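/- Let $n,k,\ell$ be natural numbers with $1\le k<n$ and $\ell=n-k-1$. Let $\Omega\subset\mathbb R^n$ be a compact domain with smooth boundary (a compact set which near each of its boundary points has the form $\{\rho\le 0\}$ with $\rho$ smooth and $d\rho\neq 0$; connectedness is not needed), and let $V_1,\dots,V_k$ be vector fields, smooth on $\Omega$ (up to the boundary), which commute ($[V_i,V_j]=0$ on $\Omega$), are divergence-free and are tangent to $\partial\Omega$. Put $V=V_1\wedge\dots\wedge V_k$. Notation. The space $\Lambda^r\mathbb R^n$ of $r$-vectors carries the inner product with $(u_1\wedge\dots\wedge u_r)\cdot(v_1\wedge\dots\wedge v_r)=\det\langle u_i,v_j\rangle$. The Hodge operator $*:\Lambda^r\mathbb R^n\to\Lambda^{n-r}\mathbb R^n$ is the linear map with $*(e_{i_1}\wedge\dots\wedge e_{i_r})=\operatorname{sign}(i_1,\dots,i_r,j_1,\dots,j_{n-r})\,e_{j_1}\wedge\dots\wedge e_{j_{n-r}}$, where $i_1<\dots<i_r$, $j_1<\dots<j_{n-r}$ and $(i_1,\dots,i_r,j_1,\dots,j_{n-r})$ is a permutation of $(1,\dots,n)$; the cross product is $u\times v=*(u\wedge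 v)$. Let $j$ be the isomorphism $j(U)(W)=U\cdot W$ from $r$-vectors to alternating $r$-forms. For an $r$-vector field $X$ on $\Omega$ put $\nabla X=j^{-1}d(jX)$ and $\operatorname{rot}(X)=(-1)^{(r+1)(n-r-1)}*(\nabla X)$, an $(n-r-1)$-vector field. At points of $\partial\Omega$ derivatives are taken within $\Omega$. Let $a_n$ be the $(n-1)$-volume of the unit sphere in $\mathbb R^n$. Then for every $x\in\Omega$ (boundary points included) the integrand below is integrable over $\Omega$, the $\ell$-vector field $$BS(V)(x)=\frac{(-1)^k}{a_n}\int_\Omega\frac{x-y}{\|x-y\|^n}\times V(y)\,dy$$ is differentiable at $x$ (within $\Omega$), and $$\operatorname{rot}(BS(V))(x)=V(x).$$ -/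

import Mathlib

open scoped ContDiff

noncomputable section

namespace Multivector

/-- Euclidean space `ℝⁿ`. -/
abbrev Space (n : ℕ) : Type := EuclideanSpace ℝ (Fin n)

/-- `k`-vectors on `ℝⁿ`. Mathlib's inner product on `⋀[ℝ]^k` of a Euclidean space is
`(u₁ ∧ ⋯ ∧ u_k) · (v₁ ∧ ⋯ ∧ v_k) = det ⟨uᵢ, vⱼ⟩`. -/
abbrev MultiVec (n k : ℕ) : Type := ⋀[ℝ]^k (Space n)

/-- The basis `e_I = e_{i₁} ∧ ⋯ ∧ e_{i_k}`, `I = {i₁ < ⋯ < i_k}`, of the space of `k`-vectors. -/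
def stdBasis (n k : ℕ) : Module.Basis (Set.powersetCard (Fin n) k) ℝ (MultiVec n k) :=
  (EuclideanSpace.basisFun (Fin n) ℝ).toBasis.exteriorPower k

/-- The permutation `(i₁, …, i_r, j₁, …, j_s)` of the `n` indices, where `i₁ < ⋯ < i_r` are the
elements of `I` and `j₁ < ⋯ < j_s` those of its complement. -/
def shuffle {n r s : ℕ} (h : r + s = n) (I : Set.powersetCard (Fin n) r) :
    Equiv.Perm (Fin n) :=
  ((finCongr h.symm).trans finSumFinEquiv.symm).trans
    (finSumEquivOfFinset (s := (I : Finset (Fin n))) (m := r) (n := s) I.2 (by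
      have hI : (I : Finset (Fin n)).card = r := I.2
      rw [Finset.card_compl, hI, Fintype.card_fin]
      omega))

/-- The Hodge operator on `r`-vectors, `r + s = n`: the linear map with
`*e_I = sign(I, Iᶜ) e_{Iᶜ}`. -/
def hodge {n r s : ℕ} (h : r + s = n) : MultiVec n r →ₗ[ℝ] MultiVec n s :=
  (stdBasis n r).constr ℝ fun I =>
    (((Equiv.Perm.sign (shuffle h I) : ℤˣ) : ℤ) : ℝ) •
      stdBasis n s (Set.powersetCard.compl (by rw [Fintype.card_fin]; omega) I)

/-- The exterior product of an `r`-vector and an `s`-vector. -/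
def wedge {n r s : ℕ} (u : MultiVec n r) (v : MultiVec n s) : MultiVec n (r + s) :=
  ⟨(u : ExteriorAlgebra ℝ (Space n)) * (v : ExteriorAlgebra ℝ (Space n)),
    SetLike.mul_mem_graded u.2 v.2⟩

/-- The generalized cross product `u × v = *(u ∧ v)`. -/
def cross {n r s m : ℕ} (h : r + s + m = n) (u : MultiVec n r) (v : MultiVec n s) :
    MultiVec n m :=
  hodge h (wedge u v)

/-- A vector regarded as a `1`-vector. -/
def ofVec {n : ℕ} (u : Space n) : MultiVec n 1 := exteriorPower.ιMulti ℝ 1 fun _ => u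

/-- The exterior product `v₁ ∧ ⋯ ∧ v_k` of `k` vectors. -/
def wedgeProd {n k : ℕ} (v : Fin k → Space n) : MultiVec n k := exteriorPower.ιMulti ℝ k v

theorem continuous_multilinear {n k : ℕ} (f : MultilinearMap ℝ (fun _ : Fin k => Space n) ℝ) :
    Continuous f := by
  have h : ∀ v : Fin k → Space n, f v =
      ∑ r : Fin k → Fin n, (∏ i, v i (r i)) • f fun i => EuclideanSpace.single (r i) 1 := by
    intro v
    have hv : v = fun i => ∑ j, v i j • (EuclideanSpace.single j 1 : Space n) := by
      funext i
      simpa using ((EuclideanSpace.basisFun (Fin n) ℝ).sum_repr (v i)).symm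
    conv_lhs => rw [hv]
    rw [MultilinearMap.map_sum]
    exact Finset.sum_congr rfl fun r _ => f.map_smul_univ _ _
  rw [show (f : (Fin k → Space n) → ℝ) = _ from funext h]
  fun_prop

/-- On a finite-dimensional space every alternating form is continuous. -/
def altEquiv (n k : ℕ) :
    ((Space n) [⋀^Fin k]→ₗ[ℝ] ℝ) ≃ₗ[ℝ] ((Space n) [⋀^Fin k]→L[ℝ] ℝ) where
  toFun f := { f with cont := continuous_multilinear f.toMultilinearMap }
  invFun f := f.toAlternatingMap
  map_add' _ _ := rfl
  map_smul' _ _ := rfl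
  left_inv _ := rfl
  right_inv _ := rfl

/-- The isomorphism `j` from `k`-vectors to alternating `k`-forms, `j(U)(V) = U · V`. -/
def toForm (n k : ℕ) : MultiVec n k ≃ₗ[ℝ] ((Space n) [⋀^Fin k]→L[ℝ] ℝ) :=
  ((InnerProductSpace.toDual ℝ (MultiVec n k)).toLinearEquiv.trans
    LinearMap.toContinuousLinearMap.symm).trans
      (exteriorPower.alternatingMapLinearEquiv.symm.trans (altEquiv n k))

theorem toForm_apply {n k : ℕ} (U : MultiVec n k) (v : Fin k → Space n) :
    toForm n k U v = inner ℝ U (wedgeProd v) := rfl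

/-- The extended gradient `∇X = j⁻¹ d (j X)` of a `k`-vector field on `Ω`. Derivatives at points
of `Ω` are taken within `Ω` (they are one-sided at boundary points). -/
def nabla {n k : ℕ} (Ω : Set (Space n)) (X : Space n → MultiVec n k) (x : Space n) :
    MultiVec n (k + 1) :=
  (toForm n (k + 1)).symm (extDerivWithin (fun y => toForm n k (X y)) Ω x)

/-- The curl `rot X = (-1)^((k+1)ℓ) * (∇X)` of a `k`-vector field on `Ω`, `ℓ = n - k - 1`. -/
def rot {n k l : ℕ} (h : k + 1 + l = n) (Ω : Set (Space n)) (X : Space n → MultiVec n k)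
    (x : Space n) : MultiVec n l :=
  (-1 : ℝ) ^ ((k + 1) * l) • hodge h (nabla Ω X x)

/-- The divergence `∑ᵢ ∂vᵢ/∂xᵢ` of a vector field on `Ω`. -/
def divergence {n : ℕ} (Ω : Set (Space n)) (v : Space n → Space n) (x : Space n) : ℝ :=
  ∑ i, fderivWithin ℝ v Ω x (EuclideanSpace.single i 1) i

/-- `ρ` is a smooth defining function of `Ω` on the open set `U`: `Ω ∩ U = {x ∈ U | ρ x ≤ 0}` and
`dρ` does not vanish on `U`. -/
structure IsDefiningFunction {n : ℕ} (Ω U : Set (Space n)) (ρ : Space n → ℝ) : Prop where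
  isOpen : IsOpen U
  contDiffOn : ContDiffOn ℝ ∞ ρ U
  fderiv_ne_zero : ∀ x ∈ U, fderiv ℝ ρ x ≠ 0
  mem_iff : ∀ x ∈ U, x ∈ Ω ↔ ρ x ≤ 0

/-- `Ω` has a smooth boundary: near each boundary point it has a smooth defining function. -/
def HasSmoothBoundary {n : ℕ} (Ω : Set (Space n)) : Prop :=
  ∀ p ∈ frontier Ω, ∃ U ρ, p ∈ U ∧ IsDefiningFunction Ω U ρ

/-- `v` is tangent to `∂Ω`: at each boundary point `x`, `v x` lies in the tangent space
`ker dρ_x` of the boundary. -/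
def IsTangentToBoundary {n : ℕ} (Ω : Set (Space n)) (v : Space n → Space n) : Prop :=
  ∀ U ρ, IsDefiningFunction Ω U ρ → ∀ x ∈ frontier Ω ∩ U, fderiv ℝ ρ x (v x) = 0

/-- The `(n-1)`-dimensional volume of the unit sphere in `ℝⁿ`. -/
def sphereVolume (n : ℕ) : ℝ :=
  ((MeasureTheory.volume : MeasureTheory.Measure (Space n)).toSphere).real Set.univ

/-- The integrand `(x - y) / ‖x - y‖ⁿ × V(y)` of the Biot–Savart integral. -/
def bsIntegrand {n k l : ℕ} (h : 1 + k + l = n) (V : Space n → MultiVec n k) (x y : Space n) :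
    MultiVec n l :=
  cross h (ofVec ((‖x - y‖ ^ n)⁻¹ • (x - y))) (V y)

/-- The Biot–Savart integral `((-1)^k / a_n) ∫_Ω (x - y) / ‖x - y‖ⁿ × V(y) dy`. -/
def biotSavart {n k l : ℕ} (h : 1 + k + l = n) (Ω : Set (Space n)) (V : Space n → MultiVec n k)
    (x : Space n) : MultiVec n l :=
  ((-1 : ℝ) ^ k / sphereVolume n) • ∫ y in Ω, bsIntegrand h V x y

end Multivector

end

/-!
Let `E_f(x) = ∫_Ω f(y) K(x - y) dy` with `K(z) = z / ‖z‖ⁿ`. In the standard basis `e_I` of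
`k`-vectors, with `f_I` the coordinates of `V`, the Biot–Savart field is a constant multiple of
`∑_I *(E_{f_I} ∧ e_I)`, so that everything reduces to two facts about the fields `E_f`.

*Regularity.* For `f` of class `C¹`, the field `E_f` is differentiable within `Ω` at every point of
`Ω`, boundary points included, with a symmetric differential of trace `a_n f`
(`exists_hasFDerivWithinAt_scalarField`). No singular integrals are used. If `W` is a `C¹` field
without flux through `∂Ω`, in the sense that `∫_Ω div (g W) = 0` for all `g` (`HasNoFlux`), then an
integration by parts writes the derivative of `E_f` along `W` as an integral `flowDeriv` of the
weakly singular kernels `DK(x - y)(W x - W y)` and `K(x - y)`, which is continuous on `Ω`. The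
integration by parts is done for the kernels `z / (‖z‖² + ε²)^(n/2)`; the limit `ε → 0` is uniform.
In the interior, cutoffs of constant fields serve as `W`. Near a boundary point with defining
function `ρ` and transversal vector `ν`, cutoffs of the tangential fields
`e_j - (∂_jρ / ∂_νρ) ν` do: they show that the tangential part of the differential extends
continuously to the boundary, and the symmetry and the known trace determine the rest of the
differential from it (`eq_ofBasisValues_of_symmetric`). As the differential has a limit at the
boundary point, the field is differentiable there.

*Orthogonality.* For a constant `(k-1)`-vector `C`, the contraction `Z` of `V₁ ∧ ⋯ ∧ V_k` with `C`
is tangent to the boundary, and divergence-free because the `V_i` are and commute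
(`divergence_contract`). As `K` is a gradient, `∫_Ω ⟨K(x - y), Z(y)⟩ dy = 0` for all `x ∈ Ω`
(`setIntegral_inner_kernel_eq_zero`), that is `∑_I ⟨e_I, E_{f_I} ∧ C⟩ = 0` on `Ω`; this relation may
be differentiated within `Ω`.

Finally, `rot` of the Biot–Savart field is `a_n⁻¹ ∑_I ∑_i ι_{e_i}(D_I e_i ∧ e_I)`, with `D_I` the
differential of `E_{f_I}` and `ι` the contraction. The product rule for `ι` splits this into a trace
term, which equals `V`, and terms that vanish by the differentiated orthogonality relation.
-/

noncomputable section

namespace Multivector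

open MeasureTheory Filter Topology

/-! ### Exterior algebra and the Hodge operator -/

/-- The generator `e₁ ∧ ⋯ ∧ eₙ` of the top exterior power, as an element of the exterior
algebra. -/
def volElement (n : ℕ) : ExteriorAlgebra ℝ (Space n) :=
  ExteriorAlgebra.ιMulti ℝ n fun i => EuclideanSpace.basisFun (Fin n) ℝ i

/-- `real_inner_smul_left` for the scalar action that exterior powers inherit as submodules, which
is not syntactically the one of the inner product space. -/
theorem inner_smul_left_multiVec {n k : ℕ} (a : ℝ) (x y : MultiVec n k) :
    (inner ℝ (a • x) y : ℝ) = a * inner ℝ x y :=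
  real_inner_smul_left x y a

theorem inner_smul_right_multiVec {n k : ℕ} (a : ℝ) (x y : MultiVec n k) :
    (inner ℝ x (a • y) : ℝ) = a * inner ℝ x y :=
  real_inner_smul_right x y a

theorem stdBasis_eq_orthonormalBasis (n k : ℕ) (I : Set.powersetCard (Fin n) k) :
    stdBasis n k I = (EuclideanSpace.basisFun (Fin n) ℝ).exteriorPower k I := by
  rw [stdBasis, ← OrthonormalBasis.toBasis_exteriorPower, OrthonormalBasis.coe_toBasis]

theorem inner_stdBasis {n k : ℕ} (I J : Set.powersetCard (Fin n) k) :
    inner ℝ (stdBasis n k I) (stdBasis n k J) = if I = J then (1 : ℝ) else 0 := by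
  classical
  rw [stdBasis_eq_orthonormalBasis, stdBasis_eq_orthonormalBasis]
  exact orthonormal_iff_ite.1 (OrthonormalBasis.orthonormal _) I J

theorem coe_stdBasis {n k : ℕ} (I : Set.powersetCard (Fin n) k) :
    (stdBasis n k I : ExteriorAlgebra ℝ (Space n)) =
      ExteriorAlgebra.ιMulti_family ℝ k (EuclideanSpace.basisFun (Fin n) ℝ) I := by
  rw [stdBasis, exteriorPower.basis_apply, exteriorPower.ιMulti_family_apply_coe]
  rfl

theorem hodge_stdBasis {n r s : ℕ} (h : r + s = n) (I : Set.powersetCard (Fin n) r) :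
    hodge h (stdBasis n r I) = (((Equiv.Perm.sign (shuffle h I) : ℤˣ) : ℤ) : ℝ) •
      stdBasis n s (Set.powersetCard.compl (by rw [Fintype.card_fin]; omega) I) := by
  rw [hodge, Module.Basis.constr_basis]

theorem stdBasis_mul_compl {n r s : ℕ} (h : r + s = n) (I : Set.powersetCard (Fin n) r) :
    (stdBasis n r I : ExteriorAlgebra ℝ (Space n)) *
      (stdBasis n s (Set.powersetCard.compl (by rw [Fintype.card_fin]; omega) I) :
        ExteriorAlgebra ℝ (Space n)) =
      (((Equiv.Perm.sign (shuffle h I) : ℤˣ) : ℤ) : ℝ) • volElement n := by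
  subst h
  rw [coe_stdBasis, coe_stdBasis, ExteriorAlgebra.ιMulti_mul_ιMulti]
  have : Fin.append
      ((EuclideanSpace.basisFun (Fin (r + s)) ℝ) ∘ (Set.powersetCard.ofFinEmbEquiv.symm I))
      ((EuclideanSpace.basisFun (Fin (r + s)) ℝ) ∘ (Set.powersetCard.ofFinEmbEquiv.symm
        (Set.powersetCard.compl (m := s) (by rw [Fintype.card_fin]; omega) I))) =
      (fun i => EuclideanSpace.basisFun (Fin (r + s)) ℝ i) ∘ shuffle rfl I := by
    funext i
    refine Fin.addCases (fun j => ?_) (fun j => ?_) i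
    · simp only [Fin.append_left, Function.comp_apply, shuffle, finCongr_refl,
        Equiv.trans_apply, Equiv.refl_apply, finSumFinEquiv_symm_apply_castAdd]
      rfl
    · simp only [Fin.append_right, Function.comp_apply, shuffle, finCongr_refl,
        Equiv.trans_apply, Equiv.refl_apply, finSumFinEquiv_symm_apply_natAdd]
      rfl
  rw [this, AlternatingMap.map_perm, volElement, Int.cast_smul_eq_zsmul, Units.smul_def]

/-- The Hodge operator is characterised by `P ∧ Q = ⟨*P, Q⟩ e₁ ∧ ⋯ ∧ eₙ`. -/
theorem mul_eq_inner_hodge {n r s : ℕ} (h : r + s = n) (P : MultiVec n r) (Q : MultiVec n s) :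
    (P : ExteriorAlgebra ℝ (Space n)) * (Q : ExteriorAlgebra ℝ (Space n)) =
      (inner ℝ (hodge h P) Q : ℝ) • volElement n := by
  classical
  let f : MultiVec n r →ₗ[ℝ] MultiVec n s →ₗ[ℝ] ExteriorAlgebra ℝ (Space n) :=
    ((LinearMap.mul ℝ (ExteriorAlgebra ℝ (Space n))).domRestrict₁₂ _ _)
  let g : MultiVec n r →ₗ[ℝ] MultiVec n s →ₗ[ℝ] ExteriorAlgebra ℝ (Space n) :=
    (((innerₗ (MultiVec n s)).comp (hodge h)).compr₂ (LinearMap.toSpanSingleton ℝ _ (volElement n)))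
  have : f = g := by
    refine (stdBasis n r).ext fun I => (stdBasis n s).ext fun J => ?_
    change (stdBasis n r I : ExteriorAlgebra ℝ (Space n)) * (stdBasis n s J :
      ExteriorAlgebra ℝ (Space n)) =
        (inner ℝ (hodge h (stdBasis n r I)) (stdBasis n s J) : ℝ) • volElement n
    rw [hodge_stdBasis, inner_smul_left_multiVec, inner_stdBasis]
    split_ifs with hJ
    · subst hJ
      rw [stdBasis_mul_compl h]
      simp
    · rw [coe_stdBasis, coe_stdBasis, ExteriorAlgebra.ιMulti_family_mul_of_not_disjoint]
      · simp
      · intro hd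
        refine hJ (Set.powersetCard.eq_iff_subset.2 ?_).symm
        rw [Set.powersetCard.coe_compl]
        exact Finset.subset_compl_iff_disjoint_left.2 hd
  exact LinearMap.congr_fun₂ this P Q

theorem volElement_ne_zero (n : ℕ) : volElement n ≠ 0 := by
  intro h0
  have h1 : wedgeProd (fun i => EuclideanSpace.basisFun (Fin n) ℝ i) = 0 := Subtype.ext h0
  have h2 := exteriorPower.inner_ιMulti_self (fun i => EuclideanSpace.basisFun (Fin n) ℝ i)
  rw [Matrix.gram_eq_one_iff_orthonormal.mpr (EuclideanSpace.basisFun (Fin n) ℝ).orthonormal,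
    Matrix.det_one, show exteriorPower.ιMulti ℝ n _ = _ from h1, inner_zero_left] at h2
  exact zero_ne_one h2

theorem inner_hodge_hodge {n r s : ℕ} (h : r + s = n) (P Q : MultiVec n r) :
    (inner ℝ (hodge h P) (hodge h Q) : ℝ) = inner ℝ P Q := by
  classical
  have : ((innerₗ (MultiVec n s)).compl₁₂ (hodge h) (hodge h)) = innerₗ (MultiVec n r) := by
    refine (stdBasis n r).ext fun I => (stdBasis n r).ext fun J => ?_
    change (inner ℝ (hodge h (stdBasis n r I)) (hodge h (stdBasis n r J)) : ℝ) =
      inner ℝ (stdBasis n r I) (stdBasis n r J)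
    rw [hodge_stdBasis, hodge_stdBasis, inner_smul_left_multiVec, inner_smul_right_multiVec,
      inner_stdBasis, inner_stdBasis]
    simp only [EmbeddingLike.apply_eq_iff_eq]
    split_ifs with hIJ
    · subst hIJ
      rcases Int.units_eq_one_or (Equiv.Perm.sign (shuffle h I)) with h | h <;> simp [h]
    · simp
  exact LinearMap.congr_fun₂ this P Q

theorem ι_mul_ιMulti {n k : ℕ} (u : Space n) (v : Fin k → Space n) :
    ExteriorAlgebra.ι ℝ u * ExteriorAlgebra.ιMulti ℝ k v =
      (-1 : ℝ) ^ k • (ExteriorAlgebra.ιMulti ℝ k v * ExteriorAlgebra.ι ℝ u) := by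
  induction k with
  | zero => simp
  | succ k ih =>
    have h1 : ExteriorAlgebra.ι ℝ u * ExteriorAlgebra.ι ℝ (v 0) =
        -(ExteriorAlgebra.ι ℝ (v 0) * ExteriorAlgebra.ι ℝ u) :=
      eq_neg_of_add_eq_zero_left (ExteriorAlgebra.ι_add_mul_swap _ _)
    rw [ExteriorAlgebra.ιMulti_succ_apply, ← mul_assoc, h1, neg_mul, mul_assoc, ih, pow_succ,
      mul_smul_comm, mul_assoc]
    simp

theorem mem_span_ιMulti {n k : ℕ} (w : MultiVec n k) :
    (w : ExteriorAlgebra ℝ (Space n)) ∈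
      Submodule.span ℝ (Set.range (ExteriorAlgebra.ιMulti ℝ k (M := Space n))) := by
  rw [ExteriorAlgebra.ιMulti_span_fixedDegree]
  exact w.2

theorem ι_mul_coe {n k : ℕ} (u : Space n) (w : MultiVec n k) :
    ExteriorAlgebra.ι ℝ u * (w : ExteriorAlgebra ℝ (Space n)) =
      (-1 : ℝ) ^ k • ((w : ExteriorAlgebra ℝ (Space n)) * ExteriorAlgebra.ι ℝ u) := by
  refine Submodule.span_induction (p := fun w _ => ExteriorAlgebra.ι ℝ u * w =
    (-1 : ℝ) ^ k • (w * ExteriorAlgebra.ι ℝ u)) ?_ ?_ ?_ ?_ (mem_span_ιMulti w)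
  · rintro _ ⟨v, rfl⟩
    exact ι_mul_ιMulti u v
  · simp
  · intro x y _ _ hx hy
    rw [mul_add, add_mul, smul_add, hx, hy]
  · intro a x _ hx
    rw [mul_smul_comm, smul_mul_assoc, hx, smul_comm]

theorem coe_mul_coe_comm {n r s : ℕ} (P : MultiVec n r) (Q : MultiVec n s) :
    (P : ExteriorAlgebra ℝ (Space n)) * (Q : ExteriorAlgebra ℝ (Space n)) =
      (-1 : ℝ) ^ (r * s) • ((Q : ExteriorAlgebra ℝ (Space n)) *
        (P : ExteriorAlgebra ℝ (Space n))) := by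
  refine Submodule.span_induction (p := fun w _ => w * (Q : ExteriorAlgebra ℝ (Space n)) =
    (-1 : ℝ) ^ (r * s) • ((Q : ExteriorAlgebra ℝ (Space n)) * w)) ?_ ?_ ?_ ?_ (mem_span_ιMulti P)
  · rintro _ ⟨v, rfl⟩
    clear P
    induction r with
    | zero => simp
    | succ r ih =>
      rw [ExteriorAlgebra.ιMulti_succ_apply, mul_assoc, ih, mul_smul_comm, ← mul_assoc, ι_mul_coe,
        smul_mul_assoc, smul_smul, ← pow_add, mul_assoc]
      congr 2
      ring
  · simp
  · intro x y _ _ hx hy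
    rw [mul_add, add_mul, smul_add, hx, hy]
  · intro a x _ hx
    rw [mul_smul_comm, smul_mul_assoc, hx, smul_comm]

theorem coe_ofVec {n : ℕ} (u : Space n) :
    (ofVec u : ExteriorAlgebra ℝ (Space n)) = ExteriorAlgebra.ι ℝ u := by
  rw [ofVec, exteriorPower.ιMulti_apply_coe]
  simp [ExteriorAlgebra.ιMulti_apply]

/-- The exterior product `u ∧ w` of a vector and a `k`-vector, as an element of degree `k + 1`. -/
def wedgeVec {n k : ℕ} : Space n →ₗ[ℝ] MultiVec n k →ₗ[ℝ] MultiVec n (k + 1) :=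
  LinearMap.mk₂ ℝ (fun u w => ⟨ExteriorAlgebra.ι ℝ u * (w : ExteriorAlgebra ℝ (Space n)), by
      have := SetLike.mul_mem_graded (ofVec u).2 w.2
      rwa [coe_ofVec, add_comm 1 k] at this⟩)
    (fun a b c => Subtype.ext (by simp [add_mul])) (fun a b c => Subtype.ext (by simp))
    (fun a b c => Subtype.ext (by simp [mul_add])) (fun a b c => Subtype.ext (by simp))

theorem coe_wedgeVec {n k : ℕ} (u : Space n) (w : MultiVec n k) :
    (wedgeVec u w : ExteriorAlgebra ℝ (Space n)) =
      ExteriorAlgebra.ι ℝ u * (w : ExteriorAlgebra ℝ (Space n)) := rfl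

theorem coe_wedge_ofVec {n k : ℕ} (u : Space n) (w : MultiVec n k) :
    (wedge (ofVec u) w : ExteriorAlgebra ℝ (Space n)) =
      ExteriorAlgebra.ι ℝ u * (w : ExteriorAlgebra ℝ (Space n)) := by
  rw [← coe_ofVec]; rfl

theorem inner_congr_coe {n r r' : ℕ} (h : r = r') {A B : MultiVec n r} {A' B' : MultiVec n r'}
    (hA : (A : ExteriorAlgebra ℝ (Space n)) = A') (hB : (B : ExteriorAlgebra ℝ (Space n)) = B') :
    (inner ℝ A B : ℝ) = inner ℝ A' B' := by
  subst h
  rw [Subtype.ext hA, Subtype.ext hB]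

/-- The Hodge operator turns exterior multiplication by a vector into contraction:
`*(u ∧ *A) = (-1)^(lk) ι_u A`, where `ι_u` is the adjoint of `u ∧ ·`. -/
theorem inner_hodge_wedgeVec_hodge {n k l : ℕ} (h : 1 + k + l = n) (h' : l + 1 + k = n)
    (u v : Space n) (w B : MultiVec n k) :
    (inner ℝ (hodge h' (wedgeVec u (hodge h (wedge (ofVec v) w)))) B : ℝ) =
      (-1) ^ (l * k) * inner ℝ (wedgeVec v w) (wedgeVec u B) := by
  have key : (inner ℝ (hodge h' (wedgeVec u (hodge h (wedge (ofVec v) w)))) B : ℝ) • volElement n =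
      ((-1) ^ (l * k) * inner ℝ (wedgeVec v w) (wedgeVec u B) : ℝ) • volElement n := by
    rw [← mul_eq_inner_hodge, coe_wedgeVec, ι_mul_coe, smul_mul_assoc, mul_assoc,
      ← coe_wedge_ofVec, coe_mul_coe_comm, mul_eq_inner_hodge h, inner_hodge_hodge,
      inner_congr_coe (add_comm 1 k) (A' := wedgeVec u B) (B' := wedgeVec v w)
        (coe_wedge_ofVec u B) (coe_wedge_ofVec v w), smul_smul, smul_smul,
      real_inner_comm, ← pow_add]
    congr 2
    rw [show l + l * (1 + k) = l * k + (l + l) by ring, pow_add, Even.neg_one_pow ⟨l, rfl⟩, mul_one]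
  exact smul_left_injective ℝ (volElement_ne_zero n) key

theorem wedgeVec_wedgeProd {n k : ℕ} (u : Space n) (v : Fin k → Space n) :
    wedgeVec u (wedgeProd v) = wedgeProd (Fin.cons u v : Fin (k + 1) → Space n) := by
  apply Subtype.ext
  rw [coe_wedgeVec]
  simp only [wedgeProd, exteriorPower.ιMulti_apply_coe]
  rw [ExteriorAlgebra.ιMulti_succ_apply]
  rfl

theorem wedgeProd_induction {n k : ℕ} {p : MultiVec n k → Prop} (w : MultiVec n k)
    (hp : ∀ v, p (wedgeProd v)) (h0 : p 0) (hadd : ∀ x y, p x → p y → p (x + y))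
    (hsmul : ∀ (a : ℝ) x, p x → p (a • x)) : p w := by
  have hw : w ∈ Submodule.span ℝ (Set.range (exteriorPower.ιMulti ℝ k (M := Space n))) := by
    rw [exteriorPower.ιMulti_span]; trivial
  refine Submodule.span_induction (p := fun x _ => p x) ?_ h0 (fun x y _ _ => hadd x y)
    (fun a x _ => hsmul a x) hw
  rintro _ ⟨v, rfl⟩
  exact hp v

/-- Expansion of the Gram determinant along the first vector. -/
theorem inner_wedgeVec_wedgeProd {n k : ℕ} (v : Space n) (w : MultiVec n k)
    (u : Fin (k + 1) → Space n) :
    (inner ℝ (wedgeVec v w) (wedgeProd u) : ℝ) =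
      ∑ a : Fin (k + 1), (-1) ^ (a : ℕ) * (inner ℝ v (u a) : ℝ) *
        inner ℝ w (wedgeProd (a.removeNth u)) := by
  induction w using wedgeProd_induction with
  | hp x =>
    rw [wedgeVec_wedgeProd]
    simp only [wedgeProd, exteriorPower.inner_ιMulti_ιMulti]
    rw [Matrix.det_succ_column_zero]
    rfl
  | h0 => simp
  | hadd x y hx hy =>
    rw [map_add, inner_add_left, hx, hy, ← Finset.sum_add_distrib]
    simp only [inner_add_left, mul_add]
  | hsmul a x hx =>
    rw [map_smul, inner_smul_left_multiVec, hx, Finset.mul_sum]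
    refine Finset.sum_congr rfl fun i _ => ?_
    rw [inner_smul_left_multiVec]
    ring

/-- `∇X = ∑ᵢ eᵢ ∧ ∂ᵢX`. -/
theorem nabla_eq_sum {n l : ℕ} {Ω : Set (Space n)} {x : Space n} {X : Space n → MultiVec n l}
    {X' : Space n →L[ℝ] MultiVec n l} (hX : HasFDerivWithinAt X X' Ω x)
    (hu : UniqueDiffWithinAt ℝ Ω x) :
    nabla Ω X x = ∑ i, wedgeVec (EuclideanSpace.basisFun (Fin n) ℝ i)
      (X' (EuclideanSpace.basisFun (Fin n) ℝ i)) := by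
  rw [nabla, LinearEquiv.symm_apply_eq]
  ext u
  have hd : fderivWithin ℝ (fun y => toForm n l (X y)) Ω x =
      (LinearMap.toContinuousLinearMap (toForm n l).toLinearMap).comp X' :=
    (((LinearMap.toContinuousLinearMap (toForm n l).toLinearMap).hasFDerivAt
      (x := X x)).comp_hasFDerivWithinAt x hX).fderivWithin hu
  rw [extDerivWithin, hd, ContinuousAlternatingMap.alternatizeUncurryFin_apply, toForm_apply,
    sum_inner]
  simp only [inner_wedgeVec_wedgeProd]
  rw [Finset.sum_comm]
  refine Finset.sum_congr rfl fun a _ => ?_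
  have hua : X' (u a) = ∑ i, (inner ℝ (EuclideanSpace.basisFun (Fin n) ℝ i) (u a) : ℝ) •
      X' (EuclideanSpace.basisFun (Fin n) ℝ i) := by
    conv_lhs => rw [← (EuclideanSpace.basisFun (Fin n) ℝ).sum_repr' (u a)]
    simp only [map_sum, map_smul]
  simp only [ContinuousLinearMap.comp_apply]
  rw [hua]
  change _ • (toForm n l _) _ = _
  rw [toForm_apply, sum_inner, zsmul_eq_mul, Finset.mul_sum]
  refine Finset.sum_congr rfl fun i _ => ?_
  rw [inner_smul_left_multiVec]
  simp
  ring

/-! ### The Biot–Savart kernel and its regularisation -/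

/-- The regularised Biot–Savart kernel `z / (‖z‖² + ε²)^(n/2)`; `ε = 0` gives the kernel
`z / ‖z‖ⁿ` itself. -/
def kernel {n : ℕ} (ε : ℝ) (z : Space n) : Space n := (‖z‖ ^ 2 + ε ^ 2) ^ (-(n : ℝ) / 2) • z

/-- The derivative of the regularised kernel, for `ε = 0` away from the origin. -/
def kernelDeriv {n : ℕ} (ε : ℝ) (z : Space n) : Space n →L[ℝ] Space n :=
  (‖z‖ ^ 2 + ε ^ 2) ^ (-(n : ℝ) / 2) • ContinuousLinearMap.id ℝ (Space n) -
    (n * (‖z‖ ^ 2 + ε ^ 2) ^ (-(n : ℝ) / 2 - 1)) • (innerSL ℝ z).smulRight z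

/-- The size `‖z‖^(1 - n)` of the Biot–Savart kernel. -/
def majorant {n : ℕ} (z : Space n) : ℝ := ‖z‖ * (‖z‖ ^ n)⁻¹

theorem sq_rpow_neg_half {n : ℕ} (r : ℝ) (hr : 0 ≤ r) :
    (r ^ 2) ^ (-(n : ℝ) / 2) = (r ^ n)⁻¹ := by
  rw [← Real.rpow_natCast r 2, ← Real.rpow_mul hr, show ((2 : ℕ) : ℝ) * (-(n : ℝ) / 2) = -n by
    push_cast; ring, Real.rpow_neg hr, Real.rpow_natCast]

theorem kernel_zero_eq {n : ℕ} (z : Space n) : kernel 0 z = (‖z‖ ^ n)⁻¹ • z := by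
  rw [kernel, zero_pow two_ne_zero, add_zero, sq_rpow_neg_half _ (norm_nonneg z)]

theorem rpow_le_inv_pow {n : ℕ} (ε : ℝ) {z : Space n} (hz : z ≠ 0) :
    (‖z‖ ^ 2 + ε ^ 2) ^ (-(n : ℝ) / 2) ≤ (‖z‖ ^ n)⁻¹ := by
  rw [← sq_rpow_neg_half _ (norm_nonneg z)]
  apply Real.rpow_le_rpow_of_nonpos
  · have := norm_pos_iff.2 hz; positivity
  · nlinarith [sq_nonneg ε]
  · have : (0 : ℝ) ≤ n := Nat.cast_nonneg n
    linarith

theorem majorant_nonneg {n : ℕ} (z : Space n) : 0 ≤ majorant z := by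
  unfold majorant; positivity

theorem norm_kernel_le {n : ℕ} (ε : ℝ) (z : Space n) : ‖kernel ε z‖ ≤ majorant z := by
  rcases eq_or_ne z 0 with rfl | hz
  · simp [kernel, majorant]
  rw [kernel, norm_smul, majorant, mul_comm, Real.norm_of_nonneg (by positivity)]
  gcongr
  exact rpow_le_inv_pow ε hz

/-- Uniformly in `ε`, the derivative of the kernel is no more singular than the kernel itself once
multiplied by `‖z‖`. -/
theorem norm_kernelDeriv_mul_le {n : ℕ} (ε : ℝ) (z : Space n) :
    ‖kernelDeriv ε z‖ * ‖z‖ ≤ (n + 1) * majorant z := by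
  rcases eq_or_ne z 0 with rfl | hz
  · simp [majorant]
  have hz' : 0 < ‖z‖ := norm_pos_iff.2 hz
  have hs : 0 < ‖z‖ ^ 2 + ε ^ 2 := by positivity
  have h1 : ‖kernelDeriv ε z‖ ≤ (n + 1) * (‖z‖ ^ 2 + ε ^ 2) ^ (-(n : ℝ) / 2) := by
    refine (norm_sub_le _ _).trans ?_
    rw [norm_smul, norm_smul, Real.norm_of_nonneg (by positivity),
      Real.norm_of_nonneg (by positivity), ContinuousLinearMap.norm_smulRight_apply,
      innerSL_apply_norm, Real.rpow_sub_one hs.ne', add_comm, add_mul]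
    have h2 : ‖ContinuousLinearMap.id ℝ (Space n)‖ ≤ 1 := ContinuousLinearMap.norm_id_le
    have h3 : ‖z‖ * ‖z‖ / (‖z‖ ^ 2 + ε ^ 2) ≤ 1 :=
      (div_le_one hs).2 (by nlinarith [sq_nonneg ε])
    refine add_le_add ?_ ?_
    · calc _ = n * (‖z‖ ^ 2 + ε ^ 2) ^ (-(n : ℝ) / 2) *
            (‖z‖ * ‖z‖ / (‖z‖ ^ 2 + ε ^ 2)) := by ring
        _ ≤ _ := mul_le_of_le_one_right (by positivity) h3
    · rw [one_mul]
      exact mul_le_of_le_one_right (by positivity) h2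
  calc _ ≤ ((n + 1) * (‖z‖ ^ n)⁻¹) * ‖z‖ := by
        gcongr
        refine h1.trans ?_
        gcongr
        exact rpow_le_inv_pow ε hz
    _ = _ := by rw [majorant]; ring

theorem hasFDerivAt_kernel {n : ℕ} {ε : ℝ} (hε : 0 < ε) (z : Space n) :
    HasFDerivAt (kernel ε) (kernelDeriv ε z) z := by
  have hs : ‖z‖ ^ 2 + ε ^ 2 ≠ 0 := by positivity
  have h1 : HasFDerivAt (fun z : Space n => ‖z‖ ^ 2 + ε ^ 2) (2 • innerSL ℝ z) z :=
    (hasStrictFDerivAt_norm_sq z).hasFDerivAt.add_const _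
  have h2 := (h1.rpow_const (p := -(n : ℝ) / 2) (Or.inl hs)).smul (hasFDerivAt_id z)
  refine h2.congr_fderiv ?_
  ext1 v
  simp only [kernelDeriv, sub_apply, add_apply, smul_apply,
    ContinuousLinearMap.smulRight_apply, id, ContinuousLinearMap.id_apply, innerSL_apply_apply,
    smul_eq_mul, nsmul_eq_mul]
  module

theorem contDiff_kernel {n : ℕ} {ε : ℝ} (hε : 0 < ε) :
    ContDiff ℝ ∞ (kernel ε : Space n → Space n) := by
  refine ContDiff.smul (ContDiff.rpow_const_of_ne ?_ fun z => by positivity) contDiff_id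
  exact (contDiff_id.norm_sq ℝ).add contDiff_const

theorem continuous_kernelDeriv {n : ℕ} {ε : ℝ} (hε : 0 < ε) :
    Continuous (kernelDeriv ε : Space n → _) := by
  have : (kernelDeriv ε : Space n → _) = fderiv ℝ (kernel ε) :=
    funext fun z => (hasFDerivAt_kernel hε z).fderiv.symm
  rw [this]
  exact (contDiff_kernel hε).continuous_fderiv (by simp)

theorem inner_kernelDeriv_comm {n : ℕ} (ε : ℝ) (z u v : Space n) :
    (inner ℝ (kernelDeriv ε z u) v : ℝ) = inner ℝ u (kernelDeriv ε z v) := by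
  simp only [kernelDeriv, sub_apply, smul_apply,
    ContinuousLinearMap.smulRight_apply, ContinuousLinearMap.id_apply, inner_sub_left,
    inner_sub_right, real_inner_smul_left, real_inner_smul_right, innerSL_apply_apply]
  rw [real_inner_comm z u]
  ring

/-- The divergence of the regularised kernel. -/
theorem sum_inner_kernelDeriv {n : ℕ} {ε : ℝ} (hε : 0 < ε) (z : Space n) :
    ∑ i, (inner ℝ (EuclideanSpace.basisFun (Fin n) ℝ i)
      (kernelDeriv ε z (EuclideanSpace.basisFun (Fin n) ℝ i)) : ℝ) =
      n * ε ^ 2 * (‖z‖ ^ 2 + ε ^ 2) ^ (-(n : ℝ) / 2 - 1) := by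
  have hs : ‖z‖ ^ 2 + ε ^ 2 ≠ 0 := by positivity
  have h1 : ∀ i, (inner ℝ (EuclideanSpace.basisFun (Fin n) ℝ i)
      (kernelDeriv ε z (EuclideanSpace.basisFun (Fin n) ℝ i)) : ℝ) =
      (‖z‖ ^ 2 + ε ^ 2) ^ (-(n : ℝ) / 2) -
        (n * (‖z‖ ^ 2 + ε ^ 2) ^ (-(n : ℝ) / 2 - 1)) * (z i) ^ 2 := by
    intro i
    simp only [kernelDeriv, sub_apply, smul_apply, ContinuousLinearMap.smulRight_apply,
      ContinuousLinearMap.id_apply, innerSL_apply_apply, inner_sub_right,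
      EuclideanSpace.basisFun_apply, EuclideanSpace.inner_single_left,
      EuclideanSpace.inner_single_right]
    simp
    left
    ring
  simp only [h1, Finset.sum_sub_distrib, ← Finset.mul_sum, ← EuclideanSpace.real_norm_sq_eq,
    Real.rpow_sub_one hs]
  simp
  field_simp
  ring

theorem locallyIntegrable_majorant {n : ℕ} (hn : 1 ≤ n) :
    LocallyIntegrable (majorant : Space n → ℝ) := by
  refine locallyIntegrable_of_norm_le_rpow (C := 1) (α := (n : ℝ) - 1) ?_ ?_ ?_ ?_
  · simpa using hn
  · simp
  · filter_upwards with z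
    rw [Real.norm_of_nonneg (majorant_nonneg z), one_mul, majorant]
    rcases eq_or_ne z 0 with rfl | hz
    · simp only [norm_zero, zero_mul]
      positivity
    rw [neg_sub, Real.rpow_sub (norm_pos_iff.2 hz), Real.rpow_one, Real.rpow_natCast]
    rfl
  · unfold majorant
    exact (by fun_prop : Measurable fun z : Space n => ‖z‖ * (‖z‖ ^ n)⁻¹).aestronglyMeasurable

theorem integrableOn_majorant {n : ℕ} (hn : 1 ≤ n) (L : ℝ) :
    IntegrableOn (majorant : Space n → ℝ) (Metric.closedBall 0 L) :=
  (locallyIntegrable_majorant hn).integrableOn_isCompact (isCompact_closedBall _ _)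

/-- A sequence of regularisation parameters that tends to zero. -/
def eps (m : ℕ) : ℝ := ((m : ℝ) + 1)⁻¹

theorem eps_pos (m : ℕ) : 0 < eps m := by unfold eps; positivity

theorem tendsto_eps : Tendsto eps atTop (𝓝 0) :=
  tendsto_inv_atTop_zero.comp (tendsto_atTop_add_const_right _ _ tendsto_natCast_atTop_atTop)

theorem tendsto_rpow_eps {n : ℕ} {z : Space n} (hz : z ≠ 0) (p : ℝ) :
    Tendsto (fun m => (‖z‖ ^ 2 + eps m ^ 2) ^ p) atTop (𝓝 ((‖z‖ ^ 2 + (0 : ℝ) ^ 2) ^ p)) := by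
  have hz' := norm_pos_iff.2 hz
  exact (tendsto_const_nhds.add (tendsto_eps.pow 2)).rpow_const (Or.inl (by positivity))

theorem tendsto_kernel {n : ℕ} {z : Space n} (hz : z ≠ 0) :
    Tendsto (fun m => kernel (eps m) z) atTop (𝓝 (kernel 0 z)) :=
  (tendsto_rpow_eps hz _).smul_const z

theorem tendsto_kernelDeriv {n : ℕ} {z : Space n} (hz : z ≠ 0) :
    Tendsto (fun m => kernelDeriv (eps m) z) atTop (𝓝 (kernelDeriv 0 z)) :=
  ((tendsto_rpow_eps hz _).smul_const _).sub
    (((tendsto_rpow_eps hz _).const_mul _).smul_const _)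

theorem measurable_kernel {n : ℕ} (ε : ℝ) : Measurable (kernel ε : Space n → _) := by
  unfold kernel; fun_prop

theorem measurable_kernelDeriv_apply {n : ℕ} (ε : ℝ) :
    Measurable (kernelDeriv ε : Space n → _) := by
  unfold kernelDeriv
  have : Measurable fun z : Space n => (innerSL ℝ z).smulRight z := by
    apply Continuous.measurable
    fun_prop
  fun_prop

/-- The error of the regularisation: it bounds the error in the kernel, and the error in its
derivative tested on a Lipschitz increment. -/
def kernelError {n : ℕ} (ε : ℝ) (z : Space n) : ℝ :=
  ‖kernel ε z - kernel 0 z‖ + ‖kernelDeriv ε z - kernelDeriv 0 z‖ * ‖z‖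

theorem kernelError_le {n : ℕ} (ε : ℝ) (z : Space n) :
    kernelError ε z ≤ (2 * n + 4) * majorant z := by
  have h1 := norm_sub_le (kernel ε z) (kernel 0 z)
  have h2 := mul_le_mul_of_nonneg_right (norm_sub_le (kernelDeriv ε z) (kernelDeriv 0 z))
    (norm_nonneg z)
  have := norm_kernel_le ε z
  have := norm_kernel_le 0 z
  have := norm_kernelDeriv_mul_le ε z
  have := norm_kernelDeriv_mul_le 0 z
  unfold kernelError
  linarith

theorem kernelError_nonneg {n : ℕ} (ε : ℝ) (z : Space n) : 0 ≤ kernelError ε z := by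
  unfold kernelError; positivity

theorem measurable_kernelError {n : ℕ} (ε : ℝ) : Measurable (kernelError ε : Space n → ℝ) := by
  unfold kernelError
  have := measurable_kernel (n := n) ε
  have := measurable_kernel (n := n) 0
  have := measurable_kernelDeriv_apply (n := n) ε
  have := measurable_kernelDeriv_apply (n := n) 0
  fun_prop

theorem integrableOn_kernelError {n : ℕ} (hn : 1 ≤ n) (ε L : ℝ) :
    IntegrableOn (kernelError ε : Space n → ℝ) (Metric.closedBall 0 L) := by
  refine Integrable.mono' ((integrableOn_majorant hn L).const_mul (2 * n + 4))
    (measurable_kernelError ε).aestronglyMeasurable ?_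
  filter_upwards with z
  rw [Real.norm_of_nonneg (kernelError_nonneg ε z)]
  exact kernelError_le ε z

theorem tendsto_integral_kernelError {n : ℕ} (hn : 1 ≤ n) (L : ℝ) :
    Tendsto (fun m => ∫ z in Metric.closedBall (0 : Space n) L, kernelError (eps m) z) atTop
      (𝓝 0) := by
  have : Nontrivial (Space n) := by
    have : Nonempty (Fin n) := ⟨⟨0, hn⟩⟩
    infer_instance
  have h := tendsto_integral_of_dominated_convergence
    (μ := volume.restrict (Metric.closedBall (0 : Space n) L))
    (F := fun m => kernelError (eps m)) (f := fun _ => 0) (fun z => (2 * n + 4) * majorant z)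
    (fun m => (measurable_kernelError _).aestronglyMeasurable)
    ((integrableOn_majorant hn L).const_mul _)
    (fun m => by
      filter_upwards with z
      rw [Real.norm_of_nonneg (kernelError_nonneg _ z)]
      exact kernelError_le _ z) ?_
  · simpa using h
  · have h0 : ∀ᵐ z ∂(volume.restrict (Metric.closedBall (0 : Space n) L)), z ≠ 0 :=
      ae_restrict_of_ae (by simp [ae_iff])
    filter_upwards [h0] with z hz
    have h1 := ((tendsto_kernel hz).sub_const (kernel 0 z)).norm
    have h2 := (((tendsto_kernelDeriv hz).sub_const (kernelDeriv 0 z)).norm).mul_const ‖z‖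
    simpa [kernelError] using h1.add h2

/-- The regularised kernel is the gradient of a function of `‖z‖²`. -/
theorem exists_potential {n : ℕ} {ε : ℝ} (hε : 0 < ε) :
    ∃ Γ : Space n → ℝ, ContDiff ℝ 1 Γ ∧ ∀ z, HasFDerivAt Γ (innerSL ℝ (kernel ε z)) z := by
  let φ : ℝ → ℝ := fun t => 2⁻¹ * (|t| + ε ^ 2) ^ (-(n : ℝ) / 2)
  have hφ : Continuous φ := by
    refine continuous_const.mul (Continuous.rpow_const (by fun_prop) fun t => Or.inl ?_)
    positivity
  let Φ : ℝ → ℝ := fun s => ∫ t in (0 : ℝ)..s, φ t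
  have hΦ : ∀ s, HasDerivAt Φ (φ s) s := fun s =>
    intervalIntegral.integral_hasDerivAt_right (hφ.intervalIntegrable _ _)
      hφ.aestronglyMeasurable.stronglyMeasurableAtFilter hφ.continuousAt
  have hd : ∀ z : Space n, HasFDerivAt (fun z : Space n => Φ (‖z‖ ^ 2))
      (innerSL ℝ (kernel ε z)) z := by
    intro z
    have h1 : HasFDerivAt (fun z : Space n => ‖z‖ ^ 2) (2 • innerSL ℝ z) z :=
      (hasStrictFDerivAt_norm_sq z).hasFDerivAt
    refine ((hΦ (‖z‖ ^ 2)).comp_hasFDerivAt z h1).congr_fderiv ?_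
    ext v
    simp [φ, kernel]
    ring
  refine ⟨_, ?_, hd⟩
  rw [contDiff_one_iff_fderiv]
  refine ⟨fun z => (hd z).differentiableAt, ?_⟩
  rw [show fderiv ℝ (fun z : Space n => Φ (‖z‖ ^ 2)) = fun z => innerSL ℝ (kernel ε z) from
    funext fun z => (hd z).fderiv]
  exact (innerSL ℝ).continuous.comp (contDiff_kernel hε).continuous

theorem sphereVolume_pos {n : ℕ} (hn : 1 ≤ n) : 0 < sphereVolume n := by
  have : Nonempty (Fin n) := ⟨⟨0, hn⟩⟩
  rw [sphereVolume, Measure.toSphere_real_apply_univ]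
  have h1 : 0 < (volume : Measure (Space n)).real (Metric.ball 0 1) :=
    ENNReal.toReal_pos (Metric.measure_ball_pos _ _ one_pos).ne' measure_ball_lt_top.ne
  have h2 : 0 < (Module.finrank ℝ (Space n) : ℝ) := by simp; omega
  exact mul_pos h2 h1

/-- The integrand is the derivative of `r ^ n * (r ^ 2 + 1) ^ (-n / 2)`. -/
theorem integral_Ioi_pow_mul_rpow {n : ℕ} (hn : 1 ≤ n) :
    ∫ r in Set.Ioi (0 : ℝ), r ^ (n - 1) * (n * (r ^ 2 + 1) ^ (-(n : ℝ) / 2 - 1)) = 1 := by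
  let g : ℝ → ℝ := fun r => r ^ n * (r ^ 2 + 1) ^ (-(n : ℝ) / 2)
  have hg : ∀ r : ℝ, HasDerivAt g (r ^ (n - 1) * (n * (r ^ 2 + 1) ^ (-(n : ℝ) / 2 - 1))) r := by
    intro r
    have hs : r ^ 2 + 1 ≠ 0 := by positivity
    have h1 : HasDerivAt (fun r : ℝ => r ^ 2 + 1) (2 * r) r := by
      simpa using (hasDerivAt_pow 2 r).add_const 1
    refine ((hasDerivAt_pow n r).mul (h1.rpow_const (p := -(n : ℝ) / 2) (Or.inl hs))).congr_deriv ?_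
    obtain ⟨k, rfl⟩ : ∃ k, n = k + 1 := ⟨n - 1, by omega⟩
    rw [Real.rpow_sub_one hs, add_tsub_cancel_right]
    field_simp
    ring
  have hlim : Tendsto g atTop (𝓝 1) := by
    have h1 : Tendsto (fun r : ℝ => (1 + (r ^ 2)⁻¹) ^ (-(n : ℝ) / 2)) atTop
        (𝓝 ((1 + 0) ^ (-(n : ℝ) / 2))) := by
      refine Tendsto.rpow_const ?_ (Or.inl (by norm_num))
      exact tendsto_const_nhds.add (tendsto_inv_atTop_zero.comp (tendsto_pow_atTop two_ne_zero))
    rw [add_zero, Real.one_rpow] at h1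
    refine h1.congr' ?_
    filter_upwards [eventually_gt_atTop 0] with r hr
    have : r ^ 2 + 1 = r ^ 2 * (1 + (r ^ 2)⁻¹) := by field_simp
    simp only [g]
    rw [this, Real.mul_rpow (by positivity) (by positivity), sq_rpow_neg_half r hr.le, ← mul_assoc,
      mul_inv_cancel₀ (by positivity), one_mul]
  rw [integral_Ioi_of_hasDerivAt_of_nonneg (hg 0).continuousAt.continuousWithinAt
    (fun r _ => hg r) (fun r hr => ?_) hlim]
  · have : n ≠ 0 := by omega
    simp [g, this]
  · have := Set.mem_Ioi.1 hr
    positivity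

/-- The divergence of the regularised kernel is an approximate identity of mass `aₙ`. -/
theorem tendsto_integral_div_kernel {n : ℕ} (hn : 1 ≤ n) {g : Space n → ℝ} (hg : Integrable g)
    {x : Space n} (hx : ContinuousAt g x) :
    Tendsto (fun m => ∫ y, (n * eps m ^ 2 *
      (‖x - y‖ ^ 2 + eps m ^ 2) ^ (-(n : ℝ) / 2 - 1)) * g y) atTop (𝓝 (sphereVolume n * g x)) := by
  have hne : Nonempty (Fin n) := ⟨⟨0, hn⟩⟩
  let φ : Space n → ℝ := fun z => (sphereVolume n)⁻¹ * (n * (‖z‖ ^ 2 + 1) ^ (-(n : ℝ) / 2 - 1))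
  have ha := sphereVolume_pos hn
  have h1 : ∫ z, φ z = 1 := by
    rw [integral_const_mul, integral_fun_norm_addHaar volume
      (fun r => (n * (r ^ 2 + 1) ^ (-(n : ℝ) / 2 - 1)))]
    simp only [finrank_euclideanSpace, Fintype.card_fin, smul_eq_mul]
    rw [integral_Ioi_pow_mul_rpow hn, sphereVolume, Measure.toSphere_real_apply_univ]
    simp only [finrank_euclideanSpace, Fintype.card_fin, mul_one, nsmul_eq_mul]
    rw [inv_mul_cancel₀]
    have := ha.ne'
    rwa [sphereVolume, Measure.toSphere_real_apply_univ, finrank_euclideanSpace,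
      Fintype.card_fin] at this
  have h2 : Tendsto (fun z : Space n => ‖z‖ ^ Module.finrank ℝ (Space n) * φ z)
      (Bornology.cobounded (Space n)) (𝓝 0) := by
    have h3 : Tendsto (fun z : Space n => ((sphereVolume n)⁻¹ * n) * (‖z‖ ^ 2)⁻¹)
        (Bornology.cobounded (Space n)) (𝓝 (((sphereVolume n)⁻¹ * n) * 0)) :=
      (tendsto_inv_atTop_zero.comp ((tendsto_pow_atTop two_ne_zero).comp
        tendsto_norm_cobounded_atTop)).const_mul _
    rw [mul_zero] at h3
    refine squeeze_zero' (Eventually.of_forall fun z => by positivity) ?_ h3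
    filter_upwards [Bornology.eventually_ne_cobounded (0 : Space n)] with z hz
    have hz' := norm_pos_iff.2 hz
    have h4 := rpow_le_inv_pow (1 : ℝ) hz
    have h5 : (‖z‖ ^ 2 + 1)⁻¹ ≤ (‖z‖ ^ 2)⁻¹ := by gcongr; linarith
    simp only [finrank_euclideanSpace, Fintype.card_fin, φ]
    rw [one_pow] at h4
    rw [Real.rpow_sub_one (by positivity), div_eq_mul_inv]
    calc _ = ((sphereVolume n)⁻¹ * n) * ((‖z‖ ^ n * (‖z‖ ^ 2 + 1) ^ (-(n : ℝ) / 2)) *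
          (‖z‖ ^ 2 + 1)⁻¹) := by ring
      _ ≤ ((sphereVolume n)⁻¹ * n) * ((‖z‖ ^ n * (‖z‖ ^ n)⁻¹) * (‖z‖ ^ 2)⁻¹) := by gcongr
      _ = _ := by rw [mul_inv_cancel₀ (by positivity), one_mul]
  have h6 := (tendsto_integral_comp_smul_smul_of_integrable' (μ := volume)
    (fun z => by positivity) h1 h2 hg hx).const_mul (sphereVolume n)
  have h7 : Tendsto (fun m : ℕ => (m : ℝ) + 1) atTop atTop :=
    tendsto_atTop_add_const_right _ _ tendsto_natCast_atTop_atTop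
  refine (h6.comp h7).congr fun m => ?_
  simp only [Function.comp_apply]
  rw [← integral_const_mul]
  refine integral_congr_ae (Eventually.of_forall fun y => ?_)
  have hc : (0 : ℝ) < m + 1 := by positivity
  have h8 : ‖((m : ℝ) + 1) • (x - y)‖ ^ 2 + 1 =
      ((m : ℝ) + 1) ^ 2 * (‖x - y‖ ^ 2 + eps m ^ 2) := by
    rw [norm_smul, Real.norm_of_nonneg hc.le, eps]
    field_simp
  simp only [φ, smul_eq_mul, finrank_euclideanSpace, Fintype.card_fin, h8]
  rw [Real.mul_rpow (by positivity) (by positivity), Real.rpow_sub_one (by positivity),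
    sq_rpow_neg_half _ hc.le, eps]
  field_simp

/-! ### Geometry of a domain with smooth boundary -/

/-- A defining function `ρ` of `Ω` on the ball `B(p, r)`, with a unit vector `ν` along which `ρ`
grows at least at rate `c`, and a bound `M` of its differential. -/
structure IsBoundaryChart {n : ℕ} (Ω : Set (Space n)) (p : Space n) (ρ : Space n → ℝ)
    (ν : Space n) (r c M : ℝ) : Prop where
  r_pos : 0 < r
  c_pos : 0 < c
  norm_ν : ‖ν‖ = 1
  defining : IsDefiningFunction Ω (Metric.ball p r) ρ
  le_fderiv : ∀ x ∈ Metric.ball p r, c ≤ fderiv ℝ ρ x ν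
  norm_fderiv_le : ∀ x ∈ Metric.ball p r, ‖fderiv ℝ ρ x‖ ≤ M

theorem IsDefiningFunction.mono {n : ℕ} {Ω U U' : Set (Space n)} {ρ : Space n → ℝ}
    (h : IsDefiningFunction Ω U ρ) (hU' : IsOpen U') (hs : U' ⊆ U) :
    IsDefiningFunction Ω U' ρ :=
  ⟨hU', h.contDiffOn.mono hs, fun x hx => h.fderiv_ne_zero x (hs hx),
    fun x hx => h.mem_iff x (hs hx)⟩

theorem HasSmoothBoundary.exists_chart {n : ℕ} {Ω : Set (Space n)} (hΩ : HasSmoothBoundary Ω)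
    {p : Space n} (hp : p ∈ frontier Ω) : ∃ ρ ν r c M, IsBoundaryChart Ω p ρ ν r c M := by
  obtain ⟨U, ρ, hpU, hU⟩ := hΩ p hp
  obtain ⟨v, hv⟩ : ∃ v, 0 < fderiv ℝ ρ p v := by
    obtain ⟨v, hv⟩ := DFunLike.ne_iff.1 (hU.fderiv_ne_zero p hpU)
    rcases lt_or_gt_of_ne hv with h | h
    · exact ⟨-v, by simpa using h⟩
    · exact ⟨v, by simpa using h⟩
  have hv0 : v ≠ 0 := by rintro rfl; simp at hv
  have hv1 := norm_pos_iff.2 hv0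
  set ν : Space n := ‖v‖⁻¹ • v
  have hν : 0 < fderiv ℝ ρ p ν := by
    simp only [ν, map_smul, smul_eq_mul]
    positivity
  have hc : ContinuousAt (fderiv ℝ ρ) p :=
    (hU.contDiffOn.continuousOn_fderiv_of_isOpen hU.isOpen (by simp)).continuousAt
      (hU.isOpen.mem_nhds hpU)
  have h1 : ∀ᶠ x in 𝓝 p, fderiv ℝ ρ p ν / 2 < fderiv ℝ ρ x ν :=
    (hc.clm_apply continuousAt_const).eventually (lt_mem_nhds (half_lt_self hν))
  have h2 : ∀ᶠ x in 𝓝 p, ‖fderiv ℝ ρ x‖ < ‖fderiv ℝ ρ p‖ + 1 :=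
    hc.norm.eventually (gt_mem_nhds (lt_add_one _))
  obtain ⟨r, hr, hr'⟩ := Metric.eventually_nhds_iff_ball.1
    ((h1.and h2).and (hU.isOpen.mem_nhds hpU))
  refine ⟨ρ, ν, r, fderiv ℝ ρ p ν / 2, ‖fderiv ℝ ρ p‖ + 1, hr, half_pos hν, ?_,
    hU.mono Metric.isOpen_ball fun x hx => (hr' x hx).2, fun x hx => (hr' x hx).1.1.le,
    fun x hx => (hr' x hx).1.2.le⟩
  rw [norm_smul, norm_inv, norm_norm, inv_mul_cancel₀ hv1.ne']

namespace IsBoundaryChart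

variable {n : ℕ} {Ω : Set (Space n)} {p : Space n} {ρ : Space n → ℝ} {ν : Space n} {r c M : ℝ}

theorem M_nonneg (h : IsBoundaryChart Ω p ρ ν r c M) : 0 ≤ M :=
  (norm_nonneg _).trans (h.norm_fderiv_le p (Metric.mem_ball_self h.r_pos))

theorem contDiffAt (h : IsBoundaryChart Ω p ρ ν r c M) {x : Space n}
    (hx : x ∈ Metric.ball p r) : ContDiffAt ℝ ∞ ρ x :=
  h.defining.contDiffOn.contDiffAt (Metric.isOpen_ball.mem_nhds hx)

theorem hasFDerivAt (h : IsBoundaryChart Ω p ρ ν r c M) {x : Space n}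
    (hx : x ∈ Metric.ball p r) : HasFDerivAt ρ (fderiv ℝ ρ x) x :=
  ((h.contDiffAt hx).differentiableAt (by simp)).hasFDerivAt

theorem shrink (h : IsBoundaryChart Ω p ρ ν r c M) {r' : ℝ} (hr' : 0 < r') (hle : r' ≤ r) :
    IsBoundaryChart Ω p ρ ν r' c M :=
  have hs := Metric.ball_subset_ball (x := p) hle
  ⟨hr', h.c_pos, h.norm_ν, h.defining.mono Metric.isOpen_ball hs,
    fun x hx => h.le_fderiv x (hs hx), fun x hx => h.norm_fderiv_le x (hs hx)⟩

theorem add_mul_le (h : IsBoundaryChart Ω p ρ ν r c M) {x : Space n} {t : ℝ} (ht : 0 ≤ t)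
    (hx : x ∈ Metric.ball p r) (hxt : x + t • ν ∈ Metric.ball p r) :
    ρ x + c * t ≤ ρ (x + t • ν) := by
  have hmem : ∀ s ∈ Set.Icc 0 t, x + s • ν ∈ Metric.ball p r := by
    intro s hs
    have hc := (convex_ball p r).segment_subset hx hxt
    apply hc
    rw [segment_eq_image']
    rcases ht.eq_or_lt with rfl | ht'
    · exact ⟨0, by simp, by
        have : s = 0 := le_antisymm hs.2 hs.1
        simp [this]⟩
    · refine ⟨s / t, ⟨by have := hs.1; positivity, (div_le_one ht').2 hs.2⟩, ?_⟩
      simp only [add_sub_cancel_left, smul_smul]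
      rw [div_mul_cancel₀ _ ht'.ne']
  have hd : ∀ s ∈ Set.Icc 0 t, HasDerivAt (fun s : ℝ => ρ (x + s • ν))
      (fderiv ℝ ρ (x + s • ν) ν) s := by
    intro s hs
    have h1 : HasDerivAt (fun s : ℝ => x + s • ν) ν s := by
      simpa using ((hasDerivAt_id s).smul_const ν).const_add x
    exact (h.hasFDerivAt (hmem s hs)).comp_hasDerivAt s h1
  have := (convex_Icc 0 t).mul_sub_le_image_sub_of_le_deriv (f := fun s : ℝ => ρ (x + s • ν))
    (C := c) (fun s hs => (hd s hs).continuousAt.continuousWithinAt)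
    (fun s hs => (hd s (interior_subset hs)).differentiableAt.differentiableWithinAt)
    (fun s hs => by
      rw [(hd s (interior_subset hs)).deriv]
      exact h.le_fderiv _ (hmem s (interior_subset hs)))
    0 ⟨le_rfl, ht⟩ t ⟨ht, le_rfl⟩ ht
  simp only [zero_smul, add_zero, sub_zero] at this
  linarith

theorem abs_sub_le (h : IsBoundaryChart Ω p ρ ν r c M) {x y : Space n}
    (hx : x ∈ Metric.ball p r) (hy : y ∈ Metric.ball p r) : |ρ y - ρ x| ≤ M * ‖y - x‖ :=
  (convex_ball p r).norm_image_sub_le_of_norm_hasFDerivWithin_le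
    (fun _ hz => (h.hasFDerivAt hz).hasFDerivWithinAt) h.norm_fderiv_le hx hy

theorem mem_interior (h : IsBoundaryChart Ω p ρ ν r c M) {x : Space n}
    (hx : x ∈ Metric.ball p r) (hneg : ρ x < 0) : x ∈ interior Ω := by
  rw [mem_interior_iff_mem_nhds]
  filter_upwards [Metric.isOpen_ball.mem_nhds hx,
    (h.hasFDerivAt hx).continuousAt.eventually (gt_mem_nhds hneg)] with y hy hy'
  exact (h.defining.mem_iff y hy).2 (le_of_lt hy')

theorem eq_zero_of_mem_frontier (h : IsBoundaryChart Ω p ρ ν r c M) (hΩ : IsClosed Ω)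
    {x : Space n} (hx : x ∈ Metric.ball p r) (hf : x ∈ frontier Ω) : ρ x = 0 := by
  refine le_antisymm ((h.defining.mem_iff x hx).1 (hΩ.frontier_subset hf)) ?_
  by_contra! hneg
  exact hf.2 (h.mem_interior hx hneg)

theorem eventually_mem_ball (_ : IsBoundaryChart Ω p ρ ν r c M) {x : Space n}
    (hx : x ∈ Metric.ball p r) : ∀ᶠ t in 𝓝 (0 : ℝ), x + t • ν ∈ Metric.ball p r := by
  have : Tendsto (fun t : ℝ => x + t • ν) (𝓝 0) (𝓝 (x + (0 : ℝ) • ν)) :=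
    Continuous.tendsto (by fun_prop) 0
  rw [zero_smul, add_zero] at this
  exact this.eventually (Metric.isOpen_ball.mem_nhds hx)

theorem neg_of_mem_interior (h : IsBoundaryChart Ω p ρ ν r c M)
    {x : Space n} (hx : x ∈ Metric.ball p r) (hi : x ∈ interior Ω) : ρ x < 0 := by
  have h1 : Tendsto (fun t : ℝ => x + t • ν) (𝓝 0) (𝓝 (x + (0 : ℝ) • ν)) :=
    Continuous.tendsto (by fun_prop) 0
  rw [zero_smul, add_zero] at h1
  have h2 := (h.eventually_mem_ball hx).and (h1.eventually (isOpen_interior.mem_nhds hi))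
  obtain ⟨t, ⟨ht1, ht2⟩, ht3⟩ := ((h2.filter_mono nhdsWithin_le_nhds).and
    (self_mem_nhdsWithin : Set.Ioi (0 : ℝ) ∈ 𝓝[>] 0)).exists
  have h3 := h.add_mul_le (le_of_lt ht3) hx ht1
  have h4 := (h.defining.mem_iff _ ht1).1 (interior_subset ht2)
  have := mul_pos h.c_pos ht3
  linarith

theorem mem_frontier (h : IsBoundaryChart Ω p ρ ν r c M)
    {x : Space n} (hx : x ∈ Metric.ball p r) (h0 : ρ x = 0) : x ∈ frontier Ω :=
  ⟨subset_closure ((h.defining.mem_iff x hx).2 h0.le), fun hi =>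
    (h.neg_of_mem_interior hx hi).ne h0⟩

/-- Inward cone condition: a vector close to `-ν` points into `Ω` at every boundary point. -/
theorem add_smul_mem_interior (h : IsBoundaryChart Ω p ρ ν r c M) {x w : Space n} {t : ℝ}
    (hx : x ∈ Metric.ball p r) (h0 : ρ x ≤ 0) (ht : 0 < t) (hw : M * ‖w + ν‖ < c)
    (h1 : x - t • ν ∈ Metric.ball p r) (h2 : x + t • w ∈ Metric.ball p r) :
    x + t • w ∈ interior Ω := by
  refine h.mem_interior h2 ?_
  have e1 := h.add_mul_le ht.le h1 (by simpa using hx)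
  rw [sub_add_cancel] at e1
  have e2 := (le_abs_self _).trans (h.abs_sub_le h1 h2)
  rw [show x + t • w - (x - t • ν) = t • (w + ν) by module, norm_smul,
    Real.norm_of_nonneg ht.le] at e2
  nlinarith

end IsBoundaryChart

theorem HasSmoothBoundary.uniqueDiffOn {n : ℕ} {Ω : Set (Space n)} (hb : HasSmoothBoundary Ω)
    (hΩ : IsClosed Ω) : UniqueDiffOn ℝ Ω := by
  intro x hx
  by_cases hi : x ∈ interior Ω
  · exact uniqueDiffWithinAt_of_mem_nhds (mem_interior_iff_mem_nhds.1 hi)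
  have hf : x ∈ frontier Ω := ⟨subset_closure hx, hi⟩
  obtain ⟨ρ, ν, r, c, M, h⟩ := hb.exists_chart hf
  have hxb : x ∈ Metric.ball x r := Metric.mem_ball_self h.r_pos
  have hcone : ∀ w : Space n, M * ‖w + ν‖ < c → w ∈ tangentConeAt ℝ Ω x := by
    intro w hw
    refine mem_tangentConeAt_of_add_smul_mem (l := 𝓝[>] (0 : ℝ)) (c := id)
      (tendsto_id'.mpr <| nhdsGT_le_nhdsNE 0) ?_
    have e1 : ∀ v : Space n, ∀ᶠ t in 𝓝[>] (0 : ℝ), x + t • v ∈ Metric.ball x r := by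
      intro v
      have : Tendsto (fun t : ℝ => x + t • v) (𝓝 0) (𝓝 (x + (0 : ℝ) • v)) :=
        Continuous.tendsto (by fun_prop) 0
      rw [zero_smul, add_zero] at this
      exact (this.mono_left nhdsWithin_le_nhds).eventually (Metric.isOpen_ball.mem_nhds hxb)
    filter_upwards [e1 w, e1 (-ν), self_mem_nhdsWithin] with t h1 h2 ht
    rw [smul_neg, ← sub_eq_add_neg] at h2
    exact interior_subset (h.add_smul_mem_interior hxb
      (h.eq_zero_of_mem_frontier hΩ hxb hf).le ht hw h2 h1)
  refine ⟨?_, subset_closure hx⟩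
  have hopen : IsOpen {w : Space n | M * ‖w + ν‖ < c} :=
    isOpen_lt (by fun_prop) continuous_const
  have htop : Submodule.span ℝ (tangentConeAt ℝ Ω x) = ⊤ := by
    refine Submodule.eq_top_of_nonempty_interior' _ ⟨-ν, ?_⟩
    refine interior_mono ?_ (hopen.interior_eq.symm ▸ (by simpa using h.c_pos :
      -ν ∈ {w : Space n | M * ‖w + ν‖ < c}))
    exact fun w hw => Submodule.subset_span (hcone w hw)
  rw [htop]
  exact dense_univ

/-- The boundary is Lebesgue null: locally its translates along `ν` are disjoint. -/
theorem HasSmoothBoundary.volume_frontier {n : ℕ} {Ω : Set (Space n)} (hb : HasSmoothBoundary Ω)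
    (hΩ : IsClosed Ω) : volume (frontier Ω) = 0 := by
  refine measure_null_of_locally_null _ fun p hp => ?_
  obtain ⟨ρ, ν, r, c, M, h⟩ := hb.exists_chart hp
  refine ⟨frontier Ω ∩ Metric.ball p r, inter_mem self_mem_nhdsWithin
    (mem_nhdsWithin_of_mem_nhds (Metric.ball_mem_nhds p h.r_pos)), ?_⟩
  refine Measure.addHaar_eq_zero_of_disjoint_translates volume
    (fun m : ℕ => ((m : ℝ) + 1)⁻¹ • ν) ?_ ?_
    (isClosed_frontier.measurableSet.inter Metric.isOpen_ball.measurableSet)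
  · refine (Metric.isBounded_closedBall (x := (0 : Space n)) (r := 1)).subset ?_
    rintro _ ⟨m, rfl⟩
    rw [mem_closedBall_zero_iff, norm_smul, h.norm_ν, mul_one, norm_inv]
    refine inv_le_one_of_one_le₀ ?_
    rw [Real.norm_of_nonneg (by positivity)]
    have : (0 : ℝ) ≤ m := Nat.cast_nonneg m
    linarith
  · have key : ∀ (s t : ℝ) (x y : Space n), s < t → x ∈ frontier Ω ∩ Metric.ball p r →
        y ∈ frontier Ω ∩ Metric.ball p r → s • ν + x ≠ t • ν + y := by
      intro s t x y hst hx hy hxy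
      have e : x = y + (t - s) • ν := by
        calc x = s • ν + x - s • ν := by abel
          _ = y + (t - s) • ν := by rw [hxy]; module
      have h1 := h.add_mul_le (sub_pos.2 hst).le hy.2 (e ▸ hx.2)
      rw [← e, h.eq_zero_of_mem_frontier hΩ hx.2 hx.1,
        h.eq_zero_of_mem_frontier hΩ hy.2 hy.1] at h1
      have := mul_pos h.c_pos (sub_pos.2 hst)
      linarith
    intro i j hij
    rw [Function.onFun, Set.disjoint_left]
    rintro z ⟨_, rfl, x, hx, rfl⟩ ⟨_, rfl, y, hy, hxy⟩
    have hne : ((i : ℝ) + 1)⁻¹ ≠ ((j : ℝ) + 1)⁻¹ := by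
      intro hh
      exact hij (by exact_mod_cast add_right_cancel (inv_injective hh))
    rcases lt_or_gt_of_ne hne with hlt | hlt
    · exact key _ _ x y hlt hx hy hxy.symm
    · exact key _ _ y x hlt hy hx hxy

/-! ### The divergence theorem for tangent vector fields -/

theorem divergence_smul {n : ℕ} {Ω : Set (Space n)} {x : Space n} {g : Space n → ℝ}
    {W : Space n → Space n} (hu : UniqueDiffWithinAt ℝ Ω x)
    (hg : DifferentiableWithinAt ℝ g Ω x) (hW : DifferentiableWithinAt ℝ W Ω x) :
    divergence Ω (fun y => g y • W y) x =
      g x * divergence Ω W x + fderivWithin ℝ g Ω x (W x) := by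
  have hWx : fderivWithin ℝ g Ω x (W x) =
      ∑ i, W x i * fderivWithin ℝ g Ω x (EuclideanSpace.single i 1) := by
    conv_lhs => rw [← (EuclideanSpace.basisFun (Fin n) ℝ).sum_repr (W x)]
    simp
  rw [divergence, fderivWithin_fun_smul hu hg hW, hWx, divergence, Finset.mul_sum,
    ← Finset.sum_add_distrib]
  refine Finset.sum_congr rfl fun i _ => ?_
  simp
  ring

theorem divergence_of_mem_nhds {n : ℕ} {Ω : Set (Space n)} {x : Space n} (hx : Ω ∈ 𝓝 x)
    (X : Space n → Space n) : divergence Ω X x = divergence Set.univ X x := by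
  simp [divergence, fderivWithin_of_mem_nhds hx]

theorem divergence_congr_nhds {n : ℕ} {x : Space n} {X Y : Space n → Space n}
    (h : X =ᶠ[𝓝 x] Y) : divergence Set.univ X x = divergence Set.univ Y x := by
  simp [divergence, h.fderiv_eq]

theorem divergence_congr {n : ℕ} {Ω : Set (Space n)} {X Y : Space n → Space n}
    (h : ∀ y ∈ Ω, X y = Y y) {x : Space n} (hx : x ∈ Ω) :
    divergence Ω X x = divergence Ω Y x := by
  simp [divergence, fderivWithin_congr h (h x hx)]

theorem continuousOn_divergence {n : ℕ} {Ω : Set (Space n)} (hu : UniqueDiffOn ℝ Ω)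
    {X : Space n → Space n} (hX : ContDiffOn ℝ 1 X Ω) : ContinuousOn (divergence Ω X) Ω := by
  have h := hX.continuousOn_fderivWithin hu le_rfl
  unfold divergence
  refine continuousOn_finsetSum _ fun i _ => ?_
  exact (EuclideanSpace.proj (𝕜 := ℝ) i).continuous.comp_continuousOn
    (h.clm_apply continuousOn_const)

/-- The divergence of a compactly supported field has integral zero. -/
theorem integral_divergence_univ_eq_zero {n : ℕ} {X : Space n → Space n} (hX : ContDiff ℝ 1 X)
    (hc : HasCompactSupport X) : ∫ y, divergence Set.univ X y = 0 := by
  have hint : ∀ i : Fin n, Integrable fun y =>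
      fderiv ℝ X y (EuclideanSpace.single i 1) i := by
    intro i
    refine Continuous.integrable_of_hasCompactSupport ?_ ?_
    · exact (EuclideanSpace.proj (𝕜 := ℝ) i).continuous.comp
        ((hX.continuous_fderiv (by simp)).clm_apply continuous_const)
    · exact (hc.fderiv (𝕜 := ℝ)).comp_left
        (g := fun T : Space n →L[ℝ] Space n => T (EuclideanSpace.single i 1) i) (by simp)
  simp only [divergence, fderivWithin_univ]
  rw [integral_finsetSum _ fun i _ => hint i]
  refine Finset.sum_eq_zero fun i _ => ?_
  have hd : ∀ y, HasFDerivAt (fun y => X y i)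
      ((EuclideanSpace.proj (𝕜 := ℝ) i).comp (fderiv ℝ X y)) y := fun y =>
    (EuclideanSpace.proj (𝕜 := ℝ) i).hasFDerivAt.comp y
      (hX.differentiable (by simp) y).hasFDerivAt
  have h := integral_bilinear_hasLineDerivAt_right_eq_neg_left_of_integrable (μ := volume)
    (f := fun _ : Space n => (1 : ℝ)) (f' := fun _ => 0) (g := fun y => X y i)
    (g' := fun y => fderiv ℝ X y (EuclideanSpace.single i 1) i)
    (v := EuclideanSpace.single i 1) (B := ContinuousLinearMap.mul ℝ ℝ) (by simp)
    (by simpa using hint i) (by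
      simp only [ContinuousLinearMap.mul_apply', one_mul]
      exact Continuous.integrable_of_hasCompactSupport
        ((EuclideanSpace.proj (𝕜 := ℝ) i).continuous.comp hX.continuous)
        (hc.comp_left (g := fun v : Space n => v i) (by simp)))
    (fun x _ => by
      simpa using (hasFDerivAt_const (𝕜 := ℝ) (1 : ℝ) x).hasLineDerivAt (EuclideanSpace.single i 1))
    (fun x _ => (hd x).hasLineDerivAt _)
  simpa using h

theorem hasCompactSupport_of_eq_zero {n : ℕ} {X : Space n → Space n} {S : Set (Space n)}
    (hS : IsCompact S) (h0 : ∀ y ∉ S, X y = 0) : HasCompactSupport X :=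
  HasCompactSupport.intro hS h0

theorem contDiff_of_eq_zero_off {n : ℕ} {X : Space n → Space n} {S : Set (Space n)}
    (hS : IsClosed S) (h0 : ∀ y ∉ S, X y = 0) (hX : ∀ y ∈ S, ContDiffAt ℝ 1 X y) :
    ContDiff ℝ 1 X := by
  rw [contDiff_iff_contDiffAt]
  intro y
  by_cases hy : y ∈ S
  · exact hX y hy
  · refine (contDiffAt_const (c := (0 : Space n))).congr_of_eventuallyEq ?_
    filter_upwards [hS.isOpen_compl.mem_nhds hy] with z hz using h0 z hz

theorem divergence_eq_zero_off {n : ℕ} {X : Space n → Space n} {S : Set (Space n)}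
    (hS : IsClosed S) (h0 : ∀ y ∉ S, X y = 0) {y : Space n} (hy : y ∉ S) :
    divergence Set.univ X y = 0 := by
  have : X =ᶠ[𝓝 y] fun _ => 0 := by
    filter_upwards [hS.isOpen_compl.mem_nhds hy] with z hz using h0 z hz
  rw [divergence_congr_nhds this]
  simp [divergence]

theorem setIntegral_divergence_of_interior {n : ℕ} {Ω S : Set (Space n)} {X : Space n → Space n}
    (hS : IsCompact S) (hSΩ : S ⊆ Ω) (hX : ∀ y ∈ S, ContDiffAt ℝ 1 X y)
    (h0 : ∀ y ∉ S, X y = 0) : ∫ y in Ω, divergence Set.univ X y = 0 := by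
  rw [setIntegral_eq_integral_of_forall_compl_eq_zero fun y hy =>
    divergence_eq_zero_off hS.isClosed h0 fun h => hy (hSΩ h)]
  exact integral_divergence_univ_eq_zero (contDiff_of_eq_zero_off hS.isClosed h0 hX)
    (hasCompactSupport_of_eq_zero hS h0)

theorem ae_mem_interior {n : ℕ} {Ω : Set (Space n)} (hb : HasSmoothBoundary Ω)
    (hΩ : IsCompact Ω) : ∀ᵐ y ∂(volume.restrict Ω), y ∈ interior Ω := by
  have h1 : ∀ᵐ y ∂(volume.restrict Ω), y ∉ frontier Ω :=
    ae_restrict_of_ae (measure_eq_zero_iff_ae_notMem.1 (hb.volume_frontier hΩ.isClosed))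
  filter_upwards [h1, ae_restrict_mem hΩ.measurableSet] with y hy hyΩ
  by_contra hi
  exact hy ⟨subset_closure hyΩ, hi⟩

theorem exists_bound_deriv_smoothTransition :
    ∃ B, ∀ t, |deriv Real.smoothTransition t| ≤ B := by
  have hc : Continuous (deriv Real.smoothTransition) :=
    (Real.smoothTransition.contDiff (n := 1)).continuous_deriv le_rfl
  obtain ⟨B, hB⟩ := (isCompact_Icc (a := (0 : ℝ)) (b := 1)).exists_bound_of_continuousOn
    hc.continuousOn
  exact ⟨B, fun t => by
    by_cases ht : t ∈ Set.Icc (0 : ℝ) 1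
    · exact hB t ht
    · have : deriv Real.smoothTransition t = 0 := by
        rw [Set.mem_Icc, not_and_or, not_le, not_le] at ht
        rcases ht with ht | ht
        · have : Real.smoothTransition =ᶠ[𝓝 t] fun _ => 0 := by
            filter_upwards [gt_mem_nhds ht] with s hs
            exact Real.smoothTransition.zero_of_nonpos (le_of_lt hs)
          rw [this.deriv_eq, deriv_const]
        · have : Real.smoothTransition =ᶠ[𝓝 t] fun _ => 1 := by
            filter_upwards [lt_mem_nhds ht] with s hs
            exact Real.smoothTransition.one_of_one_le (le_of_lt hs)
          rw [this.deriv_eq, deriv_const]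
      rw [this, abs_zero]
      exact (norm_nonneg _).trans (hB 0 (by simp))⟩

theorem deriv_smoothTransition_eq_zero {t : ℝ} (ht : 1 < t) :
    deriv Real.smoothTransition t = 0 := by
  have : Real.smoothTransition =ᶠ[𝓝 t] fun _ => 1 := by
    filter_upwards [lt_mem_nhds ht] with s hs
    exact Real.smoothTransition.one_of_one_le (le_of_lt hs)
  rw [this.deriv_eq, deriv_const]

/-- The divergence theorem in a boundary chart. The field is cut off by a function of `ρ/ε` that
vanishes near the boundary; the error term is `dρ(X)/ε` on the layer `-2ε ≤ ρ < 0`, which is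
bounded because `|dρ(X)| ≤ C|ρ|`, and its support shrinks to nothing. -/
theorem IsBoundaryChart.setIntegral_divergence {n : ℕ} {Ω : Set (Space n)} {p : Space n}
    {ρ : Space n → ℝ} {ν : Space n} {r c M C : ℝ} (h : IsBoundaryChart Ω p ρ ν r c M)
    (hb : HasSmoothBoundary Ω) (hΩ : IsCompact Ω) {X : Space n → Space n}
    (hX : ContDiffOn ℝ 1 X Ω) {S : Set (Space n)} (hS : IsCompact S) (hSb : S ⊆ Metric.ball p r)
    (h0 : ∀ y ∉ S, X y = 0)
    (hC : ∀ y ∈ S ∩ interior Ω, |fderiv ℝ ρ y (X y)| ≤ C * |ρ y|) :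
    ∫ y in Ω, divergence Ω X y = 0 := by
  obtain ⟨B, hB⟩ := exists_bound_deriv_smoothTransition
  have hB0 : 0 ≤ B := (abs_nonneg _).trans (hB 0)
  let u : ℕ → Space n → ℝ := fun m y => -1 - (eps m)⁻¹ * ρ y
  let Y : ℕ → Space n → Space n := fun m y => Real.smoothTransition (u m y) • X y
  have hρc : ContinuousOn ρ S := h.defining.contDiffOn.continuousOn.mono hSb
  have hcut : ∀ m y, -eps m ≤ ρ y → Real.smoothTransition (u m y) = 0 := by
    intro m y hy
    refine Real.smoothTransition.zero_of_nonpos ?_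
    have h1 := mul_le_mul_of_nonneg_left hy (inv_pos.2 (eps_pos m)).le
    rw [mul_neg, inv_mul_cancel₀ (eps_pos m).ne'] at h1
    simp only [u]
    linarith
  have hud : ∀ m, ∀ y ∈ Metric.ball p r,
      HasFDerivAt (u m) (-((eps m)⁻¹ • fderiv ℝ ρ y)) y := fun m y hy =>
    ((h.hasFDerivAt hy).const_mul _).const_sub _
  have hXi : ∀ y ∈ interior Ω, ContDiffAt ℝ 1 X y := fun y hy =>
    hX.contDiffAt (mem_interior_iff_mem_nhds.1 hy)
  -- the cut-off fields are compactly supported in the interior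
  let T : ℕ → Set (Space n) := fun m => S ∩ ρ ⁻¹' Set.Iic (-eps m)
  have hT : ∀ m, IsCompact (T m) := fun m =>
    hS.of_isClosed_subset (hρc.preimage_isClosed_of_isClosed hS.isClosed isClosed_Iic)
      Set.inter_subset_left
  have hTi : ∀ m, T m ⊆ interior Ω := fun m y hy =>
    h.mem_interior (hSb hy.1) (lt_of_le_of_lt hy.2 (neg_neg_of_pos (eps_pos m)))
  have hY0 : ∀ m, ∀ y ∉ T m, Y m y = 0 := by
    intro m y hy
    by_cases hyS : y ∈ S
    · have : -eps m ≤ ρ y := by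
        by_contra! hlt
        exact hy ⟨hyS, hlt.le⟩
      simp [Y, hcut m y this]
    · simp [Y, h0 y hyS]
  have hYd : ∀ m, ∀ y ∈ T m, ContDiffAt ℝ 1 (Y m) y := by
    intro m y hy
    change ContDiffAt ℝ 1 ((fun y => Real.smoothTransition (u m y)) • X) y
    refine ContDiffAt.smul ?_ (hXi y (hTi m hy))
    refine Real.smoothTransition.contDiff.contDiffAt.comp y ?_
    exact contDiffAt_const.sub (contDiffAt_const.mul
      ((h.contDiffAt (hSb hy.1)).of_le (by simp)))
  have hYc : ∀ m, ContDiff ℝ 1 (Y m) := fun m =>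
    contDiff_of_eq_zero_off (hT m).isClosed (hY0 m) (hYd m)
  have hYint : ∀ m, ∫ y in Ω, divergence Set.univ (Y m) y = 0 := fun m =>
    setIntegral_divergence_of_interior (hT m) ((hTi m).trans interior_subset) (hYd m) (hY0 m)
  -- the divergence of the cut-off field at interior points of the chart
  have hformula : ∀ m, ∀ y ∈ S ∩ interior Ω, divergence Set.univ (Y m) y =
      Real.smoothTransition (u m y) * divergence Ω X y -
        deriv Real.smoothTransition (u m y) * ((eps m)⁻¹ * fderiv ℝ ρ y (X y)) := by
    intro m y hy
    have hg : HasFDerivAt (fun z => Real.smoothTransition (u m z))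
        (deriv Real.smoothTransition (u m y) • -((eps m)⁻¹ • fderiv ℝ ρ y)) y :=
      ((Real.smoothTransition.contDiff (n := 1)).differentiable (by simp)
        (u m y)).hasDerivAt.comp_hasFDerivAt y (hud m y (hSb hy.1))
    rw [divergence_smul uniqueDiffWithinAt_univ hg.differentiableAt.differentiableWithinAt
      ((hXi y hy.2).differentiableAt (by simp)).differentiableWithinAt, fderivWithin_univ,
      hg.fderiv, divergence_of_mem_nhds (mem_interior_iff_mem_nhds.1 hy.2)]
    simp
    ring
  have hdivc := continuousOn_divergence (hb.uniqueDiffOn hΩ.isClosed) hX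
  have hC0 : ∀ y ∈ S ∩ interior Ω, |fderiv ℝ ρ y (X y)| ≤ |C| * |ρ y| := fun y hy =>
    (hC y hy).trans (mul_le_mul_of_nonneg_right (le_abs_self C) (abs_nonneg _))
  have key := tendsto_integral_of_dominated_convergence (μ := volume.restrict Ω)
    (F := fun m => divergence Set.univ (Y m)) (f := divergence Ω X)
    (fun y => ‖divergence Ω X y‖ + B * (2 * |C|)) (fun m => by
      exact (continuousOn_univ.1 (continuousOn_divergence uniqueDiffOn_univ
        (hYc m).contDiffOn)).aestronglyMeasurable)
    ((hdivc.integrableOn_compact hΩ).norm.add (integrableOn_const hΩ.measure_lt_top.ne))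
    (fun m => by
      filter_upwards [ae_mem_interior hb hΩ] with y hy
      by_cases hyS : y ∈ S
      · rw [hformula m y ⟨hyS, hy⟩]
        refine (norm_sub_le _ _).trans (add_le_add ?_ ?_)
        · rw [norm_mul, Real.norm_of_nonneg (Real.smoothTransition.nonneg _)]
          exact mul_le_of_le_one_left (norm_nonneg _) (Real.smoothTransition.le_one _)
        · rw [norm_mul]
          by_cases hu : 1 < u m y
          · rw [deriv_smoothTransition_eq_zero hu, norm_zero, zero_mul]
            positivity
          · refine mul_le_mul (hB _) ?_ (norm_nonneg _) hB0
            have hneg := h.neg_of_mem_interior (hSb hyS) hy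
            have he := eps_pos m
            have h1 : |ρ y| ≤ 2 * eps m := by
              rw [abs_of_neg hneg]
              have h2 : (eps m)⁻¹ * -ρ y ≤ 2 := by simp only [u] at hu; linarith
              rwa [inv_mul_le_iff₀ he, mul_comm] at h2
            rw [norm_mul, norm_inv, Real.norm_of_nonneg he.le, Real.norm_eq_abs,
              inv_mul_le_iff₀ he]
            calc _ ≤ |C| * |ρ y| := hC0 y ⟨hyS, hy⟩
              _ ≤ |C| * (2 * eps m) := by gcongr
              _ = _ := by ring
      · rw [divergence_eq_zero_off hS.isClosed (fun z hz => by simp [Y, h0 z hz]) hyS, norm_zero]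
        positivity)
    (by
      filter_upwards [ae_mem_interior hb hΩ] with y hy
      by_cases hyS : y ∈ S
      · have hneg := h.neg_of_mem_interior (hSb hyS) hy
        have hlim : Tendsto (fun m => u m y) atTop atTop := by
          have h1 : Tendsto (fun m => (eps m)⁻¹) atTop atTop := by
            simp only [eps, inv_inv]
            exact tendsto_atTop_add_const_right _ _ tendsto_natCast_atTop_atTop
          have h2 := tendsto_atTop_add_const_left atTop (-1 : ℝ)
            (h1.atTop_mul_const (neg_pos.2 hneg))
          refine h2.congr fun m => ?_
          simp only [u]
          ring
        refine tendsto_const_nhds.congr' ?_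
        filter_upwards [hlim.eventually_gt_atTop 1] with m hm
        rw [hformula m y ⟨hyS, hy⟩, deriv_smoothTransition_eq_zero hm,
          Real.smoothTransition.one_of_one_le hm.le]
        ring
      · refine tendsto_const_nhds.congr' (Eventually.of_forall fun m => ?_)
        change _ = divergence Set.univ (Y m) y
        rw [divergence_eq_zero_off hS.isClosed (fun z hz => by simp [Y, h0 z hz]) hyS,
          divergence_of_mem_nhds (mem_interior_iff_mem_nhds.1 hy),
          divergence_eq_zero_off hS.isClosed h0 hyS])
  simp only [hYint] at key
  exact (tendsto_nhds_unique tendsto_const_nhds key).symm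

/-- If `q` is `C¹` on `Ω` and vanishes on the boundary then `|q| ≤ C|ρ|` near a boundary point:
from a point of `Ω`, the boundary is reached along `ν` after a distance at most `|ρ|/c`. -/
theorem IsBoundaryChart.exists_abs_le {n : ℕ} {Ω : Set (Space n)} {p : Space n}
    {ρ : Space n → ℝ} {ν : Space n} {r c M : ℝ} (h : IsBoundaryChart Ω p ρ ν r c M)
    (hb : HasSmoothBoundary Ω) (hΩ : IsCompact Ω) (hp : p ∈ frontier Ω) {q : Space n → ℝ}
    (hq : ContDiffOn ℝ 1 q (Ω ∩ Metric.ball p r))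
    (hq0 : ∀ y ∈ frontier Ω ∩ Metric.ball p r, q y = 0) :
    ∃ r' > 0, r' ≤ r ∧ ∃ C, ∀ y ∈ Ω ∩ Metric.ball p r', |q y| ≤ C * |ρ y| := by
  have hr := h.r_pos
  have hc := h.c_pos
  have hM := h.M_nonneg
  have huniq : UniqueDiffOn ℝ (Ω ∩ Metric.ball p r) :=
    (hb.uniqueDiffOn hΩ.isClosed).inter Metric.isOpen_ball
  have hball : Metric.closedBall p (r / 2) ⊆ Metric.ball p r :=
    Metric.closedBall_subset_ball (half_lt_self hr)
  obtain ⟨D, hD⟩ := (hΩ.inter_right (Metric.isClosed_closedBall (x := p)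
    (ε := r / 2))).exists_bound_of_continuousOn
    ((hq.continuousOn_fderivWithin huniq le_rfl).mono (Set.inter_subset_inter_right _ hball))
  refine ⟨r / 2 / (1 + M / c), by positivity, ?_, |D| / c, ?_⟩
  · refine (div_le_self (by positivity) ?_).trans (half_le_self hr.le)
    have : 0 ≤ M / c := by positivity
    linarith
  rintro y ⟨hyΩ, hy⟩
  have hp0 := h.eq_zero_of_mem_frontier hΩ.isClosed (Metric.mem_ball_self hr) hp
  have hyd : ‖y - p‖ * (1 + M / c) < r / 2 := by
    rw [← lt_div_iff₀ (by positivity)]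
    rwa [mem_ball_iff_norm] at hy
  have hyd' : ‖y - p‖ + ‖y - p‖ * (M / c) < r / 2 := by linarith
  have hyb : y ∈ Metric.ball p r := by
    rw [mem_ball_iff_norm]
    have : 0 ≤ ‖y - p‖ * (M / c) := by positivity
    linarith
  have hyneg : ρ y ≤ 0 := (h.defining.mem_iff y hyb).1 hyΩ
  set t : ℝ := |ρ y| / c
  have ht : 0 ≤ t := by positivity
  have htle : t ≤ ‖y - p‖ * (M / c) := by
    have := h.abs_sub_le (Metric.mem_ball_self hr) hyb
    rw [hp0, sub_zero] at this
    calc t ≤ M * ‖y - p‖ / c := by simp only [t]; gcongr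
      _ = _ := by ring
  have hmem : ∀ s ∈ Set.Icc 0 t, y + s • ν ∈ Metric.closedBall p (r / 2) := by
    intro s hs
    rw [mem_closedBall_iff_norm]
    calc ‖y + s • ν - p‖ = ‖(y - p) + s • ν‖ := by congr 1; abel
      _ ≤ ‖y - p‖ + ‖s • ν‖ := norm_add_le _ _
      _ = ‖y - p‖ + s := by rw [norm_smul, h.norm_ν, mul_one, Real.norm_of_nonneg hs.1]
      _ ≤ r / 2 := by linarith [hs.2]
  have hcont : ContinuousOn (fun s : ℝ => ρ (y + s • ν)) (Set.Icc 0 t) :=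
    h.defining.contDiffOn.continuousOn.comp (by fun_prop) fun s hs => hball (hmem s hs)
  -- the boundary point `y + τ • ν` above `y`
  obtain ⟨τ, hτ, hτ0⟩ : (0 : ℝ) ∈ (fun s : ℝ => ρ (y + s • ν)) '' Set.Icc 0 t := by
    refine intermediate_value_Icc ht hcont ⟨by simpa using hyneg, ?_⟩
    have h1 := h.add_mul_le ht hyb (hball (hmem t ⟨ht, le_rfl⟩))
    have h2 : c * t = |ρ y| := by simp only [t]; field_simp
    have h3 := neg_abs_le (ρ y)
    linarith
  simp only at hτ0
  have hsub : segment ℝ y (y + τ • ν) ⊆ Ω ∩ Metric.closedBall p (r / 2) := by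
    rw [segment_eq_image']
    rintro _ ⟨θ, hθ, rfl⟩
    simp only [add_sub_cancel_left, smul_smul]
    have hθτ : θ * τ ∈ Set.Icc 0 t :=
      ⟨mul_nonneg hθ.1 hτ.1, (mul_le_of_le_one_left hτ.1 hθ.2).trans hτ.2⟩
    refine ⟨(h.defining.mem_iff _ (hball (hmem _ hθτ))).2 ?_, hmem _ hθτ⟩
    have e : y + τ • ν = y + (θ * τ) • ν + (τ - θ * τ) • ν := by module
    have h0 : 0 ≤ τ - θ * τ := by nlinarith [hθ.2, hτ.1]
    have h1 := h.add_mul_le h0 (hball (hmem _ hθτ)) (e ▸ hball (hmem τ hτ))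
    rw [← e, hτ0] at h1
    have := mul_nonneg hc.le h0
    linarith
  have hend : q (y + τ • ν) = 0 :=
    hq0 _ ⟨h.mem_frontier (hball (hmem τ hτ)) hτ0, hball (hmem τ hτ)⟩
  have hmv := (convex_segment y (y + τ • ν)).norm_image_sub_le_of_norm_hasFDerivWithin_le
    (f := q) (C := |D|) (f' := fun z => fderivWithin ℝ q (Ω ∩ Metric.ball p r) z)
    (fun z hz => ((hq.differentiableOn (by simp) z
      ⟨(hsub hz).1, hball (hsub hz).2⟩).hasFDerivWithinAt).mono
      (hsub.trans (Set.inter_subset_inter_right _ hball)))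
    (fun z hz => (hD z (hsub hz)).trans (le_abs_self D))
    (right_mem_segment ℝ _ _) (left_mem_segment ℝ _ _)
  rw [hend, sub_zero, sub_add_cancel_left, norm_neg, norm_smul, h.norm_ν, mul_one,
    Real.norm_of_nonneg hτ.1] at hmv
  calc |q y| ≤ |D| * τ := hmv
    _ ≤ |D| * t := by gcongr; exact hτ.2
    _ = _ := by simp only [t]; ring

theorem setIntegral_divergence_cutoff_of_mem_interior {n : ℕ} {Ω : Set (Space n)}
    (hb : HasSmoothBoundary Ω) (hΩ : IsCompact Ω) {X : Space n → Space n}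
    (hX : ContDiffOn ℝ 1 X Ω) {χ : Space n → ℝ} (hχ : ContDiff ℝ ∞ χ)
    (hsupp : tsupport χ ⊆ interior Ω) : ∫ y in Ω, divergence Ω (fun y => χ y • X y) y = 0 := by
  have h1 : ∫ y in Ω, divergence Set.univ (fun y => χ y • X y) y = 0 := by
    refine setIntegral_divergence_of_interior (S := tsupport χ)
      (hΩ.of_isClosed_subset (isClosed_tsupport χ) (hsupp.trans interior_subset))
      (hsupp.trans interior_subset) (fun y hy => ?_) (fun y hy => ?_)
    · exact (hχ.contDiffAt.of_le (by simp)).smul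
        (hX.contDiffAt (mem_interior_iff_mem_nhds.1 (hsupp hy)))
    · simp [image_eq_zero_of_notMem_tsupport hy]
  rw [← h1]
  refine integral_congr_ae ?_
  filter_upwards [ae_mem_interior hb hΩ] with y hy
  exact divergence_of_mem_nhds (mem_interior_iff_mem_nhds.1 hy) _

theorem IsBoundaryChart.contDiffOn_fderiv_apply {n : ℕ} {Ω : Set (Space n)} {p : Space n}
    {ρ : Space n → ℝ} {ν : Space n} {r c M : ℝ} (h : IsBoundaryChart Ω p ρ ν r c M)
    {X : Space n → Space n} {s : Set (Space n)} (hs : s ⊆ Metric.ball p r)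
    (hX : ContDiffOn ℝ 1 X s) : ContDiffOn ℝ 1 (fun y => fderiv ℝ ρ y (X y)) s :=
  ((h.defining.contDiffOn.fderiv_of_isOpen (m := 1) Metric.isOpen_ball
    (show (((2 : ℕ∞) : WithTop ℕ∞) ≤ ((⊤ : ℕ∞) : WithTop ℕ∞)) from
      WithTop.coe_le_coe.2 le_top)).mono hs).clm_apply hX

theorem exists_radius_setIntegral_divergence_cutoff {n : ℕ} {Ω : Set (Space n)}
    (hb : HasSmoothBoundary Ω) (hΩ : IsCompact Ω) {X : Space n → Space n}
    (hX : ContDiffOn ℝ 1 X Ω) (htan : IsTangentToBoundary Ω X) {p : Space n} (hp : p ∈ Ω) :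
    ∃ R > 0, ∀ χ : Space n → ℝ, ContDiff ℝ ∞ χ → tsupport χ ⊆ Metric.ball p R →
      ∫ y in Ω, divergence Ω (fun y => χ y • X y) y = 0 := by
  by_cases hi : p ∈ interior Ω
  · obtain ⟨R, hR, hRs⟩ := Metric.isOpen_iff.1 isOpen_interior p hi
    exact ⟨R, hR, fun χ hχ hs =>
      setIntegral_divergence_cutoff_of_mem_interior hb hΩ hX hχ (hs.trans hRs)⟩
  have hf : p ∈ frontier Ω := ⟨subset_closure hp, hi⟩
  obtain ⟨ρ, ν, r, c, M, h⟩ := hb.exists_chart hf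
  obtain ⟨R, hR, hRr, C, hC⟩ := h.exists_abs_le hb hΩ hf
    (h.contDiffOn_fderiv_apply Set.inter_subset_right (hX.mono Set.inter_subset_left))
    (fun y hy => htan _ ρ h.defining y hy)
  refine ⟨R, hR, fun χ hχ hs => ?_⟩
  have hS : IsCompact (tsupport χ) := (isCompact_closedBall p R).of_isClosed_subset
    (isClosed_tsupport χ) (hs.trans Metric.ball_subset_closedBall)
  obtain ⟨B, hB⟩ := hS.exists_bound_of_continuousOn hχ.continuous.continuousOn
  refine (h.shrink hR hRr).setIntegral_divergence (C := B * C) hb hΩ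
    ((hχ.contDiffOn.of_le (by simp)).smul hX) hS hs
    (fun y hy => by simp [image_eq_zero_of_notMem_tsupport hy]) (fun y hy => ?_)
  rw [map_smul, smul_eq_mul, abs_mul, mul_assoc]
  exact mul_le_mul (hB y hy.1) (hC y ⟨interior_subset hy.2, hs hy.1⟩) (abs_nonneg _)
    ((norm_nonneg _).trans (hB y hy.1))

/-- The divergence theorem for a `C¹` field tangent to the boundary. -/
theorem setIntegral_divergence_of_tangent {n : ℕ} {Ω : Set (Space n)}
    (hb : HasSmoothBoundary Ω) (hΩ : IsCompact Ω) {X : Space n → Space n}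
    (hX : ContDiffOn ℝ 1 X Ω) (htan : IsTangentToBoundary Ω X) :
    ∫ y in Ω, divergence Ω X y = 0 := by
  choose! R hR hcut using fun p hp =>
    exists_radius_setIntegral_divergence_cutoff hb hΩ hX htan (p := p) hp
  obtain ⟨t, ht, hcover⟩ := hΩ.elim_nhds_subcover (fun p => Metric.ball p (R p))
    (fun p hp => Metric.ball_mem_nhds p (hR p hp))
  obtain ⟨f, hf⟩ := SmoothPartitionOfUnity.exists_isSubordinate (modelWithCornersSelf ℝ (Space n))
    hΩ.isClosed (fun p : t => Metric.ball (p : Space n) (R p)) (fun _ => Metric.isOpen_ball)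
    (by simpa [Set.iUnion_subtype] using hcover)
  have hu := hb.uniqueDiffOn hΩ.isClosed
  have hfs : ∀ p, ContDiff ℝ ∞ (f p) := fun p => (f p).contMDiff.contDiff
  have hfX : ∀ p, ContDiffOn ℝ 1 (fun y => f p y • X y) Ω := fun p =>
    ((hfs p).contDiffOn.of_le (by simp)).smul hX
  have hsum : ∀ y ∈ Ω, X y = ∑ p, f p y • X y := by
    intro y hy
    rw [← Finset.sum_smul, ← finsum_eq_sum_of_fintype, f.sum_eq_one hy, one_smul]
  have hdiv : ∀ y ∈ Ω, divergence Ω X y = ∑ p, divergence Ω (fun y => f p y • X y) y := by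
    intro y hy
    rw [divergence_congr hsum hy]
    simp only [divergence]
    rw [fderivWithin_fun_sum (hu y hy) fun p _ => (hfX p).differentiableOn (by simp) y hy,
      Finset.sum_comm]
    refine Finset.sum_congr rfl fun i _ => ?_
    simp
  rw [setIntegral_congr_fun hΩ.measurableSet hdiv, integral_finsetSum _ fun p _ =>
    (continuousOn_divergence hu (hfX p)).integrableOn_compact hΩ]
  exact Finset.sum_eq_zero fun p _ => hcut p (ht p p.2) (f p) (hfs p) (hf p)

/-- `W` has no flux through the boundary of `Ω`: `∫_Ω div (g W) = 0` for all `C¹` functions `g`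
on `Ω`. -/
def HasNoFlux {n : ℕ} (Ω : Set (Space n)) (W : Space n → Space n) : Prop :=
  ∀ g : Space n → ℝ, ContDiffOn ℝ 1 g Ω →
    ∫ y in Ω, (g y * divergence Ω W y + fderivWithin ℝ g Ω y (W y)) = 0

theorem hasNoFlux_of_setIntegral_divergence {n : ℕ} {Ω : Set (Space n)}
    (hb : HasSmoothBoundary Ω) (hΩ : IsCompact Ω) {W : Space n → Space n}
    (hW : ContDiffOn ℝ 1 W Ω) (h : ∀ g : Space n → ℝ, ContDiffOn ℝ 1 g Ω →
      ∫ y in Ω, divergence Ω (fun y => g y • W y) y = 0) : HasNoFlux Ω W := by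
  intro g hg
  rw [← h g hg]
  refine setIntegral_congr_fun hΩ.measurableSet fun y hy => ?_
  exact (divergence_smul (hb.uniqueDiffOn hΩ.isClosed y hy)
    (hg.differentiableOn (by simp) y hy) (hW.differentiableOn (by simp) y hy)).symm

theorem HasNoFlux.of_tangent {n : ℕ} {Ω : Set (Space n)} (hb : HasSmoothBoundary Ω)
    (hΩ : IsCompact Ω) {W : Space n → Space n} (hW : ContDiffOn ℝ 1 W Ω)
    (htan : IsTangentToBoundary Ω W) : HasNoFlux Ω W := by
  refine hasNoFlux_of_setIntegral_divergence hb hΩ hW fun g hg =>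
    setIntegral_divergence_of_tangent hb hΩ (hg.smul hW) fun U ρ hU x hx => ?_
  rw [map_smul, htan U ρ hU x hx, smul_zero]

theorem HasNoFlux.of_tsupport_subset_interior {n : ℕ} {Ω : Set (Space n)}
    (hb : HasSmoothBoundary Ω) (hΩ : IsCompact Ω) {χ : Space n → ℝ} (hχ : ContDiff ℝ ∞ χ)
    (hs : tsupport χ ⊆ interior Ω) (v : Space n) : HasNoFlux Ω fun y => χ y • v := by
  refine hasNoFlux_of_setIntegral_divergence hb hΩ
    ((hχ.smul contDiff_const).contDiffOn.of_le (by simp)) fun g hg => ?_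
  have := setIntegral_divergence_cutoff_of_mem_interior hb hΩ
    (hg.smul (contDiffOn_const (c := v))) hχ hs
  rw [← this]
  congr 1
  funext y
  congr 1
  funext z
  exact smul_comm _ _ _

/-- The fields `χ (v - (dρ(v)/dρ(ν)) ν)` are tangent to all the level sets of `ρ`. -/
def IsBoundaryChart.tangentField {n : ℕ} (ρ : Space n → ℝ) (ν : Space n) (χ : Space n → ℝ)
    (v : Space n) (y : Space n) : Space n :=
  χ y • (v - (fderiv ℝ ρ y v / fderiv ℝ ρ y ν) • ν)

theorem IsBoundaryChart.contDiffOn_slope {n : ℕ} {Ω : Set (Space n)} {p : Space n}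
    {ρ : Space n → ℝ} {ν : Space n} {r c M : ℝ} (h : IsBoundaryChart Ω p ρ ν r c M)
    (v : Space n) :
    ContDiffOn ℝ 1 (fun y => fderiv ℝ ρ y v / fderiv ℝ ρ y ν) (Metric.ball p r) :=
  (h.contDiffOn_fderiv_apply subset_rfl contDiffOn_const).div
    (h.contDiffOn_fderiv_apply subset_rfl contDiffOn_const)
    fun y hy => (h.c_pos.trans_le (h.le_fderiv y hy)).ne'

theorem IsBoundaryChart.contDiff_tangentField {n : ℕ} {Ω : Set (Space n)} {p : Space n}
    {ρ : Space n → ℝ} {ν : Space n} {r c M : ℝ} (h : IsBoundaryChart Ω p ρ ν r c M)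
    {χ : Space n → ℝ} (hχ : ContDiff ℝ ∞ χ) (hs : tsupport χ ⊆ Metric.ball p r) (v : Space n) :
    ContDiff ℝ 1 (tangentField ρ ν χ v) := by
  refine contDiff_of_eq_zero_off (isClosed_tsupport χ)
    (fun y hy => by simp [tangentField, image_eq_zero_of_notMem_tsupport hy]) fun y hy => ?_
  have hsl := (h.contDiffOn_slope v).contDiffAt (Metric.isOpen_ball.mem_nhds (hs hy))
  exact (hχ.contDiffAt.of_le (by simp)).smul (contDiffAt_const.sub (hsl.smul contDiffAt_const))

theorem IsBoundaryChart.hasNoFlux_tangentField {n : ℕ} {Ω : Set (Space n)} {p : Space n}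
    {ρ : Space n → ℝ} {ν : Space n} {r c M : ℝ} (h : IsBoundaryChart Ω p ρ ν r c M)
    (hb : HasSmoothBoundary Ω) (hΩ : IsCompact Ω)
    {χ : Space n → ℝ} (hχ : ContDiff ℝ ∞ χ) (hs : tsupport χ ⊆ Metric.ball p r) (v : Space n) :
    HasNoFlux Ω (tangentField ρ ν χ v) := by
  have hW := (h.contDiff_tangentField hχ hs v).contDiffOn (s := Ω)
  refine hasNoFlux_of_setIntegral_divergence hb hΩ hW fun g hg => ?_
  have hS : IsCompact (tsupport χ) := (isCompact_closedBall p r).of_isClosed_subset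
    (isClosed_tsupport χ) (hs.trans Metric.ball_subset_closedBall)
  -- `dρ` annihilates the tangential field
  refine h.setIntegral_divergence (C := 0) hb hΩ (hg.smul hW) hS hs
    (fun y hy => by simp [tangentField, image_eq_zero_of_notMem_tsupport hy]) (fun y hy => ?_)
  have : fderiv ℝ ρ y ν ≠ 0 := (h.c_pos.trans_le (h.le_fderiv y (hs hy.1))).ne'
  simp [tangentField, this]

/-! ### The Biot–Savart field of a scalar density -/

/-- The field `∫_Ω f(y) K_ε(x - y) dy` of a scalar density. -/
def scalarField {n : ℕ} (Ω : Set (Space n)) (f : Space n → ℝ) (ε : ℝ) (x : Space n) : Space n :=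
  ∫ y in Ω, f y • kernel ε (x - y)

/-- The derivative `∫_Ω f(y) DK_ε(x - y) dy` of the regularised field. -/
def scalarFieldDeriv {n : ℕ} (Ω : Set (Space n)) (f : Space n → ℝ) (ε : ℝ) (x : Space n) :
    Space n →L[ℝ] Space n :=
  ∫ y in Ω, f y • kernelDeriv ε (x - y)

/-- The derivative of `scalarField Ω f` along `W`, after an integration by parts that leaves only
weakly singular kernels. -/
def flowDeriv {n : ℕ} (Ω : Set (Space n)) (f : Space n → ℝ) (W : Space n → Space n) (ε : ℝ)
    (x : Space n) : Space n :=
  ∫ y in Ω, (f y • kernelDeriv ε (x - y) (W x - W y) +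
    (f y * divergence Ω W y + fderivWithin ℝ f Ω y (W y)) • kernel ε (x - y))

section Regularised

variable {n : ℕ} {Ω : Set (Space n)} {f : Space n → ℝ} {ε : ℝ}

theorem exists_bound_kernelDeriv (hΩ : IsCompact Ω) (hε : 0 < ε) (x₀ : Space n) :
    ∃ B, ∀ x ∈ Metric.ball x₀ 1, ∀ y ∈ Ω,
      ‖(kernelDeriv ε (x - y) : Space n →L[ℝ] Space n)‖ ≤ B := by
  obtain ⟨B, hB⟩ := ((isCompact_closedBall x₀ 1).prod hΩ).exists_bound_of_continuousOn
    (f := fun z : Space n × Space n => (kernelDeriv ε (z.1 - z.2) : Space n →L[ℝ] Space n))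
    ((continuous_kernelDeriv hε).comp (by fun_prop)).continuousOn
  exact ⟨B, fun x hx y hy => hB (x, y) ⟨Metric.ball_subset_closedBall hx, hy⟩⟩

theorem continuousOn_smul_kernel (hf : ContinuousOn f Ω) (hε : 0 < ε) (x : Space n) :
    ContinuousOn (fun y => f y • kernel ε (x - y)) Ω :=
  hf.smul ((contDiff_kernel hε).continuous.comp (by fun_prop)).continuousOn

theorem continuousOn_smul_kernelDeriv (hf : ContinuousOn f Ω) (hε : 0 < ε) (x : Space n) :
    ContinuousOn (fun y => f y • (kernelDeriv ε (x - y) : Space n →L[ℝ] Space n)) Ω :=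
  hf.smul ((continuous_kernelDeriv hε).comp (by fun_prop)).continuousOn

theorem hasFDerivAt_scalarField (hΩ : IsCompact Ω) (hf : ContinuousOn f Ω) (hε : 0 < ε)
    (x : Space n) : HasFDerivAt (scalarField Ω f ε) (scalarFieldDeriv Ω f ε x) x := by
  obtain ⟨B, hB⟩ := exists_bound_kernelDeriv hΩ hε x
  refine hasFDerivAt_integral_of_dominated_of_fderiv_le (μ := volume.restrict Ω)
    (F' := fun x y => f y • kernelDeriv ε (x - y))
    (bound := fun y => ‖f y‖ * B) (Metric.ball_mem_nhds x one_pos) ?_ ?_ ?_ ?_ ?_ ?_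
  · exact Eventually.of_forall fun z =>
      (continuousOn_smul_kernel hf hε z).aestronglyMeasurable hΩ.measurableSet
  · exact (continuousOn_smul_kernel hf hε x).integrableOn_compact hΩ
  · exact (continuousOn_smul_kernelDeriv hf hε x).aestronglyMeasurable hΩ.measurableSet
  · filter_upwards [ae_restrict_mem hΩ.measurableSet] with y hy z hz
    rw [norm_smul]
    exact mul_le_mul_of_nonneg_left (hB z hz y hy) (norm_nonneg _)
  · exact (hf.integrableOn_compact hΩ).norm.mul_const B
  · refine Eventually.of_forall fun y z _ => ?_
    have h1 : HasFDerivAt (fun z : Space n => z - y) (ContinuousLinearMap.id ℝ (Space n)) z :=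
      (hasFDerivAt_id z).sub_const y
    exact ((hasFDerivAt_kernel hε (z - y)).comp z h1).const_smul (f y)

theorem continuous_scalarFieldDeriv (hΩ : IsCompact Ω) (hf : ContinuousOn f Ω) (hε : 0 < ε) :
    Continuous (scalarFieldDeriv Ω f ε) := by
  rw [continuous_iff_continuousAt]
  intro x
  obtain ⟨B, hB⟩ := exists_bound_kernelDeriv hΩ hε x
  refine continuousAt_of_dominated (bound := fun y => ‖f y‖ * B) ?_ ?_ ?_ ?_
  · exact Eventually.of_forall fun z =>
      (continuousOn_smul_kernelDeriv hf hε z).aestronglyMeasurable hΩ.measurableSet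
  · filter_upwards [Metric.ball_mem_nhds x one_pos] with z hz
    filter_upwards [ae_restrict_mem hΩ.measurableSet] with y hy
    rw [norm_smul]
    exact mul_le_mul_of_nonneg_left (hB z hz y hy) (norm_nonneg _)
  · exact (hf.integrableOn_compact hΩ).norm.mul_const B
  · refine Eventually.of_forall fun y => ?_
    exact (((continuous_kernelDeriv hε).comp (by fun_prop)).const_smul (f y)).continuousAt

theorem scalarFieldDeriv_apply (hΩ : IsCompact Ω) (hf : ContinuousOn f Ω) (hε : 0 < ε)
    (x v : Space n) :
    scalarFieldDeriv Ω f ε x v = ∫ y in Ω, f y • kernelDeriv ε (x - y) v := by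
  rw [scalarFieldDeriv, ContinuousLinearMap.integral_apply
    ((continuousOn_smul_kernelDeriv hf hε x).integrableOn_compact hΩ)]
  rfl

theorem inner_scalarFieldDeriv_apply (hΩ : IsCompact Ω) (hf : ContinuousOn f Ω) (hε : 0 < ε)
    (x u v : Space n) : (inner ℝ u (scalarFieldDeriv Ω f ε x v) : ℝ) =
      ∫ y in Ω, f y * inner ℝ u (kernelDeriv ε (x - y) v) := by
  have hint : IntegrableOn (fun y => f y • kernelDeriv ε (x - y) v) Ω :=
    ContinuousOn.integrableOn_compact hΩ ((continuousOn_smul_kernelDeriv hf hε x).clm_apply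
      continuousOn_const)
  rw [scalarFieldDeriv_apply hΩ hf hε, ← integral_inner hint]
  simp only [real_inner_smul_right]

theorem inner_scalarFieldDeriv_comm (hΩ : IsCompact Ω) (hf : ContinuousOn f Ω) (hε : 0 < ε)
    (x u v : Space n) : (inner ℝ u (scalarFieldDeriv Ω f ε x v) : ℝ) =
      inner ℝ v (scalarFieldDeriv Ω f ε x u) := by
  rw [inner_scalarFieldDeriv_apply hΩ hf hε, inner_scalarFieldDeriv_apply hΩ hf hε]
  simp only [← inner_kernelDeriv_comm ε _ u v, real_inner_comm v]

theorem continuousOn_fderivWithin_apply (hu : UniqueDiffOn ℝ Ω) (hf : ContDiffOn ℝ 1 f Ω)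
    {W : Space n → Space n} (hW : ContDiffOn ℝ 1 W Ω) :
    ContinuousOn (fun y => f y * divergence Ω W y + fderivWithin ℝ f Ω y (W y)) Ω :=
  (hf.continuousOn.mul (continuousOn_divergence hu hW)).add
    ((hf.continuousOn_fderivWithin hu le_rfl).clm_apply hW.continuousOn)

/-- Differentiation of the regularised field along a field without boundary flux: integration by
parts moves the derivative from the kernel to the density, up to a commutator. -/
theorem scalarFieldDeriv_apply_eq_flowDeriv (hΩ : IsCompact Ω) (hu : UniqueDiffOn ℝ Ω)
    (hf : ContDiffOn ℝ 1 f Ω) {W : Space n → Space n} (hW : ContDiffOn ℝ 1 W Ω)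
    (hflux : HasNoFlux Ω W) (hε : 0 < ε) (x : Space n) :
    scalarFieldDeriv Ω f ε x (W x) = flowDeriv Ω f W ε x := by
  have hDK : ∀ v : Space n → Space n, ContinuousOn v Ω →
      ContinuousOn (fun y => f y • kernelDeriv ε (x - y) (v y)) Ω := fun v hv =>
    (continuousOn_smul_kernelDeriv hf.continuousOn hε x).clm_apply hv
  have hK := continuousOn_smul_kernel (continuousOn_fderivWithin_apply hu hf hW) hε x
  have hI : IntegrableOn (fun y => f y • kernelDeriv ε (x - y) (W x - W y) +
      (f y * divergence Ω W y + fderivWithin ℝ f Ω y (W y)) • kernel ε (x - y)) Ω :=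
    ((hDK _ (continuousOn_const.sub hW.continuousOn)).add hK).integrableOn_compact hΩ
  refine ext_inner_left ℝ fun a => ?_
  rw [inner_scalarFieldDeriv_apply hΩ hf.continuousOn hε, flowDeriv, ← integral_inner hI,
    ← sub_eq_zero, ← integral_sub]
  · let φ : Space n → ℝ := fun y => inner ℝ a (kernel ε (x - y))
    have hφd : ∀ y, HasFDerivAt φ (-(innerSL ℝ a).comp (kernelDeriv ε (x - y))) y := by
      intro y
      have h1 : HasFDerivAt (fun y : Space n => x - y) (-ContinuousLinearMap.id ℝ (Space n)) y :=
        (hasFDerivAt_id y).const_sub x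
      refine (((innerSL ℝ a).hasFDerivAt).comp y
        ((hasFDerivAt_kernel hε (x - y)).comp y h1)).congr_fderiv ?_
      ext v
      simp
    have hφ : ContDiff ℝ 1 φ :=
      contDiff_const.inner ℝ (((contDiff_kernel hε).of_le (by simp)).comp
        (contDiff_const.sub contDiff_id))
    -- the integration by parts: `∫ div (φ f W) = 0` with `φ = ⟨a, K_ε(x - ·)⟩`
    have h0 := hflux (fun y => φ y * f y) (hφ.contDiffOn.mul hf)
    rw [← neg_eq_zero, ← integral_neg] at h0
    rw [← h0]
    refine setIntegral_congr_fun hΩ.measurableSet fun y hy => ?_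
    rw [fderivWithin_fun_mul (hu y hy) (hφ.differentiable (by simp) y).differentiableWithinAt
      (hf.differentiableOn (by simp) y hy), (hφd y).hasFDerivWithinAt.fderivWithin (hu y hy)]
    simp only [φ, inner_add_right, real_inner_smul_right, map_sub, inner_sub_right, add_apply,
      smul_apply, neg_apply, ContinuousLinearMap.comp_apply, innerSL_apply_apply, smul_eq_mul]
    ring
  · simpa only [real_inner_smul_right] using
      (((hDK _ (continuousOn_const (c := W x))).integrableOn_compact hΩ).const_inner (𝕜 := ℝ) a)
  · exact hI.const_inner a

end Regularised

/-! ### Removal of the regularisation -/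

section Limit

variable {n : ℕ} {Ω : Set (Space n)} {f : Space n → ℝ}

theorem exists_sub_mem_closedBall (hΩ : IsCompact Ω) :
    ∃ L, ∀ x ∈ Ω, ∀ y ∈ Ω, x - y ∈ Metric.closedBall (0 : Space n) L := by
  obtain ⟨L, hL⟩ := hΩ.isBounded.exists_norm_le
  refine ⟨L + L, fun x hx y hy => ?_⟩
  rw [mem_closedBall_zero_iff]
  exact (norm_sub_le _ _).trans (add_le_add (hL x hx) (hL y hy))

theorem integrableOn_comp_sub {g : Space n → ℝ} {L : ℝ} {x : Space n}
    (hΩ : IsCompact Ω) (hg : IntegrableOn g (Metric.closedBall 0 L))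
    (hL : ∀ y ∈ Ω, x - y ∈ Metric.closedBall (0 : Space n) L) :
    IntegrableOn (fun y => g (x - y)) Ω := by
  have h1 := ((integrable_indicator_iff Metric.isClosed_closedBall.measurableSet).2
    hg).comp_sub_left x
  refine (h1.integrableOn (s := Ω)).congr_fun (fun y hy => ?_) hΩ.measurableSet
  exact Set.indicator_of_mem (hL y hy) _

theorem setIntegral_comp_sub_le {g : Space n → ℝ} {L : ℝ} {x : Space n}
    (hΩ : IsCompact Ω) (hg : IntegrableOn g (Metric.closedBall 0 L)) (h0 : ∀ z, 0 ≤ g z)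
    (hL : ∀ y ∈ Ω, x - y ∈ Metric.closedBall (0 : Space n) L) :
    ∫ y in Ω, g (x - y) ≤ ∫ z in Metric.closedBall 0 L, g z := by
  have h1 := (integrable_indicator_iff Metric.isClosed_closedBall.measurableSet).2 hg
  calc ∫ y in Ω, g (x - y) = ∫ y in Ω, (Metric.closedBall 0 L).indicator g (x - y) :=
        setIntegral_congr_fun hΩ.measurableSet fun y hy =>
          (Set.indicator_of_mem (hL y hy) _).symm
    _ ≤ ∫ y, (Metric.closedBall 0 L).indicator g (x - y) :=
        setIntegral_le_integral (h1.comp_sub_left x)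
          (Eventually.of_forall fun y => Set.indicator_nonneg (fun z _ => h0 z) _)
    _ = ∫ z, (Metric.closedBall 0 L).indicator g z :=
        integral_sub_left_eq_self ((Metric.closedBall 0 L).indicator g) volume x
    _ = _ := integral_indicator Metric.isClosed_closedBall.measurableSet

/-- Integral operators whose kernels differ by at most a multiple of `kernelError` converge
uniformly. -/
theorem tendstoUniformlyOn_setIntegral {F : Type*} [NormedAddCommGroup F] [NormedSpace ℝ F]
    (hn : 1 ≤ n) (hΩ : IsCompact Ω) {Φ : ℝ → Space n → Space n → F} {C : ℝ} (hC : 0 ≤ C)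
    (hint : ∀ ε, ∀ x ∈ Ω, IntegrableOn (Φ ε x) Ω)
    (hle : ∀ ε, ∀ x ∈ Ω, ∀ y ∈ Ω, ‖Φ ε x y - Φ 0 x y‖ ≤ C * kernelError ε (x - y)) :
    TendstoUniformlyOn (fun m x => ∫ y in Ω, Φ (eps m) x y) (fun x => ∫ y in Ω, Φ 0 x y)
      atTop Ω := by
  obtain ⟨L, hL⟩ := exists_sub_mem_closedBall hΩ
  have hlim := (tendsto_integral_kernelError hn L).const_mul C
  rw [mul_zero] at hlim
  rw [Metric.tendstoUniformlyOn_iff]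
  intro δ hδ
  filter_upwards [hlim.eventually (gt_mem_nhds hδ)] with m hm x hx
  rw [dist_comm, dist_eq_norm, ← integral_sub (hint _ x hx) (hint _ x hx)]
  have hκ := integrableOn_comp_sub hΩ (integrableOn_kernelError hn (eps m) L) (hL x hx)
  calc ‖∫ y in Ω, (Φ (eps m) x y - Φ 0 x y)‖
      ≤ ∫ y in Ω, C * kernelError (eps m) (x - y) := by
        refine norm_integral_le_of_norm_le (hκ.const_mul C) ?_
        filter_upwards [ae_restrict_mem hΩ.measurableSet] with y hy using hle _ x hx y hy
    _ = C * ∫ y in Ω, kernelError (eps m) (x - y) := integral_const_mul _ _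
    _ ≤ C * ∫ z in Metric.closedBall 0 L, kernelError (eps m) z :=
        mul_le_mul_of_nonneg_left (setIntegral_comp_sub_le hΩ
          (integrableOn_kernelError hn (eps m) L) (kernelError_nonneg _) (hL x hx)) hC
    _ < δ := hm

theorem integrableOn_of_norm_le_majorant {F : Type*} [NormedAddCommGroup F]
    (hn : 1 ≤ n) (hΩ : IsCompact Ω) {g : Space n → F} {x : Space n} {C : ℝ} (hx : x ∈ Ω)
    (hg : AEStronglyMeasurable g (volume.restrict Ω))
    (hle : ∀ y ∈ Ω, ‖g y‖ ≤ C * majorant (x - y)) : IntegrableOn g Ω := by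
  obtain ⟨L, hL⟩ := exists_sub_mem_closedBall hΩ
  refine ((integrableOn_comp_sub hΩ (integrableOn_majorant hn L) (hL x hx)).const_mul C).mono' hg ?_
  filter_upwards [ae_restrict_mem hΩ.measurableSet] with y hy using hle y hy

theorem integrableOn_smul_kernel (hn : 1 ≤ n) (hΩ : IsCompact Ω) (hf : ContinuousOn f Ω) (ε : ℝ)
    {x : Space n} (hx : x ∈ Ω) : IntegrableOn (fun y => f y • kernel ε (x - y)) Ω := by
  obtain ⟨B, hB⟩ := hΩ.exists_bound_of_continuousOn hf
  refine integrableOn_of_norm_le_majorant (C := B) hn hΩ hx ?_ fun y hy => ?_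
  · exact (hf.aestronglyMeasurable hΩ.measurableSet).smul
      ((measurable_kernel ε).comp (measurable_const.sub measurable_id)).aestronglyMeasurable
  · rw [norm_smul]
    exact mul_le_mul (hB y hy) (norm_kernel_le _ _) (norm_nonneg _)
      ((norm_nonneg _).trans (hB y hy))

theorem tendstoUniformlyOn_scalarField (hn : 1 ≤ n) (hΩ : IsCompact Ω) (hf : ContinuousOn f Ω) :
    TendstoUniformlyOn (fun m => scalarField Ω f (eps m)) (scalarField Ω f 0) atTop Ω := by
  obtain ⟨B, hB⟩ := hΩ.exists_bound_of_continuousOn hf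
  refine tendstoUniformlyOn_setIntegral (Φ := fun ε x y => f y • kernel ε (x - y)) (C := |B|) hn hΩ
    (abs_nonneg B) (fun ε x hx => integrableOn_smul_kernel hn hΩ hf ε hx) fun ε x hx y hy => ?_
  rw [← smul_sub, norm_smul]
  refine mul_le_mul ((hB y hy).trans (le_abs_self B)) ?_ (norm_nonneg _) (abs_nonneg _)
  exact le_add_of_nonneg_right (by positivity)

theorem continuousOn_scalarField (hn : 1 ≤ n) (hΩ : IsCompact Ω) (hf : ContinuousOn f Ω) :
    ContinuousOn (scalarField Ω f 0) Ω :=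
  (tendstoUniformlyOn_scalarField hn hΩ hf).continuousOn
    (Frequently.of_forall fun m x _ =>
      (hasFDerivAt_scalarField hΩ hf (eps_pos m) x).continuousAt.continuousWithinAt)

theorem integrableOn_smul_kernelDeriv (hn : 1 ≤ n) (hΩ : IsCompact Ω) (hf : ContinuousOn f Ω)
    {W : Space n → Space n} (hW : ContinuousOn W Ω) {K : ℝ} (hK : ∀ x ∈ Ω, ∀ y ∈ Ω,
      ‖W x - W y‖ ≤ K * ‖x - y‖) (ε : ℝ) {x : Space n} (hx : x ∈ Ω) :
    IntegrableOn (fun y => f y • kernelDeriv ε (x - y) (W x - W y)) Ω := by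
  obtain ⟨B, hB⟩ := hΩ.exists_bound_of_continuousOn hf
  refine integrableOn_of_norm_le_majorant (C := |B| * (|K| * (n + 1))) hn hΩ hx ?_ fun y hy => ?_
  · refine (hf.aestronglyMeasurable hΩ.measurableSet).smul ?_
    exact ContinuousLinearMap.aestronglyMeasurable_comp₂
      (ContinuousLinearMap.id ℝ (Space n →L[ℝ] Space n))
      ((measurable_kernelDeriv_apply ε).comp
        (measurable_const.sub measurable_id)).aestronglyMeasurable
      ((continuousOn_const.sub hW).aestronglyMeasurable hΩ.measurableSet)
  · rw [norm_smul, mul_assoc]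
    refine mul_le_mul ((hB y hy).trans (le_abs_self B)) ?_ (norm_nonneg _) (abs_nonneg _)
    calc _ ≤ ‖(kernelDeriv ε (x - y) : Space n →L[ℝ] Space n)‖ * ‖W x - W y‖ :=
          ContinuousLinearMap.le_opNorm _ _
      _ ≤ ‖(kernelDeriv ε (x - y) : Space n →L[ℝ] Space n)‖ * (|K| * ‖x - y‖) := by
          gcongr
          exact (hK x hx y hy).trans (mul_le_mul_of_nonneg_right (le_abs_self K) (norm_nonneg _))
      _ = |K| * (‖(kernelDeriv ε (x - y) : Space n →L[ℝ] Space n)‖ * ‖x - y‖) := by ring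
      _ ≤ |K| * ((n + 1) * majorant (x - y)) := by
          exact mul_le_mul_of_nonneg_left (norm_kernelDeriv_mul_le ε (x - y)) (abs_nonneg _)
      _ = _ := by ring

/-- The increments `W x - W y` compensate for the singularity of `DK`, so that the regularisation
can be removed from `flowDeriv` uniformly. -/
theorem tendstoUniformlyOn_flowDeriv (hn : 1 ≤ n) (hΩ : IsCompact Ω) (hu : UniqueDiffOn ℝ Ω)
    (hf : ContDiffOn ℝ 1 f Ω) {W : Space n → Space n} (hW : ContDiffOn ℝ 1 W Ω) {K : ℝ}
    (hK : ∀ x ∈ Ω, ∀ y ∈ Ω, ‖W x - W y‖ ≤ K * ‖x - y‖) :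
    TendstoUniformlyOn (fun m => flowDeriv Ω f W (eps m)) (flowDeriv Ω f W 0) atTop Ω := by
  obtain ⟨B, hB⟩ := hΩ.exists_bound_of_continuousOn hf.continuousOn
  have hg := continuousOn_fderivWithin_apply hu hf hW
  obtain ⟨B', hB'⟩ := hΩ.exists_bound_of_continuousOn hg
  refine tendstoUniformlyOn_setIntegral (Φ := fun ε x y =>
    f y • kernelDeriv ε (x - y) (W x - W y) +
      (f y * divergence Ω W y + fderivWithin ℝ f Ω y (W y)) • kernel ε (x - y))
    (C := |B| * |K| + |B'|) hn hΩ (by positivity)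
    (fun ε x hx => (integrableOn_smul_kernelDeriv hn hΩ hf.continuousOn hW.continuousOn hK ε
      hx).add (integrableOn_smul_kernel hn hΩ hg ε hx)) fun ε x hx y hy => ?_
  rw [add_sub_add_comm, ← smul_sub, ← smul_sub, ← sub_apply]
  refine (norm_add_le _ _).trans ?_
  rw [add_mul, norm_smul, norm_smul]
  refine add_le_add ?_ ?_
  · rw [mul_assoc]
    refine mul_le_mul ((hB y hy).trans (le_abs_self B)) ?_ (norm_nonneg _) (abs_nonneg _)
    calc _ ≤ ‖(kernelDeriv ε (x - y) - kernelDeriv 0 (x - y) : Space n →L[ℝ] Space n)‖ *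
            ‖W x - W y‖ := ContinuousLinearMap.le_opNorm _ _
      _ ≤ ‖(kernelDeriv ε (x - y) - kernelDeriv 0 (x - y) : Space n →L[ℝ] Space n)‖ *
            (|K| * ‖x - y‖) := by
          gcongr
          exact (hK x hx y hy).trans (mul_le_mul_of_nonneg_right (le_abs_self K) (norm_nonneg _))
      _ = |K| * (‖(kernelDeriv ε (x - y) - kernelDeriv 0 (x - y) : Space n →L[ℝ] Space n)‖ *
            ‖x - y‖) := by ring
      _ ≤ _ := by
          gcongr
          exact le_add_of_nonneg_left (norm_nonneg _)
  · refine mul_le_mul ((hB' y hy).trans (le_abs_self B')) ?_ (norm_nonneg _) (abs_nonneg _)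
    exact le_add_of_nonneg_right (by positivity)

end Limit

/-! ### Differentiability of the field at interior points -/

theorem norm_le_sum_norm_apply_single {n : ℕ} (T : Space n →L[ℝ] Space n) :
    ‖T‖ ≤ ∑ j, ‖T (EuclideanSpace.basisFun (Fin n) ℝ j)‖ := by
  refine T.opNorm_le_bound (Finset.sum_nonneg fun j _ => norm_nonneg _) fun v => ?_
  conv_lhs => rw [← (EuclideanSpace.basisFun (Fin n) ℝ).sum_repr v]
  rw [map_sum, Finset.sum_mul]
  refine (norm_sum_le _ _).trans (Finset.sum_le_sum fun j _ => ?_)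
  rw [map_smul, norm_smul, mul_comm]
  exact mul_le_mul_of_nonneg_left (PiLp.norm_apply_le v j) (norm_nonneg _)

/-- The linear map with prescribed values on the standard basis. -/
def ofBasisValues {n : ℕ} (a : Fin n → Space n) : Space n →L[ℝ] Space n :=
  ∑ j, (EuclideanSpace.proj (𝕜 := ℝ) j : Space n →L[ℝ] ℝ).smulRight (a j)

theorem ofBasisValues_apply_basis {n : ℕ} (a : Fin n → Space n) (j : Fin n) :
    ofBasisValues a (EuclideanSpace.basisFun (Fin n) ℝ j) = a j := by
  classical
  simp [ofBasisValues, PiLp.single_apply]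

theorem clm_ext_basis {n : ℕ} {T T' : Space n →L[ℝ] Space n}
    (h : ∀ j, T (EuclideanSpace.basisFun (Fin n) ℝ j) = T' (EuclideanSpace.basisFun (Fin n) ℝ j)) :
    T = T' := by
  have := (EuclideanSpace.basisFun (Fin n) ℝ).toBasis.ext (f₁ := T.toLinearMap)
    (f₂ := T'.toLinearMap) (by simpa using h)
  exact ContinuousLinearMap.coe_injective this

theorem exists_lipschitz_bound {n : ℕ} {W : Space n → Space n} (hW : ContDiff ℝ 1 W)
    (hc : HasCompactSupport W) : ∃ K : ℝ, ∀ x y, ‖W x - W y‖ ≤ K * ‖x - y‖ := by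
  obtain ⟨K, hK⟩ := hW.lipschitzWith_of_hasCompactSupport hc (by simp)
  exact ⟨K, fun x y => by simpa [dist_eq_norm] using hK.dist_le_mul x y⟩

section Interior

variable {n : ℕ} {Ω : Set (Space n)} {f : Space n → ℝ}

/-- Near an interior point, the derivatives of the regularised fields are the `flowDeriv` along
cutoffs of the constant basis fields, which converge uniformly. -/
theorem exists_hasFDerivAt_scalarField (hn : 1 ≤ n) (hb : HasSmoothBoundary Ω) (hΩ : IsCompact Ω)
    (hf : ContDiffOn ℝ 1 f Ω) {x₀ : Space n} (hx₀ : x₀ ∈ interior Ω) :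
    ∃ D, HasFDerivAt (scalarField Ω f 0) D x₀ ∧
      Tendsto (fun m => scalarFieldDeriv Ω f (eps m) x₀) atTop (𝓝 D) := by
  have hu := hb.uniqueDiffOn hΩ.isClosed
  obtain ⟨R, hR, hRs⟩ := Metric.isOpen_iff.1 isOpen_interior x₀ hx₀
  let χ : ContDiffBump x₀ := ⟨R / 4, R / 2, by positivity, by linarith⟩
  have hχs : tsupport χ ⊆ interior Ω := by
    rw [χ.tsupport_eq]
    exact (Metric.closedBall_subset_ball (half_lt_self hR)).trans hRs
  have hN : Metric.ball x₀ (R / 4) ⊆ interior Ω :=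
    (Metric.ball_subset_ball (by linarith)).trans hRs
  let e : Fin n → Space n := fun j => EuclideanSpace.basisFun (Fin n) ℝ j
  let W : Fin n → Space n → Space n := fun j y => χ y • e j
  have hW : ∀ j, ContDiff ℝ 1 (W j) := fun j => χ.contDiff.smul contDiff_const
  have hWc : ∀ j, HasCompactSupport (W j) := fun j => χ.hasCompactSupport.smul_right
  have hflux : ∀ j, HasNoFlux Ω (W j) := fun j =>
    HasNoFlux.of_tsupport_subset_interior hb hΩ χ.contDiff hχs (e j)
  have hW1 : ∀ j, ∀ x ∈ Metric.ball x₀ (R / 4), W j x = e j := by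
    intro j x hx
    simp [W, χ.one_of_mem_closedBall (Metric.ball_subset_closedBall hx)]
  let G : Space n → Space n →L[ℝ] Space n := fun x =>
    ofBasisValues fun j => flowDeriv Ω f (W j) 0 x
  have hunif : TendstoUniformlyOn (fun m => scalarFieldDeriv Ω f (eps m)) G atTop
      (Metric.ball x₀ (R / 4)) := by
    have hj : ∀ j, TendstoUniformlyOn (fun m => flowDeriv Ω f (W j) (eps m))
        (flowDeriv Ω f (W j) 0) atTop Ω := by
      intro j
      obtain ⟨K, hK⟩ := exists_lipschitz_bound (hW j) (hWc j)
      exact tendstoUniformlyOn_flowDeriv hn hΩ hu hf (hW j).contDiffOn fun x _ y _ => hK x y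
    rw [Metric.tendstoUniformlyOn_iff]
    intro δ hδ
    have hev : ∀ᶠ m in atTop, ∀ j, ∀ x ∈ Ω,
        dist (flowDeriv Ω f (W j) 0 x) (flowDeriv Ω f (W j) (eps m) x) < δ / (n + 1) :=
      eventually_all.2 fun j => Metric.tendstoUniformlyOn_iff.1 (hj j) _ (by positivity)
    filter_upwards [hev] with m hm x hx
    rw [dist_eq_norm]
    refine (norm_le_sum_norm_apply_single _).trans_lt ?_
    calc _ ≤ ∑ _j : Fin n, δ / (n + 1) := by
          refine Finset.sum_le_sum fun j _ => ?_
          have h1 := scalarFieldDeriv_apply_eq_flowDeriv hΩ hu hf (hW j).contDiffOn (hflux j)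
            (eps_pos m) x
          rw [hW1 j x hx] at h1
          rw [sub_apply, ofBasisValues_apply_basis, h1, ← dist_eq_norm]
          exact (hm j x (interior_subset (hN hx))).le
      _ = n * (δ / (n + 1)) := by simp
      _ < δ := by
          rw [mul_div_assoc', div_lt_iff₀ (by positivity)]
          nlinarith
  refine ⟨G x₀, ?_, hunif.tendsto_at (Metric.mem_ball_self (by positivity))⟩
  exact hasFDerivAt_of_tendstoUniformlyOn Metric.isOpen_ball hunif
    (fun m x _ => hasFDerivAt_scalarField hΩ hf.continuousOn (eps_pos m) x)
    (fun x hx => (tendstoUniformlyOn_scalarField hn hΩ hf.continuousOn).tendsto_at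
      (interior_subset (hN hx))) (Metric.mem_ball_self (by positivity))

theorem hasFDerivAt_scalarField_zero (hn : 1 ≤ n) (hb : HasSmoothBoundary Ω) (hΩ : IsCompact Ω)
    (hf : ContDiffOn ℝ 1 f Ω) {x : Space n} (hx : x ∈ interior Ω) :
    HasFDerivAt (scalarField Ω f 0) (fderiv ℝ (scalarField Ω f 0) x) x :=
  (exists_hasFDerivAt_scalarField hn hb hΩ hf hx).choose_spec.1.differentiableAt.hasFDerivAt

theorem tendsto_scalarFieldDeriv (hn : 1 ≤ n) (hb : HasSmoothBoundary Ω) (hΩ : IsCompact Ω)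
    (hf : ContDiffOn ℝ 1 f Ω) {x : Space n} (hx : x ∈ interior Ω) :
    Tendsto (fun m => scalarFieldDeriv Ω f (eps m) x) atTop
      (𝓝 (fderiv ℝ (scalarField Ω f 0) x)) := by
  obtain ⟨D, hD, hlim⟩ := exists_hasFDerivAt_scalarField hn hb hΩ hf hx
  rwa [hD.fderiv]

theorem tendsto_scalarFieldDeriv_apply (hn : 1 ≤ n) (hb : HasSmoothBoundary Ω) (hΩ : IsCompact Ω)
    (hf : ContDiffOn ℝ 1 f Ω) {x : Space n} (hx : x ∈ interior Ω) (v : Space n) :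
    Tendsto (fun m => scalarFieldDeriv Ω f (eps m) x v) atTop
      (𝓝 (fderiv ℝ (scalarField Ω f 0) x v)) :=
  ((ContinuousLinearMap.apply ℝ (Space n) v).continuous.tendsto _).comp
    (tendsto_scalarFieldDeriv hn hb hΩ hf hx)

theorem inner_fderiv_scalarField_comm (hn : 1 ≤ n) (hb : HasSmoothBoundary Ω) (hΩ : IsCompact Ω)
    (hf : ContDiffOn ℝ 1 f Ω) {x : Space n} (hx : x ∈ interior Ω) (u v : Space n) :
    (inner ℝ u (fderiv ℝ (scalarField Ω f 0) x v) : ℝ) =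
      inner ℝ v (fderiv ℝ (scalarField Ω f 0) x u) := by
  have h := tendsto_scalarFieldDeriv_apply hn hb hΩ hf hx
  have h1 : ∀ a b : Space n, Tendsto (fun m => (inner ℝ a (scalarFieldDeriv Ω f (eps m) x b) : ℝ))
      atTop (𝓝 (inner ℝ a (fderiv ℝ (scalarField Ω f 0) x b))) := fun a b =>
    tendsto_const_nhds.inner (h b)
  refine tendsto_nhds_unique (h1 u v) ((h1 v u).congr fun m => ?_)
  exact inner_scalarFieldDeriv_comm hΩ hf.continuousOn (eps_pos m) x v u

/-- The divergence of the regularised field is the convolution of `f` with an approximate identity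
of mass `a_n`. -/
theorem trace_fderiv_scalarField (hn : 1 ≤ n) (hb : HasSmoothBoundary Ω) (hΩ : IsCompact Ω)
    (hf : ContDiffOn ℝ 1 f Ω) {x : Space n} (hx : x ∈ interior Ω) :
    ∑ i, (inner ℝ (EuclideanSpace.basisFun (Fin n) ℝ i)
      (fderiv ℝ (scalarField Ω f 0) x (EuclideanSpace.basisFun (Fin n) ℝ i)) : ℝ) =
      sphereVolume n * f x := by
  have h := tendsto_scalarFieldDeriv_apply hn hb hΩ hf hx
  have h1 := tendsto_finsetSum (Finset.univ : Finset (Fin n)) fun i _ =>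
    (tendsto_const_nhds (x := EuclideanSpace.basisFun (Fin n) ℝ i)).inner (𝕜 := ℝ)
      (h (EuclideanSpace.basisFun (Fin n) ℝ i))
  have hg : Integrable (Ω.indicator f) :=
    (integrable_indicator_iff hΩ.measurableSet).2 (hf.continuousOn.integrableOn_compact hΩ)
  have hnhds := mem_interior_iff_mem_nhds.1 hx
  have heq : Ω.indicator f =ᶠ[𝓝 x] f := by
    filter_upwards [hnhds] with y hy using Set.indicator_of_mem hy f
  have hgc : ContinuousAt (Ω.indicator f) x :=
    (hf.continuousOn.continuousAt hnhds).congr heq.symm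
  have h2 := tendsto_integral_div_kernel hn hg hgc
  rw [heq.eq_of_nhds] at h2
  refine tendsto_nhds_unique h1 (h2.congr fun m => ?_)
  have hε := eps_pos m
  simp only [inner_scalarFieldDeriv_apply hΩ hf.continuousOn hε]
  rw [← integral_finsetSum]
  · rw [← integral_indicator hΩ.measurableSet]
    congr 1
    funext y
    by_cases hy : y ∈ Ω
    · rw [Set.indicator_of_mem hy, Set.indicator_of_mem hy, ← Finset.mul_sum,
        sum_inner_kernelDeriv hε, mul_comm]
    · rw [Set.indicator_of_notMem hy, Set.indicator_of_notMem hy, mul_zero]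
  · intro i _
    have h3 : IntegrableOn (fun y => f y • kernelDeriv (eps m) (x - y)
        (EuclideanSpace.basisFun (Fin n) ℝ i)) Ω :=
      ContinuousOn.integrableOn_compact hΩ
        ((continuousOn_smul_kernelDeriv hf.continuousOn hε x).clm_apply continuousOn_const)
    simpa only [real_inner_smul_right] using
      h3.const_inner (𝕜 := ℝ) (EuclideanSpace.basisFun (Fin n) ℝ i)

theorem fderiv_scalarField_apply_eq_flowDeriv (hn : 1 ≤ n) (hb : HasSmoothBoundary Ω)
    (hΩ : IsCompact Ω) (hf : ContDiffOn ℝ 1 f Ω) {W : Space n → Space n} (hW : ContDiff ℝ 1 W)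
    (hc : HasCompactSupport W) (hflux : HasNoFlux Ω W) {x : Space n} (hx : x ∈ interior Ω) :
    fderiv ℝ (scalarField Ω f 0) x (W x) = flowDeriv Ω f W 0 x := by
  have hu := hb.uniqueDiffOn hΩ.isClosed
  obtain ⟨K, hK⟩ := exists_lipschitz_bound hW hc
  have h1 := tendsto_scalarFieldDeriv_apply hn hb hΩ hf hx (W x)
  have h2 := (tendstoUniformlyOn_flowDeriv hn hΩ hu hf hW.contDiffOn
    fun x _ y _ => hK x y).tendsto_at (interior_subset hx)
  refine tendsto_nhds_unique h1 (h2.congr fun m => ?_)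
  exact (scalarFieldDeriv_apply_eq_flowDeriv hΩ hu hf hW.contDiffOn hflux (eps_pos m) x).symm

theorem continuousOn_flowDeriv (hn : 1 ≤ n) (hb : HasSmoothBoundary Ω)
    (hΩ : IsCompact Ω) (hf : ContDiffOn ℝ 1 f Ω) {W : Space n → Space n} (hW : ContDiff ℝ 1 W)
    (hc : HasCompactSupport W) (hflux : HasNoFlux Ω W) :
    ContinuousOn (flowDeriv Ω f W 0) Ω := by
  have hu := hb.uniqueDiffOn hΩ.isClosed
  obtain ⟨K, hK⟩ := exists_lipschitz_bound hW hc
  refine (tendstoUniformlyOn_flowDeriv hn hΩ hu hf hW.contDiffOn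
    fun x _ y _ => hK x y).continuousOn (Frequently.of_forall fun m => ?_)
  have : flowDeriv Ω f W (eps m) = fun x => scalarFieldDeriv Ω f (eps m) x (W x) := funext fun x =>
    (scalarFieldDeriv_apply_eq_flowDeriv hΩ hu hf hW.contDiffOn hflux (eps_pos m) x).symm
  rw [this]
  exact ((continuous_scalarFieldDeriv hΩ hf.continuousOn (eps_pos m)).clm_apply
    hW.continuous).continuousOn

end Interior

/-! ### Differentiability of the field at boundary points -/

section Boundary

variable {n : ℕ} {Ω : Set (Space n)} {p : Space n} {ρ : Space n → ℝ} {ν : Space n} {r c M : ℝ}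

/-- Mean value inequality along `ν`, from a point of `Ω` inwards. -/
theorem norm_sub_le_of_ray {g : Space n → Space n} {g' : Space n → Space n →L[ℝ] Space n}
    {a : Space n} {τ η : ℝ} (hν : ‖ν‖ = 1) (hτ : 0 ≤ τ) (haΩ : a ∈ Ω) (hg : ContinuousOn g Ω)
    (hmem : ∀ s, 0 < s → s ≤ τ → a - s • ν ∈ interior Ω)
    (hg' : ∀ s, 0 < s → s ≤ τ → HasFDerivAt g (g' (a - s • ν)) (a - s • ν))
    (hη : ∀ s, 0 < s → s ≤ τ → ‖g' (a - s • ν)‖ ≤ η) :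
    ‖g a - g (a - τ • ν)‖ ≤ η * τ := by
  have hcurve : ∀ s, HasDerivAt (fun s : ℝ => a - (τ - s) • ν) ν s := by
    intro s
    have := (((hasDerivAt_id s).const_sub τ).smul_const ν).const_sub a
    simpa using this
  have h := norm_image_sub_le_of_norm_deriv_right_le_segment (a := 0) (b := τ) (C := η)
    (f := fun s : ℝ => g (a - (τ - s) • ν)) (f' := fun s => g' (a - (τ - s) • ν) ν) ?_ ?_ ?_
    τ ⟨hτ, le_rfl⟩
  · simpa using h
  · refine hg.comp (fun s _ => (hcurve s).continuousAt.continuousWithinAt) fun s hs => ?_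
    rcases hs.2.eq_or_lt with rfl | hlt
    · simpa using haΩ
    · exact interior_subset (hmem (τ - s) (by linarith) (by linarith [hs.1]))
  · intro s hs
    exact ((hg' (τ - s) (by linarith [hs.2]) (by linarith [hs.1])).comp_hasDerivAt s
      (hcurve s)).hasDerivWithinAt
  · intro s hs
    refine ((g' (a - (τ - s) • ν)).le_opNorm ν).trans ?_
    rw [hν, mul_one]
    exact hη (τ - s) (by linarith [hs.2]) (by linarith [hs.1])

/-- A function that is continuous on `Ω` and differentiable in the interior, with a derivative
that has a limit at a boundary point `p`, is differentiable within `Ω` at `p`. The points `p` and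
`x` are joined by a path of length `O(‖x - p‖)` that goes inwards along `-ν`, across, and back. -/
theorem IsBoundaryChart.hasFDerivWithinAt_of_tendsto (h : IsBoundaryChart Ω p ρ ν r c M)
    (hΩ : IsClosed Ω) (hp : p ∈ frontier Ω) {E : Space n → Space n} (hE : ContinuousOn E Ω)
    {L : Space n →L[ℝ] Space n}
    (hd : ∀ᶠ x in 𝓝[interior Ω] p, DifferentiableAt ℝ E x)
    (hL : Tendsto (fderiv ℝ E) (𝓝[interior Ω] p) (𝓝 L)) : HasFDerivWithinAt E L Ω p := by
  have hr := h.r_pos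
  have hc := h.c_pos
  have hM := h.M_nonneg
  have hp0 := h.eq_zero_of_mem_frontier hΩ (Metric.mem_ball_self hr) hp
  have hpΩ : p ∈ Ω := hΩ.frontier_subset hp
  -- at depth `κ ‖x - p‖` the function `ρ` is so negative that the crossing stays in the interior
  obtain ⟨κ, hκ0, hcκ⟩ : ∃ κ : ℝ, 0 < κ ∧ c * κ = M + c :=
    ⟨M / c + 1, by positivity, by field_simp⟩
  refine .of_isLittleO (Asymptotics.isLittleO_iff.2 fun η hη => ?_)
  obtain ⟨η', hη'0, hη'⟩ : ∃ η' : ℝ, 0 < η' ∧ η' * (2 * κ + 1) = η :=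
    ⟨η / (2 * κ + 1), by positivity, by field_simp⟩
  have hev : ∀ᶠ x in 𝓝[interior Ω] p, DifferentiableAt ℝ E x ∧ ‖fderiv ℝ E x - L‖ ≤ η' := by
    refine hd.and ?_
    filter_upwards [hL.eventually (Metric.closedBall_mem_nhds L hη'0)] with x hx
    simpa [dist_eq_norm] using hx
  rw [eventually_nhdsWithin_iff, Metric.eventually_nhds_iff_ball] at hev
  obtain ⟨δ, hδ, hδ'⟩ := hev
  obtain ⟨δ₁, hδ₁, hδ₁δ, hδ₁r⟩ : ∃ δ₁ : ℝ, 0 < δ₁ ∧ δ₁ ≤ δ ∧ δ₁ ≤ r :=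
    ⟨min δ r, lt_min hδ hr, min_le_left _ _, min_le_right _ _⟩
  let g : Space n → Space n := fun z => E z - L z
  have hgc : ContinuousOn g Ω := hE.sub L.continuous.continuousOn
  have hgd : ∀ z ∈ interior Ω, z ∈ Metric.ball p δ₁ →
      HasFDerivAt g (fderiv ℝ E z - L) z ∧ ‖fderiv ℝ E z - L‖ ≤ η' := by
    intro z hz hzb
    have := hδ' z (Metric.ball_subset_ball hδ₁δ hzb) hz
    exact ⟨this.1.hasFDerivAt.sub L.hasFDerivAt, this.2⟩
  have hsmall : ∀ᶠ x in 𝓝[Ω] p, ‖x - p‖ * (1 + κ) < δ₁ := by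
    refine nhdsWithin_le_nhds ?_
    have : Tendsto (fun x : Space n => ‖x - p‖ * (1 + κ)) (𝓝 p) (𝓝 (‖p - p‖ * (1 + κ))) :=
      Continuous.tendsto (by fun_prop) p
    rw [sub_self, norm_zero, zero_mul] at this
    exact this.eventually (gt_mem_nhds hδ₁)
  filter_upwards [hsmall, self_mem_nhdsWithin] with x hx hxΩ
  rcases eq_or_ne x p with rfl | hxp
  · simp
  have hd0 : 0 < ‖x - p‖ := norm_pos_iff.2 (sub_ne_zero.2 hxp)
  generalize hd_def : ‖x - p‖ = d at hx hd0
  obtain ⟨τ, hτ⟩ : ∃ τ : ℝ, τ = κ * d := ⟨_, rfl⟩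
  have hτ0 : 0 < τ := hτ ▸ mul_pos hκ0 hd0
  have hball : ∀ θ ∈ Set.Icc (0 : ℝ) 1, ∀ s ∈ Set.Icc 0 τ,
      p + θ • (x - p) - s • ν ∈ Metric.ball p δ₁ := by
    intro θ hθ s hs
    rw [mem_ball_iff_norm, show p + θ • (x - p) - s • ν - p = θ • (x - p) - s • ν by abel]
    calc _ ≤ ‖θ • (x - p)‖ + ‖s • ν‖ := norm_sub_le _ _
      _ = θ * d + s := by
        rw [norm_smul, norm_smul, h.norm_ν, mul_one, hd_def, Real.norm_of_nonneg hθ.1,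
          Real.norm_of_nonneg hs.1]
      _ ≤ 1 * d + τ := add_le_add (mul_le_mul_of_nonneg_right hθ.2 hd0.le) hs.2
      _ = d * (1 + κ) := by rw [hτ]; ring
      _ < δ₁ := hx
  have hpb : ∀ s ∈ Set.Icc 0 τ, p - s • ν ∈ Metric.ball p δ₁ := fun s hs => by
    simpa using hball 0 (by simp) s hs
  have hxb : ∀ s ∈ Set.Icc 0 τ, x - s • ν ∈ Metric.ball p δ₁ := fun s hs => by
    simpa using hball 1 (by simp) s hs
  have hsub : Metric.ball p δ₁ ⊆ Metric.ball p r := Metric.ball_subset_ball hδ₁r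
  have hxr : x ∈ Metric.ball p r := hsub (by simpa using hxb 0 ⟨le_rfl, hτ0.le⟩)
  have hx0 : ρ x ≤ 0 := (h.defining.mem_iff x hxr).1 hxΩ
  have hdown : ∀ a ∈ Metric.ball p r, ρ a ≤ 0 → ∀ s, 0 ≤ s → a - s • ν ∈ Metric.ball p r →
      ρ (a - s • ν) ≤ -(c * s) := by
    intro a ha ha0 s hs has
    have := h.add_mul_le hs has (by simpa using ha)
    rw [sub_add_cancel] at this
    linarith
  have hray : ∀ a ∈ Ω, a ∈ Metric.ball p r → ρ a ≤ 0 →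
      (∀ s ∈ Set.Icc 0 τ, a - s • ν ∈ Metric.ball p δ₁) → ‖g a - g (a - τ • ν)‖ ≤ η' * τ := by
    intro a haΩ ha ha0 hab
    have hmem : ∀ s, 0 < s → s ≤ τ → a - s • ν ∈ interior Ω := fun s hs hsτ => by
      have hb := hsub (hab s ⟨hs.le, hsτ⟩)
      refine h.mem_interior hb (lt_of_le_of_lt (hdown a ha ha0 s hs.le hb) ?_)
      have := mul_pos hc hs
      linarith
    exact norm_sub_le_of_ray (g' := fun z => fderiv ℝ E z - L) h.norm_ν hτ0.le haΩ hgc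
      hmem
      (fun s hs hsτ => (hgd _ (hmem s hs hsτ) (hab s ⟨hs.le, hsτ⟩)).1)
      (fun s hs hsτ => (hgd _ (hmem s hs hsτ) (hab s ⟨hs.le, hsτ⟩)).2)
  -- the three pieces of the path
  have e1 := hray p hpΩ (Metric.mem_ball_self hr) hp0.le hpb
  have e2 := hray x hxΩ hxr hx0 hxb
  have hseg : segment ℝ (p - τ • ν) (x - τ • ν) ⊆ interior Ω ∩ Metric.ball p δ₁ := by
    rw [segment_eq_image']
    rintro _ ⟨θ, hθ, rfl⟩
    have hb := hball θ hθ τ ⟨hτ0.le, le_rfl⟩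
    have e : p - τ • ν + θ • (x - τ • ν - (p - τ • ν)) = p + θ • (x - p) - τ • ν := by
      rw [sub_sub_sub_cancel_right]; abel
    simp only [e]
    refine ⟨h.mem_interior (hsub hb) ?_, hb⟩
    have hpτ := hsub (hpb τ ⟨hτ0.le, le_rfl⟩)
    have e3 := hdown p (Metric.mem_ball_self hr) hp0.le τ hτ0.le hpτ
    have e4 := (le_abs_self _).trans (h.abs_sub_le hpτ (hsub hb))
    rw [show p + θ • (x - p) - τ • ν - (p - τ • ν) = θ • (x - p) by abel, norm_smul,
      hd_def, Real.norm_of_nonneg hθ.1] at e4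
    have e5 : M * (θ * d) ≤ M * d :=
      mul_le_mul_of_nonneg_left (mul_le_of_le_one_left hd0.le hθ.2) hM
    have e6 : c * τ = M * d + c * d := by rw [hτ, ← mul_assoc, hcκ]; ring
    have := mul_pos hc hd0
    linarith
  have e3 := (convex_segment (p - τ • ν) (x - τ • ν)).norm_image_sub_le_of_norm_hasFDerivWithin_le
    (f := g) (C := η') (f' := fun z => fderiv ℝ E z - L)
    (fun z hz => (hgd z (hseg hz).1 (hseg hz).2).1.hasFDerivWithinAt)
    (fun z hz => (hgd z (hseg hz).1 (hseg hz).2).2)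
    (left_mem_segment ℝ _ _) (right_mem_segment ℝ _ _)
  rw [sub_sub_sub_cancel_right, hd_def] at e3
  have e4 : E x - E p - L (x - p) =
      (g x - g (x - τ • ν)) + (g (x - τ • ν) - g (p - τ • ν)) - (g p - g (p - τ • ν)) := by
    simp only [g, map_sub]
    abel
  rw [e4]
  calc _ ≤ ‖g x - g (x - τ • ν)‖ + ‖g (x - τ • ν) - g (p - τ • ν)‖ + ‖g p - g (p - τ • ν)‖ :=
        (norm_sub_le _ _).trans (add_le_add_left (norm_add_le _ _) _)
    _ ≤ η' * τ + η' * d + η' * τ := add_le_add (add_le_add e2 e3) e1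
    _ = η * d := by rw [hτ, ← hη']; ring

theorem IsBoundaryChart.mem_closure_interior (h : IsBoundaryChart Ω p ρ ν r c M)
    (hΩ : IsClosed Ω) (hp : p ∈ frontier Ω) : p ∈ closure (interior Ω) := by
  have hpb : p ∈ Metric.ball p r := Metric.mem_ball_self h.r_pos
  have h1 : Tendsto (fun t : ℝ => p - t • ν) (𝓝[>] 0) (𝓝 p) := by
    have : Tendsto (fun t : ℝ => p - t • ν) (𝓝 0) (𝓝 (p - (0 : ℝ) • ν)) :=
      Continuous.tendsto (by fun_prop) 0
    rw [zero_smul, sub_zero] at this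
    exact this.mono_left nhdsWithin_le_nhds
  refine mem_closure_of_tendsto h1 ?_
  filter_upwards [self_mem_nhdsWithin, h1.eventually (Metric.isOpen_ball.mem_nhds hpb)] with t ht hb
  have := h.add_smul_mem_interior (w := -ν) hpb (h.eq_zero_of_mem_frontier hΩ hpb hp).le ht
    (by simpa using h.c_pos) hb (by simpa [sub_eq_add_neg] using hb)
  simpa [sub_eq_add_neg] using this

end Boundary

/-! ### Differentiability of the field up to the boundary -/

theorem continuous_ofBasisValues {n : ℕ} : Continuous (ofBasisValues (n := n)) :=
  continuous_finsetSum _ fun j _ =>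
    (ContinuousLinearMap.smulRightL ℝ (Space n) (Space n)
      (EuclideanSpace.proj (𝕜 := ℝ) j : Space n →L[ℝ] ℝ)).continuous.comp (continuous_apply j)

section SymmetricOfTangential

variable {n : ℕ}

/-- If `D` is symmetric with trace `t` and `D e_j = R_j + β_j D ν`, this is `⟨ν, D ν⟩`. -/
def normalEntry (ν : Space n) (t : ℝ) (β : Fin n → ℝ) (R : Fin n → Space n) : ℝ :=
  (t - ∑ j, ((inner ℝ (EuclideanSpace.basisFun (Fin n) ℝ j) (R j) : ℝ) + β j * inner ℝ ν (R j))) /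
    ∑ j, β j ^ 2

/-- If `D` is symmetric with trace `t` and `D e_j = R_j + β_j D ν`, this is `D ν`. -/
def normalValue (ν : Space n) (t : ℝ) (β : Fin n → ℝ) (R : Fin n → Space n) : Space n :=
  ∑ j, ((inner ℝ ν (R j) : ℝ) + β j * normalEntry ν t β R) • EuclideanSpace.basisFun (Fin n) ℝ j

theorem sum_sq_ne_zero {ν : Space n} {β : Fin n → ℝ} (hβ : ∑ j, ν j * β j = 1) :
    ∑ j, β j ^ 2 ≠ 0 := by
  intro h0
  have := (Finset.sum_eq_zero_iff_of_nonneg fun j _ => sq_nonneg (β j)).1 h0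
  have h1 : ∑ j, ν j * β j = 0 := Finset.sum_eq_zero fun j hj => by
    rw [pow_eq_zero_iff two_ne_zero |>.1 (this j hj), mul_zero]
  exact zero_ne_one (h1.symm.trans hβ)

/-- A symmetric endomorphism `D` is determined by its trace and by its restriction to a hyperplane,
given here by the vectors `R_j = D e_j - β_j D ν` with `∑ ν_j β_j = 1`. -/
theorem eq_ofBasisValues_of_symmetric {ν : Space n} {t : ℝ} {β : Fin n → ℝ} {R : Fin n → Space n}
    {D : Space n →L[ℝ] Space n} (hβ : ∑ j, ν j * β j = 1)
    (hR : ∀ j, D (EuclideanSpace.basisFun (Fin n) ℝ j) = R j + β j • D ν)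
    (hsymm : ∀ u v, (inner ℝ u (D v) : ℝ) = inner ℝ v (D u))
    (htr : ∑ j, (inner ℝ (EuclideanSpace.basisFun (Fin n) ℝ j)
      (D (EuclideanSpace.basisFun (Fin n) ℝ j)) : ℝ) = t) :
    D = ofBasisValues fun j => R j + β j • normalValue ν t β R := by
  have hS := sum_sq_ne_zero hβ
  have hcol : ∀ j, (inner ℝ (EuclideanSpace.basisFun (Fin n) ℝ j) (D ν) : ℝ) =
      inner ℝ ν (R j) + β j * inner ℝ ν (D ν) := by
    intro j
    rw [hsymm, hR, inner_add_right, real_inner_smul_right]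
  have hτ : (inner ℝ ν (D ν) : ℝ) = normalEntry ν t β R := by
    rw [normalEntry, eq_div_iff hS, ← htr, ← Finset.sum_sub_distrib, Finset.mul_sum]
    refine Finset.sum_congr rfl fun j _ => ?_
    rw [hR, inner_add_right, real_inner_smul_right, hcol]
    ring
  have hν : D ν = normalValue ν t β R := by
    rw [← (EuclideanSpace.basisFun (Fin n) ℝ).sum_repr' (D ν), normalValue]
    simp only [hcol, hτ]
  refine clm_ext_basis fun j => ?_
  rw [ofBasisValues_apply_basis, hR, hν]

end SymmetricOfTangential

section BoundaryLimit

variable {n : ℕ} {Ω : Set (Space n)} {f : Space n → ℝ} {p : Space n} {ρ : Space n → ℝ}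
  {ν : Space n} {r c M : ℝ}

/-- Near a boundary point, the tangential derivatives of the field are integrals with weakly
singular kernels, hence continuous up to the boundary; the symmetry and the trace of the
differential then control the remaining derivative. -/
theorem IsBoundaryChart.exists_tendsto_fderiv_scalarField (h : IsBoundaryChart Ω p ρ ν r c M)
    (hn : 1 ≤ n) (hb : HasSmoothBoundary Ω) (hΩ : IsCompact Ω) (hf : ContDiffOn ℝ 1 f Ω)
    (hp : p ∈ Ω) :
    ∃ L, Tendsto (fderiv ℝ (scalarField Ω f 0)) (𝓝[interior Ω] p) (𝓝 L) := by
  have hr := h.r_pos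
  let χ : ContDiffBump p := ⟨r / 4, r / 2, by positivity, by linarith⟩
  have hχs : tsupport χ ⊆ Metric.ball p r := by
    rw [χ.tsupport_eq]
    exact Metric.closedBall_subset_ball (half_lt_self hr)
  have hχ1 : ∀ x ∈ Metric.ball p (r / 4), χ x = 1 := fun x hx =>
    χ.one_of_mem_closedBall (Metric.ball_subset_closedBall hx)
  let e : Fin n → Space n := fun j => EuclideanSpace.basisFun (Fin n) ℝ j
  let W : Fin n → Space n → Space n := fun j => tangentField ρ ν χ (e j)
  have hW : ∀ j, ContDiff ℝ 1 (W j) := fun j => h.contDiff_tangentField χ.contDiff hχs (e j)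
  have hWc : ∀ j, HasCompactSupport (W j) := fun j => χ.hasCompactSupport.smul_right
  have hflux : ∀ j, HasNoFlux Ω (W j) := fun j =>
    h.hasNoFlux_tangentField hb hΩ χ.contDiff hχs (e j)
  let β : Space n → Fin n → ℝ := fun x j => fderiv ℝ ρ x (e j) / fderiv ℝ ρ x ν
  let R : Space n → Fin n → Space n := fun x j => flowDeriv Ω f (W j) 0 x
  let G : Space n → Space n →L[ℝ] Space n := fun x =>
    ofBasisValues fun j => R x j + β x j • normalValue ν (sphereVolume n * f x) (β x) (R x)
  have hsum : ∀ x ∈ Metric.ball p r, ∑ j, ν j * β x j = 1 := by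
    intro x hx
    have hx0 : fderiv ℝ ρ x ν ≠ 0 := (h.c_pos.trans_le (h.le_fderiv x hx)).ne'
    have h1 : ∑ j, ν j * fderiv ℝ ρ x (e j) = fderiv ℝ ρ x ν := by
      conv_rhs => rw [← (EuclideanSpace.basisFun (Fin n) ℝ).sum_repr ν]
      simp [e]
    simp only [β, mul_div_assoc', ← Finset.sum_div]
    rw [h1, div_self hx0]
  have hG : ∀ x ∈ interior Ω ∩ Metric.ball p (r / 4), G x = fderiv ℝ (scalarField Ω f 0) x := by
    rintro x ⟨hx, hxb⟩
    refine (eq_ofBasisValues_of_symmetric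
      (hsum x (Metric.ball_subset_ball (by linarith) hxb)) (fun j => ?_)
      (fun u v => inner_fderiv_scalarField_comm hn hb hΩ hf hx u v)
      (trace_fderiv_scalarField hn hb hΩ hf hx)).symm
    have h1 := fderiv_scalarField_apply_eq_flowDeriv hn hb hΩ hf (hW j) (hWc j) (hflux j) hx
    have h2 : W j x = e j - β x j • ν := by
      simp only [W, tangentField, hχ1 x hxb, one_smul, β]
    rw [h2, map_sub, map_smul, sub_eq_iff_eq_add] at h1
    exact h1
  have hβc : ∀ j, ContinuousWithinAt (fun x => β x j) Ω p := fun j =>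
    ((h.contDiffOn_slope (e j)).continuousOn.continuousAt
      (Metric.ball_mem_nhds p hr)).continuousWithinAt
  have hRc : ∀ j, ContinuousWithinAt (fun x => R x j) Ω p := fun j =>
    continuousOn_flowDeriv hn hb hΩ hf (hW j) (hWc j) (hflux j) p hp
  have hinner : ∀ v j, ContinuousWithinAt (fun x => (inner ℝ v (R x j) : ℝ)) Ω p := fun v j =>
    (innerSL ℝ v).continuous.continuousAt.comp_continuousWithinAt (hRc j)
  have hfc := hf.continuousOn p hp
  have hS := sum_sq_ne_zero (hsum p (Metric.mem_ball_self hr))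
  have hτc : ContinuousWithinAt
      (fun x => normalEntry ν (sphereVolume n * f x) (β x) (R x)) Ω p := by
    refine Tendsto.div ?_ (tendsto_finsetSum _ fun j _ => (hβc j).pow 2) hS
    refine (hfc.const_mul _).sub (tendsto_finsetSum _ fun j _ => ?_)
    exact (hinner (e j) j).add ((hβc j).mul (hinner ν j))
  have hAc : ContinuousWithinAt
      (fun x => normalValue ν (sphereVolume n * f x) (β x) (R x)) Ω p :=
    tendsto_finsetSum _ fun j _ =>
      ((hinner ν j).add ((hβc j).mul hτc)).smul
        continuousWithinAt_const
  have hGc : ContinuousWithinAt G Ω p :=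
    continuous_ofBasisValues.continuousAt.comp_continuousWithinAt
      (continuousWithinAt_pi.2 fun j => (hRc j).add ((hβc j).smul hAc))
  refine ⟨G p, Tendsto.congr' ?_ (hGc.mono interior_subset)⟩
  filter_upwards [self_mem_nhdsWithin,
    nhdsWithin_le_nhds (Metric.ball_mem_nhds p (show 0 < r / 4 by positivity))] with x hx hxb
  exact hG x ⟨hx, hxb⟩

/-- The field of a `C¹` density `f` is differentiable within `Ω` at every point of `Ω`, with a
symmetric differential of trace `a_n f`. -/
theorem exists_hasFDerivWithinAt_scalarField (hn : 1 ≤ n) (hb : HasSmoothBoundary Ω)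
    (hΩ : IsCompact Ω) (hf : ContDiffOn ℝ 1 f Ω) {x : Space n} (hx : x ∈ Ω) :
    ∃ D : Space n →L[ℝ] Space n, HasFDerivWithinAt (scalarField Ω f 0) D Ω x ∧
      (∀ u v, (inner ℝ u (D v) : ℝ) = inner ℝ v (D u)) ∧
      ∑ i, (inner ℝ (EuclideanSpace.basisFun (Fin n) ℝ i)
        (D (EuclideanSpace.basisFun (Fin n) ℝ i)) : ℝ) = sphereVolume n * f x := by
  by_cases hi : x ∈ interior Ω
  · exact ⟨_, (hasFDerivAt_scalarField_zero hn hb hΩ hf hi).hasFDerivWithinAt,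
      inner_fderiv_scalarField_comm hn hb hΩ hf hi, trace_fderiv_scalarField hn hb hΩ hf hi⟩
  have hfr : x ∈ frontier Ω := ⟨subset_closure hx, hi⟩
  obtain ⟨ρ, ν, r, c, M, h⟩ := hb.exists_chart hfr
  obtain ⟨L, hL⟩ := h.exists_tendsto_fderiv_scalarField hn hb hΩ hf hx
  have : (𝓝[interior Ω] x).NeBot :=
    mem_closure_iff_nhdsWithin_neBot.1 (h.mem_closure_interior hΩ.isClosed hfr)
  have hLv : ∀ u v, Tendsto (fun y => (inner ℝ u (fderiv ℝ (scalarField Ω f 0) y v) : ℝ))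
      (𝓝[interior Ω] x) (𝓝 (inner ℝ u (L v))) := fun u v =>
    (((innerSL ℝ u).continuous.comp
      (ContinuousLinearMap.apply ℝ (Space n) v).continuous).tendsto L).comp hL
  refine ⟨L, ?_, fun u v => ?_, ?_⟩
  · refine h.hasFDerivWithinAt_of_tendsto hΩ.isClosed hfr
      (continuousOn_scalarField hn hΩ hf.continuousOn) ?_ hL
    filter_upwards [self_mem_nhdsWithin] with y hy
    exact (hasFDerivAt_scalarField_zero hn hb hΩ hf hy).differentiableAt
  · refine tendsto_nhds_unique (hLv u v) ((hLv v u).congr' ?_)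
    filter_upwards [self_mem_nhdsWithin] with y hy
    exact inner_fderiv_scalarField_comm hn hb hΩ hf hy v u
  · refine tendsto_nhds_unique (tendsto_finsetSum (Finset.univ : Finset (Fin n)) fun i _ =>
      hLv (EuclideanSpace.basisFun (Fin n) ℝ i) (EuclideanSpace.basisFun (Fin n) ℝ i)) ?_
    refine Tendsto.congr' ?_
      (((hf.continuousOn x hx).mono interior_subset).const_mul (sphereVolume n))
    filter_upwards [self_mem_nhdsWithin] with y hy
    exact (trace_fderiv_scalarField hn hb hΩ hf hy).symm

end BoundaryLimit

/-! ### Fields orthogonal to the kernel, and contractions of commuting fields -/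

section Contraction

variable {n : ℕ} {Ω : Set (Space n)}

theorem integrableOn_inner_kernel (hn : 1 ≤ n) (hΩ : IsCompact Ω) {W : Space n → Space n}
    (hW : ContinuousOn W Ω) (ε : ℝ) {x : Space n} (hx : x ∈ Ω) :
    IntegrableOn (fun y => (inner ℝ (kernel ε (x - y)) (W y) : ℝ)) Ω := by
  obtain ⟨B, hB⟩ := hΩ.exists_bound_of_continuousOn hW
  refine integrableOn_of_norm_le_majorant (C := B) hn hΩ hx ?_ fun y hy => ?_
  · exact ((measurable_kernel ε).comp
      (measurable_const.sub measurable_id)).aestronglyMeasurable.inner (𝕜 := ℝ)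
        (hW.aestronglyMeasurable hΩ.measurableSet)
  · refine (norm_inner_le_norm _ _).trans ?_
    rw [mul_comm]
    exact mul_le_mul (hB y hy) (norm_kernel_le _ _) (norm_nonneg _)
      ((norm_nonneg _).trans (hB y hy))

/-- A divergence-free field tangent to `∂Ω` is `L²`-orthogonal to all gradients; the regularised
kernel is a gradient, and the regularisation can be removed. -/
theorem setIntegral_inner_kernel_eq_zero (hn : 1 ≤ n) (hb : HasSmoothBoundary Ω)
    (hΩ : IsCompact Ω) {W : Space n → Space n} (hW : ContDiffOn ℝ 1 W Ω)
    (hdiv : ∀ y ∈ Ω, divergence Ω W y = 0) (htan : IsTangentToBoundary Ω W) {x : Space n}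
    (hx : x ∈ Ω) : ∫ y in Ω, (inner ℝ (kernel 0 (x - y)) (W y) : ℝ) = 0 := by
  have hu := hb.uniqueDiffOn hΩ.isClosed
  have hreg : ∀ ε : ℝ, 0 < ε → ∫ y in Ω, (inner ℝ (kernel ε (x - y)) (W y) : ℝ) = 0 := by
    intro ε hε
    obtain ⟨Γ, hΓ, hΓ'⟩ := exists_potential (n := n) hε
    have h0 := HasNoFlux.of_tangent hb hΩ hW htan (fun y => Γ (x - y))
      ((hΓ.comp (contDiff_const.sub contDiff_id)).contDiffOn)
    rw [← neg_eq_zero, ← integral_neg] at h0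
    rw [← h0]
    refine setIntegral_congr_fun hΩ.measurableSet fun y hy => ?_
    have h1 : HasFDerivAt (fun y : Space n => x - y) (-ContinuousLinearMap.id ℝ (Space n)) y :=
      (hasFDerivAt_id y).const_sub x
    have h2 : HasFDerivAt (fun y : Space n => Γ (x - y)) _ y := (hΓ' (x - y)).comp y h1
    simp only [hdiv y hy, mul_zero, zero_add, h2.hasFDerivWithinAt.fderivWithin (hu y hy)]
    simp
  obtain ⟨B, hB⟩ := hΩ.exists_bound_of_continuousOn hW.continuousOn
  have hlim := (tendstoUniformlyOn_setIntegral
    (Φ := fun ε x y => (inner ℝ (kernel ε (x - y)) (W y) : ℝ)) (C := |B|) hn hΩ (abs_nonneg B)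
    (fun ε x hx => integrableOn_inner_kernel hn hΩ hW.continuousOn ε hx)
    fun ε x hx y hy => by
      rw [← inner_sub_left]
      refine (norm_inner_le_norm _ _).trans ?_
      rw [mul_comm]
      refine mul_le_mul ((hB y hy).trans (le_abs_self B)) ?_ (norm_nonneg _) (abs_nonneg _)
      exact le_add_of_nonneg_right (by positivity)).tendsto_at hx
  refine tendsto_nhds_unique hlim ?_
  simp only [hreg _ (eps_pos _), tendsto_const_nhds_iff]

theorem divergence_sum {ι : Type*} [Fintype ι] {W : ι → Space n → Space n} {x : Space n}
    (hu : UniqueDiffWithinAt ℝ Ω x) (hW : ∀ i, DifferentiableWithinAt ℝ (W i) Ω x) :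
    divergence Ω (fun y => ∑ i, W i y) x = ∑ i, divergence Ω (W i) x := by
  simp only [divergence, fderivWithin_fun_sum hu fun i _ => hW i]
  rw [Finset.sum_comm]
  simp

/-- The vector field `Z` with `⟨u, Z⟩ = (u♭ ∧ θ)(V₀, …, V_k)` for every vector `u`. -/
def contract {k : ℕ} (θ : (Space n) [⋀^Fin k]→L[ℝ] ℝ) (V : Fin (k + 1) → Space n → Space n)
    (y : Space n) : Space n :=
  ∑ a : Fin (k + 1), ((-1) ^ (a : ℕ) * θ (a.removeNth fun i => V i y)) • V a y

variable {k : ℕ} {V : Fin (k + 1) → Space n → Space n}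

theorem contDiffOn_form_removeNth (θ : (Space n) [⋀^Fin k]→L[ℝ] ℝ)
    (hV : ∀ i, ContDiffOn ℝ 1 (V i) Ω) (a : Fin (k + 1)) :
    ContDiffOn ℝ 1 (fun y => θ (a.removeNth fun i => V i y)) Ω :=
  θ.toContinuousMultilinearMap.contDiff.comp_contDiffOn
    (contDiffOn_pi.2 fun i => hV (a.succAbove i))

theorem contDiffOn_contract (θ : (Space n) [⋀^Fin k]→L[ℝ] ℝ)
    (hV : ∀ i, ContDiffOn ℝ 1 (V i) Ω) : ContDiffOn ℝ 1 (contract θ V) Ω :=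
  ContDiffOn.sum fun a _ =>
    (contDiffOn_const.mul (contDiffOn_form_removeNth θ hV a)).smul (hV a)

/-- For commuting divergence-free fields the divergence of the contraction is
`dθ(V₀, …, V_k)`, and the constant form `θ` is closed. -/
theorem divergence_contract (hu : UniqueDiffOn ℝ Ω) (θ : (Space n) [⋀^Fin k]→L[ℝ] ℝ)
    (hV : ∀ i, ContDiffOn ℝ 1 (V i) Ω)
    (hcomm : ∀ i j, ∀ x ∈ Ω, VectorField.lieBracketWithin ℝ (V i) (V j) Ω x = 0)
    (hdiv : ∀ i, ∀ x ∈ Ω, divergence Ω (V i) x = 0) {x : Space n} (hx : x ∈ Ω) :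
    divergence Ω (contract θ V) x = 0 := by
  have hd : ∀ i, DifferentiableWithinAt ℝ (V i) Ω x := fun i =>
    (hV i).differentiableOn (by simp) x hx
  have hc : ∀ a : Fin (k + 1),
      DifferentiableWithinAt ℝ (fun y => θ (a.removeNth fun i => V i y)) Ω x := fun a =>
    (contDiffOn_form_removeNth θ hV a).differentiableOn (by simp) x hx
  have hext := extDerivWithin_apply_vectorField_of_pairwise_commute
    (differentiableWithinAt_const θ : DifferentiableWithinAt ℝ (fun _ : Space n => θ) Ω x) hd
    (hu x hx) fun i j _ => hcomm i j x hx
  have hclosed : extDerivWithin (fun _ : Space n => θ) Ω x = 0 := by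
    ext v
    simp [extDerivWithin, ContinuousAlternatingMap.alternatizeUncurryFin_apply]
  rw [hclosed] at hext
  calc divergence Ω (contract θ V) x
      = ∑ a : Fin (k + 1), (-1 : ℝ) ^ (a : ℕ) *
          fderivWithin ℝ (fun y => θ (a.removeNth fun i => V i y)) Ω x (V a x) := by
        unfold contract
        rw [divergence_sum (W := fun (a : Fin (k + 1)) y =>
          ((-1) ^ (a : ℕ) * θ (a.removeNth fun i => V i y)) • V a y)
          (hu x hx) fun a => ((hc a).const_mul _).smul (hd a)]
        refine Finset.sum_congr rfl fun a _ => ?_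
        rw [divergence_smul (hu x hx) ((hc a).const_mul _) (hd a), hdiv a x hx, mul_zero, zero_add,
          fderivWithin_const_mul (hu x hx) (hc a)]
        simp
    _ = 0 := by
        rw [eq_comm]
        simpa using hext

theorem isTangentToBoundary_contract (θ : (Space n) [⋀^Fin k]→L[ℝ] ℝ)
    (htan : ∀ i, IsTangentToBoundary Ω (V i)) : IsTangentToBoundary Ω (contract θ V) := by
  intro U ρ hU x hx
  rw [contract, map_sum]
  refine Finset.sum_eq_zero fun a _ => ?_
  rw [map_smul, htan a U ρ hU x hx, smul_zero]

theorem inner_wedgeVec_wedgeProd_eq_inner_contract (u : Space n) (C : MultiVec n k) (y : Space n) :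
    (inner ℝ (wedgeVec u C) (wedgeProd fun i => V i y) : ℝ) =
      inner ℝ u (contract (toForm n k C) V y) := by
  rw [inner_wedgeVec_wedgeProd, contract, inner_sum]
  refine Finset.sum_congr rfl fun a _ => ?_
  rw [real_inner_smul_right, toForm_apply]
  ring

end Contraction

/-! ### The curl of the Biot–Savart field -/

theorem removeNth_succ_cons {n k : ℕ} (a : Fin (k + 1)) (u : Space n)
    (b : Fin (k + 1) → Space n) :
    (a.succ.removeNth (Fin.cons u b : Fin (k + 2) → Space n) : Fin (k + 1) → Space n) =
      (Fin.cons u (a.removeNth b : Fin k → Space n) : Fin (k + 1) → Space n) := by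
  funext i
  refine Fin.cases ?_ (fun i => ?_) i
  · simp [Fin.removeNth]
  · simp [Fin.removeNth]

/-- Expansion of `∑ᵢ ι_{eᵢ}(D eᵢ ∧ w)` for a symmetric `D`. -/
theorem sum_inner_wedgeVec_wedgeVec_of_symmetric {n k : ℕ} {D : Space n →L[ℝ] Space n} {t : ℝ}
    (hsymm : ∀ u v, (inner ℝ u (D v) : ℝ) = inner ℝ v (D u))
    (htr : ∑ i, (inner ℝ (EuclideanSpace.basisFun (Fin n) ℝ i)
      (D (EuclideanSpace.basisFun (Fin n) ℝ i)) : ℝ) = t)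
    (w : MultiVec n (k + 1)) (b : Fin (k + 1) → Space n) :
    ∑ i, (inner ℝ (wedgeVec (D (EuclideanSpace.basisFun (Fin n) ℝ i)) w)
      (wedgeVec (EuclideanSpace.basisFun (Fin n) ℝ i) (wedgeProd b)) : ℝ) =
      t * inner ℝ w (wedgeProd b) - ∑ a : Fin (k + 1), (-1) ^ (a : ℕ) *
        (inner ℝ w (wedgeVec (D (b a)) (wedgeProd (a.removeNth b))) : ℝ) := by
  have hterm : ∀ e : Space n, (inner ℝ (wedgeVec (D e) w) (wedgeVec e (wedgeProd b)) : ℝ) =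
      inner ℝ e (D e) * inner ℝ w (wedgeProd b) - ∑ a : Fin (k + 1), (-1) ^ (a : ℕ) *
        (inner ℝ w (wedgeVec ((inner ℝ e (D (b a)) : ℝ) • e) (wedgeProd (a.removeNth b))) : ℝ) := by
    intro e
    rw [wedgeVec_wedgeProd, inner_wedgeVec_wedgeProd, Fin.sum_univ_succ, sub_eq_add_neg,
      ← Finset.sum_neg_distrib]
    congr 1
    · simp [real_inner_comm e]
    · refine Finset.sum_congr rfl fun a _ => ?_
      rw [removeNth_succ_cons, ← wedgeVec_wedgeProd, map_smul, LinearMap.smul_apply,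
        inner_smul_right_multiVec, Fin.cons_succ, real_inner_comm, hsymm, Fin.val_succ, pow_succ]
      ring
  simp only [hterm]
  rw [Finset.sum_sub_distrib, ← Finset.sum_mul, htr, Finset.sum_comm]
  congr 1
  refine Finset.sum_congr rfl fun a _ => ?_
  rw [← Finset.mul_sum, ← inner_sum]
  congr 2
  rw [← LinearMap.sum_apply, ← map_sum, (EuclideanSpace.basisFun (Fin n) ℝ).sum_repr']

/-- The cross product of a vector and a `k`-vector, as a bilinear map. -/
def crossVec {n k l : ℕ} (h : 1 + k + l = n) :
    Space n →ₗ[ℝ] MultiVec n k →ₗ[ℝ] MultiVec n l :=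
  LinearMap.mk₂ ℝ (fun u w => cross h (ofVec u) w)
    (fun u v w => by
      rw [cross, cross, cross, ← map_add]
      refine congrArg _ (Subtype.ext ?_)
      simp [coe_wedge_ofVec, add_mul])
    (fun a u w => by
      rw [cross, cross, ← map_smul]
      refine congrArg _ (Subtype.ext ?_)
      simp [coe_wedge_ofVec])
    (fun u v w => by
      rw [cross, cross, cross, ← map_add]
      refine congrArg _ (Subtype.ext ?_)
      simp [coe_wedge_ofVec, mul_add])
    (fun a u w => by
      rw [cross, cross, ← map_smul]
      refine congrArg _ (Subtype.ext ?_)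
      simp [coe_wedge_ofVec])

/-- The coordinate of a field of `k`-vectors along `e_I`. -/
def coord {n k : ℕ} (X : Space n → MultiVec n k) (I : Set.powersetCard (Fin n) k) (y : Space n) :
    ℝ :=
  inner ℝ (stdBasis n k I) (X y)

theorem sum_coord_smul {n k : ℕ} (X : Space n → MultiVec n k) (y : Space n) :
    ∑ I, coord X I y • stdBasis n k I = X y := by
  simp only [coord, stdBasis_eq_orthonormalBasis]
  exact ((EuclideanSpace.basisFun (Fin n) ℝ).exteriorPower k).sum_repr' (X y)

section Curl

variable {n k l : ℕ} {Ω : Set (Space n)}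

theorem bsIntegrand_eq_sum (h : 1 + k + l = n) (X : Space n → MultiVec n k) (x y : Space n) :
    bsIntegrand h X x y = ∑ I, ((crossVec h).flip (stdBasis n k I)).toContinuousLinearMap
      (coord X I y • kernel 0 (x - y)) := by
  conv_lhs => rw [bsIntegrand, ← sum_coord_smul X y, ← kernel_zero_eq]
  change crossVec h _ _ = _
  rw [map_sum]
  refine Finset.sum_congr rfl fun I _ => ?_
  rw [map_smul, map_smul]
  rfl

theorem integrableOn_bsIntegrand (h : 1 + k + l = n) (hΩ : IsCompact Ω)
    {X : Space n → MultiVec n k} (hX : ∀ I, ContinuousOn (coord X I) Ω) {x : Space n}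
    (hx : x ∈ Ω) : IntegrableOn (bsIntegrand h X x) Ω := by
  rw [show bsIntegrand h X x = _ from funext (bsIntegrand_eq_sum h X x)]
  exact integrable_finsetSum _ fun I _ =>
    ContinuousLinearMap.integrable_comp _ (integrableOn_smul_kernel (by omega) hΩ (hX I) 0 hx)

theorem biotSavart_eq_sum (h : 1 + k + l = n) (hΩ : IsCompact Ω)
    {X : Space n → MultiVec n k} (hX : ∀ I, ContinuousOn (coord X I) Ω) {x : Space n}
    (hx : x ∈ Ω) : biotSavart h Ω X x = ((-1 : ℝ) ^ k / sphereVolume n) •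
      ∑ I, ((crossVec h).flip (stdBasis n k I)).toContinuousLinearMap
        (scalarField Ω (coord X I) 0 x) := by
  have hi := fun I => integrableOn_smul_kernel (n := n) (by omega) hΩ (hX I) 0 hx
  rw [biotSavart, show bsIntegrand h X x = _ from funext (bsIntegrand_eq_sum h X x)]
  rw [integral_finsetSum _ fun I _ => ContinuousLinearMap.integrable_comp _ (hi I)]
  simp only [fun I => ContinuousLinearMap.integral_comp_comm
    ((crossVec h).flip (stdBasis n k I)).toContinuousLinearMap (hi I), scalarField]

/-- The curl of the Biot–Savart field in terms of the differentials `D_I` of the scalar fields. -/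
theorem rot_biotSavart_eq (h : 1 + k + l = n) (h' : l + 1 + k = n) (hΩ : IsCompact Ω)
    {X : Space n → MultiVec n k} (hX : ∀ I, ContinuousOn (coord X I) Ω) {x : Space n}
    (hx : x ∈ Ω) (hu : UniqueDiffWithinAt ℝ Ω x)
    {D : Set.powersetCard (Fin n) k → Space n →L[ℝ] Space n}
    (hD : ∀ I, HasFDerivWithinAt (scalarField Ω (coord X I) 0) (D I) Ω x) :
    DifferentiableWithinAt ℝ (biotSavart h Ω X) Ω x ∧
      ∀ B, (inner ℝ (rot h' Ω (biotSavart h Ω X) x) B : ℝ) = (sphereVolume n)⁻¹ *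
        ∑ I, ∑ i, inner ℝ
          (wedgeVec (D I (EuclideanSpace.basisFun (Fin n) ℝ i)) (stdBasis n k I))
          (wedgeVec (EuclideanSpace.basisFun (Fin n) ℝ i) B) := by
  have hder : HasFDerivWithinAt (biotSavart h Ω X) (((-1 : ℝ) ^ k / sphereVolume n) •
      ∑ I, ((crossVec h).flip (stdBasis n k I)).toContinuousLinearMap.comp (D I)) Ω x := by
    refine HasFDerivWithinAt.congr ?_ (fun y hy => biotSavart_eq_sum h hΩ hX hy)
      (biotSavart_eq_sum h hΩ hX hx)
    have hI : ∀ I, HasFDerivWithinAt (fun y => ((crossVec h).flip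
        (stdBasis n k I)).toContinuousLinearMap (scalarField Ω (coord X I) 0 y))
        (((crossVec h).flip (stdBasis n k I)).toContinuousLinearMap.comp (D I)) Ω x := fun I =>
      ((crossVec h).flip (stdBasis n k I)).toContinuousLinearMap.hasFDerivAt.comp_hasFDerivWithinAt
        x (hD I)
    exact (HasFDerivWithinAt.fun_sum (𝕜 := ℝ) (u := Finset.univ) fun I _ => hI I).const_smul
      ((-1 : ℝ) ^ k / sphereVolume n)
  refine ⟨hder.differentiableWithinAt, fun B => ?_⟩
  -- the signs in `rot`, in the Biot–Savart integral and in `* (e ∧ * ·)` cancel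
  have hsign : (-1 : ℝ) ^ ((l + 1) * k) * ((-1) ^ k / sphereVolume n * (-1) ^ (l * k)) =
      (sphereVolume n)⁻¹ := by
    rw [add_mul, one_mul, pow_add]
    rcases neg_one_pow_eq_or ℝ (l * k) with h1 | h1 <;>
      rcases neg_one_pow_eq_or ℝ k with h2 | h2 <;> rw [h1, h2] <;> ring
  rw [rot, nabla_eq_sum hder hu, inner_smul_left_multiVec, ← hsign, mul_assoc]
  congr 1
  have h1 : ∀ i, (inner ℝ (hodge h' (wedgeVec (EuclideanSpace.basisFun (Fin n) ℝ i)
      ((((-1 : ℝ) ^ k / sphereVolume n) •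
        ∑ I, ((crossVec h).flip (stdBasis n k I)).toContinuousLinearMap.comp (D I))
        (EuclideanSpace.basisFun (Fin n) ℝ i)))) B : ℝ) =
      ((-1) ^ k / sphereVolume n * (-1) ^ (l * k)) * ∑ I, inner ℝ
          (wedgeVec (D I (EuclideanSpace.basisFun (Fin n) ℝ i)) (stdBasis n k I))
          (wedgeVec (EuclideanSpace.basisFun (Fin n) ℝ i) B) := by
    intro i
    rw [smul_apply, sum_apply, map_smul, map_smul, inner_smul_left_multiVec, map_sum, map_sum,
      sum_inner, mul_assoc]
    congr 1
    rw [Finset.mul_sum]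
    refine Finset.sum_congr rfl fun I _ => ?_
    exact inner_hodge_wedgeVec_hodge h h' _ _ _ _
  rw [map_sum, sum_inner]
  simp only [h1]
  rw [← Finset.mul_sum, Finset.sum_comm]

end Curl

section Main

variable {n k : ℕ} {Ω : Set (Space n)} {V : Fin (k + 1) → Space n → Space n}

theorem contDiffOn_coord_wedgeProd {k : ℕ} {V : Fin k → Space n → Space n}
    (hV : ∀ i, ContDiffOn ℝ 1 (V i) Ω) (I : Set.powersetCard (Fin n) k) :
    ContDiffOn ℝ 1 (coord (fun y => wedgeProd fun i => V i y) I) Ω :=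
  (toForm n k (stdBasis n k I)).toContinuousMultilinearMap.contDiff.comp_contDiffOn
    (contDiffOn_pi.2 hV)

/-- The scalar fields of the coordinates of `V` satisfy `∑_I ⟨e_I, E_I ∧ C⟩ = 0` on `Ω`: this is
the integral of `⟨K(x - y), Z(y)⟩` for the divergence-free tangent field `Z` that arises by
contracting `V` with `C`. -/
theorem sum_inner_wedgeVec_scalarField_eq_zero (hn : 1 ≤ n) (hb : HasSmoothBoundary Ω)
    (hΩ : IsCompact Ω) (hV : ∀ i, ContDiffOn ℝ 1 (V i) Ω)
    (hcomm : ∀ i j, ∀ x ∈ Ω, VectorField.lieBracketWithin ℝ (V i) (V j) Ω x = 0)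
    (hdiv : ∀ i, ∀ x ∈ Ω, divergence Ω (V i) x = 0)
    (htan : ∀ i, IsTangentToBoundary Ω (V i)) (C : MultiVec n k) {x : Space n} (hx : x ∈ Ω) :
    ∑ I, (inner ℝ (stdBasis n (k + 1) I) (wedgeVec
      (scalarField Ω (coord (fun y => wedgeProd fun i => V i y) I) 0 x) C) : ℝ) = 0 := by
  have hu := hb.uniqueDiffOn hΩ.isClosed
  let S : Set.powersetCard (Fin n) (k + 1) → Space n →L[ℝ] ℝ := fun I =>
    ((innerₗ (MultiVec n (k + 1)) (stdBasis n (k + 1) I)).comp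
      (wedgeVec.flip C)).toContinuousLinearMap
  have hi := fun I => integrableOn_smul_kernel hn hΩ (contDiffOn_coord_wedgeProd hV I).continuousOn
    0 hx
  have h0 := setIntegral_inner_kernel_eq_zero hn hb hΩ (contDiffOn_contract (toForm n k C) hV)
    (fun y hy => divergence_contract hu (toForm n k C) hV hcomm hdiv hy)
    (isTangentToBoundary_contract (toForm n k C) htan) hx
  change ∑ I, S I (∫ y in Ω, coord (fun y => wedgeProd fun i => V i y) I y • kernel 0 (x - y)) = 0
  simp only [← fun I => ContinuousLinearMap.integral_comp_comm (S I) (hi I)]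
  rw [← integral_finsetSum _ fun I _ => ContinuousLinearMap.integrable_comp _ (hi I)]
  refine Eq.trans ?_ h0
  congr 1
  funext y
  rw [← inner_wedgeVec_wedgeProd_eq_inner_contract,
    ← sum_coord_smul (fun y => wedgeProd fun i => V i y) y, inner_sum]
  refine Finset.sum_congr rfl fun I _ => ?_
  rw [map_smul, inner_smul_right_multiVec, real_inner_comm]
  rfl

/-- The derivative within `Ω` of `sum_inner_wedgeVec_scalarField_eq_zero`. -/
theorem sum_inner_wedgeVec_fderiv_eq_zero (hn : 1 ≤ n) (hb : HasSmoothBoundary Ω)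
    (hΩ : IsCompact Ω) (hV : ∀ i, ContDiffOn ℝ 1 (V i) Ω)
    (hcomm : ∀ i j, ∀ x ∈ Ω, VectorField.lieBracketWithin ℝ (V i) (V j) Ω x = 0)
    (hdiv : ∀ i, ∀ x ∈ Ω, divergence Ω (V i) x = 0)
    (htan : ∀ i, IsTangentToBoundary Ω (V i)) {x : Space n} (hx : x ∈ Ω)
    {D : Set.powersetCard (Fin n) (k + 1) → Space n →L[ℝ] Space n}
    (hD : ∀ I, HasFDerivWithinAt
      (scalarField Ω (coord (fun y => wedgeProd fun i => V i y) I) 0) (D I) Ω x)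
    (u : Space n) (C : MultiVec n k) :
    ∑ I, (inner ℝ (stdBasis n (k + 1) I) (wedgeVec (D I u) C) : ℝ) = 0 := by
  let S : Set.powersetCard (Fin n) (k + 1) → Space n →L[ℝ] ℝ := fun I =>
    ((innerₗ (MultiVec n (k + 1)) (stdBasis n (k + 1) I)).comp
      (wedgeVec.flip C)).toContinuousLinearMap
  have h1 : HasFDerivWithinAt (fun y => ∑ I, S I
      (scalarField Ω (coord (fun y => wedgeProd fun i => V i y) I) 0 y))
      (∑ I, (S I).comp (D I)) Ω x := by
    have hI : ∀ I, HasFDerivWithinAt (fun y => S I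
        (scalarField Ω (coord (fun y => wedgeProd fun i => V i y) I) 0 y))
        ((S I).comp (D I)) Ω x := fun I =>
      (S I).hasFDerivAt.comp_hasFDerivWithinAt x (hD I)
    exact HasFDerivWithinAt.fun_sum fun I _ => hI I
  have hzero := fun y (hy : y ∈ Ω) =>
    sum_inner_wedgeVec_scalarField_eq_zero hn hb hΩ hV hcomm hdiv htan C hy
  have h2 := (hasFDerivWithinAt_const (𝕜 := ℝ) (0 : ℝ) x Ω).congr hzero (hzero x hx)
  have h3 := DFunLike.congr_fun ((hb.uniqueDiffOn hΩ.isClosed x hx).eq h1 h2) u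
  rw [sum_apply] at h3
  exact h3

theorem rot_biotSavart_wedgeProd {l : ℕ} (hn : 1 + (k + 1) + l = n) (h' : l + 1 + (k + 1) = n)
    (hb : HasSmoothBoundary Ω) (hΩ : IsCompact Ω) (hV : ∀ i, ContDiffOn ℝ 1 (V i) Ω)
    (hcomm : ∀ i j, ∀ x ∈ Ω, VectorField.lieBracketWithin ℝ (V i) (V j) Ω x = 0)
    (hdiv : ∀ i, ∀ x ∈ Ω, divergence Ω (V i) x = 0)
    (htan : ∀ i, IsTangentToBoundary Ω (V i)) {x : Space n} (hx : x ∈ Ω) :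
    DifferentiableWithinAt ℝ (biotSavart hn Ω fun y => wedgeProd fun i => V i y) Ω x ∧
      rot h' Ω (biotSavart hn Ω fun y => wedgeProd fun i => V i y) x =
        wedgeProd fun i => V i x := by
  have hn1 : 1 ≤ n := by omega
  have hf := contDiffOn_coord_wedgeProd (Ω := Ω) hV
  choose D hD hsymm htr using fun I =>
    exists_hasFDerivWithinAt_scalarField hn1 hb hΩ (hf I) hx
  obtain ⟨hdiff, hrot⟩ := rot_biotSavart_eq hn h' hΩ (fun I => (hf I).continuousOn) hx
    (hb.uniqueDiffOn hΩ.isClosed x hx) hD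
  refine ⟨hdiff, ext_inner_right ℝ fun B => ?_⟩
  induction B using wedgeProd_induction with
  | hp b =>
    have ha := (sphereVolume_pos hn1).ne'
    rw [hrot]
    simp only [fun I => sum_inner_wedgeVec_wedgeVec_of_symmetric (hsymm I) (htr I)
      (stdBasis n (k + 1) I) b]
    rw [Finset.sum_sub_distrib, Finset.sum_comm]
    simp only [← Finset.mul_sum, sum_inner_wedgeVec_fderiv_eq_zero hn1 hb hΩ hV hcomm hdiv htan
      hx hD, mul_zero, Finset.sum_const_zero, sub_zero, mul_assoc]
    rw [inv_mul_cancel_left₀ ha]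
    conv_rhs => rw [← sum_coord_smul (fun y => wedgeProd fun i => V i y) x, sum_inner]
    simp only [inner_smul_left_multiVec]
  | h0 => simp
  | hadd B B' h h' => rw [inner_add_right, inner_add_right, h, h']
  | hsmul a B h => rw [inner_smul_right_multiVec, inner_smul_right_multiVec, h]

end Main

end Multivector

end

theorem mainTheorem5 (n k l : ℕ) (hk : 1 ≤ k) (hn : 1 + k + l = n)
    (Ω : Set (Multivector.Space n)) (hΩ : IsCompact Ω) (hbdry : Multivector.HasSmoothBoundary Ω)
    (V : Fin k → Multivector.Space n → Multivector.Space n)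
    (hsmooth : ∀ i, ContDiffOn ℝ ∞ (V i) Ω)
    (hcomm : ∀ i j, ∀ x ∈ Ω, VectorField.lieBracketWithin ℝ (V i) (V j) Ω x = 0)
    (hdiv : ∀ i, ∀ x ∈ Ω, Multivector.divergence Ω (V i) x = 0)
    (htan : ∀ i, Multivector.IsTangentToBoundary Ω (V i)) :
    ∀ x ∈ Ω,
      MeasureTheory.IntegrableOn
        (Multivector.bsIntegrand hn (fun y => Multivector.wedgeProd fun i => V i y) x) Ω ∧
      DifferentiableWithinAt ℝ
        (Multivector.biotSavart hn Ω fun y => Multivector.wedgeProd fun i => V i y) Ω x ∧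
      Multivector.rot (l := k) (by omega) Ω
        (Multivector.biotSavart hn Ω fun y => Multivector.wedgeProd fun i => V i y) x =
          Multivector.wedgeProd fun i => V i x := by
  intro x hx
  have hV : ∀ i, ContDiffOn ℝ 1 (V i) Ω := fun i => (hsmooth i).of_le (by simp)
  obtain ⟨k, rfl⟩ : ∃ k', k = k' + 1 := ⟨k - 1, by omega⟩
  exact ⟨Multivector.integrableOn_bsIntegrand hn hΩ
      (fun I => (Multivector.contDiffOn_coord_wedgeProd hV I).continuousOn) hx,
    Multivector.rot_biotSavart_wedgeProd hn (by omega) hbdry hΩ hV hcomm hdiv htan hx⟩
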